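/- Let $h>0$ and let $\alpha,\beta\in L^\infty(\mathbb R;(0,\infty))$ with $\inf\alpha>0$ and $\inf\beta>0$, where $\beta$ is given as a Borel function. Let $V=V_0+V_1$, where $V_0$ is a finite signed Borel measure on $\mathbb R$ and $V_1\in L^\infty(\mathbb R;\mathbb R)$, and let $b=b_0+b_1$ with $b_0\in L^2(\mathbb R;\mathbb R)$ and $b_1\in L^\infty(\mathbb R;\mathbb R)$. Write $D_x=-i\partial_x$, let $u_c$ denote the continuous representative of $u$, and for a function $f$ of locally bounded variation (that is, one whose real and imaginary parts are each a difference of increasing functions) let $df$ denote its distributional derivative, a locally finite complex Borel measure. Where it makes sense, define in the sense of distributions $$P(h)u:=\beta\,d(-h^2\alpha u'-ihbu)+h\beta b\,D_xu+u_cV ,$$ and set $$\mathcal D:=\{u\in H^1(\mathbb R):\ h\alpha u'+ibu\in L^\infty(\mathbb R)\text{ has locally bounded variation, and } P(h)u\in L^2(\mathbb R)\}.$$ Then $\mathcal D$ is a dense subspace of $L^2(\mathbb R;\beta^{-1}dx)$, and the operator $P(h)$ with domain $\mathcal D$ is self-adjoint on $L^2(\mathbb R;\beta^{-1}dx)$.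 Moreover $\mathcal D$ equals the maximal domain $$\mathcal D_{\max}:=\{u\in L^2(\mathbb R):\ u'\in L^1_{\rm loc}(\mathbb R),\ h\alpha u'+ibu\text{ has locally bounded variation, and }P(h)u\in L^2(\mathbb R)\}.$$ -/

import Mathlib

namespace MagSchr

open MeasureTheory

/-- Complex-valued test functions on the line: smooth with compact support. -/
def IsTest (φ : ℝ → ℂ) : Prop :=
  ContDiff ℝ (⊤ : ℕ∞) φ ∧ HasCompactSupport φ

/-- The locally integrable function `v` is the distributional derivative of the locally integrable
function `u`. -/
def IsWeakDeriv (u v : ℝ → ℂ) : Prop :=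
  LocallyIntegrable u volume ∧ LocallyIntegrable v volume ∧
    ∀ φ : ℝ → ℂ, IsTest φ → ∫ x, u x * deriv φ x = -∫ x, v x * φ x

/-- A function `f : ℝ → ℂ` of locally bounded variation, presented as
`f = f_{r,+} - f_{r,-} + i (f_{i,+} - f_{i,-})` with (not necessarily bounded) increasing
functions on the right. -/
structure LocBV (f : ℝ → ℂ) where
  rePos : ℝ → ℝ
  reNeg : ℝ → ℝ
  imPos : ℝ → ℝ
  imNeg : ℝ → ℝ
  rePos_mono : Monotone rePos
  reNeg_mono : Monotone reNeg
  imPos_mono : Monotone imPos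
  imNeg_mono : Monotone imNeg
  eq : ∀ x, f x = ((rePos x - reNeg x : ℝ) : ℂ) + Complex.I * ((imPos x - imNeg x : ℝ) : ℂ)

/-- The Borel measure `μ` of an increasing function `g`,
`μ (x₁, x₂] = g^R(x₂) - g^R(x₁)` with `g^R` the right limit. -/
noncomputable def monoMeasure {g : ℝ → ℝ} (hg : Monotone g) : Measure ℝ :=
  hg.stieltjesFunction.measure

/-- `∫ g df`, where
`df = μ_{r,+} - μ_{r,-} + i (μ_{i,+} - μ_{i,-})` is the (locally finite complex) measure of `f`.
For `g` of compact support and integrable for the four measures the value does not depend on the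
presentation of `f`. -/
noncomputable def LocBV.integral {f : ℝ → ℂ} (F : LocBV f) (g : ℝ → ℂ) : ℂ :=
  ((∫ x, g x ∂(monoMeasure F.rePos_mono)) - ∫ x, g x ∂(monoMeasure F.reNeg_mono)) +
    Complex.I *
      ((∫ x, g x ∂(monoMeasure F.imPos_mono)) - ∫ x, g x ∂(monoMeasure F.imNeg_mono))

/-- `β` is locally integrable for `df`, so that `β df` is a measure on bounded Borel sets. For a
bounded Borel function `β` this always holds; it only matters when `β` is unbounded on a Lebesgue
null set. -/
def LocBV.LocInt {f : ℝ → ℂ} (F : LocBV f) (β : ℝ → ℝ) : Prop :=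
  LocallyIntegrable β (monoMeasure F.rePos_mono) ∧
    LocallyIntegrable β (monoMeasure F.reNeg_mono) ∧
    LocallyIntegrable β (monoMeasure F.imPos_mono) ∧
    LocallyIntegrable β (monoMeasure F.imNeg_mono)

/-- The integral against a finite signed Borel measure (through its Jordan decomposition). -/
noncomputable def signedIntegral (ν : SignedMeasure ℝ) (g : ℝ → ℂ) : ℂ :=
  (∫ x, g x ∂ν.toJordanDecomposition.posPart) - ∫ x, g x ∂ν.toJordanDecomposition.negPart

/-- The measure `β⁻¹ dx`. -/
noncomputable def weight (β : ℝ → ℝ) : Measure ℝ :=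
  volume.withDensity (fun x => ENNReal.ofReal ((β x)⁻¹))

/-- The Hilbert space `L²(ℝ; β⁻¹ dx)`. -/
abbrev L2 (β : ℝ → ℝ) : Type := Lp ℂ 2 (weight β)

/-- `Acts h α β b V₀ V₁ u uc u' f w` says: `uc` is the continuous representative of `u`, `u'` is the
distributional derivative of `u`, `f` is a representative of `h α u' + i b u` of locally bounded
variation, and
`β d(-h² α u' - i h b u) + h β b D_x u + u_c (V₀ + V₁) = w` in the sense of distributions, where
`D_x = -i ∂_x`. -/
def Acts (h : ℝ) (α β b : ℝ → ℝ) (V₀ : SignedMeasure ℝ) (V₁ : ℝ → ℝ)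
    (u uc u' f w : ℝ → ℂ) : Prop :=
  Continuous uc ∧ u =ᵐ[volume] uc ∧ IsWeakDeriv uc u' ∧
    f =ᵐ[volume] (fun x => (h : ℂ) * (α x : ℂ) * u' x + Complex.I * (b x : ℂ) * uc x) ∧
    ∃ F : LocBV f, F.LocInt β ∧
      ∀ φ : ℝ → ℂ, IsTest φ →
        -(h : ℂ) * F.integral (fun x => φ x * (β x : ℂ))
          + (∫ x, φ x * ((h : ℂ) * (β x : ℂ) * (b x : ℂ) * (-Complex.I * u' x)))
          + signedIntegral V₀ (fun x => φ x * uc x)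
          + (∫ x, φ x * (uc x * (V₁ x : ℂ)))
        = ∫ x, φ x * w x

/-- `u` belongs to the domain `𝒟` and `P(h)u = w`: here `u ∈ H¹(ℝ)`, the function `h α u' + i b u`
is in `L^∞` and of locally bounded variation, and `w ∈ L²(ℝ)`. -/
def IsOp (h : ℝ) (α β b : ℝ → ℝ) (V₀ : SignedMeasure ℝ) (V₁ : ℝ → ℝ) (u w : ℝ → ℂ) : Prop :=
  ∃ uc u' f : ℝ → ℂ, Acts h α β b V₀ V₁ u uc u' f w ∧
    MemLp u 2 volume ∧ MemLp u' 2 volume ∧ MemLp f ⊤ volume ∧ MemLp w 2 volume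

/-- The domain `𝒟`. -/
def dom (h : ℝ) (α β b : ℝ → ℝ) (V₀ : SignedMeasure ℝ) (V₁ : ℝ → ℝ) : Set (L2 β) :=
  {u | ∃ w : ℝ → ℂ, IsOp h α β b V₀ V₁ u w}

/-- The maximal domain: all `u ∈ L²(ℝ)` with a locally integrable distributional derivative, such
that `h α u' + i b u` has locally bounded variation and `P(h)u`, taken in the sense of
distributions, belongs to `L²(ℝ)`. -/
def maxDom (h : ℝ) (α β b : ℝ → ℝ) (V₀ : SignedMeasure ℝ) (V₁ : ℝ → ℝ) : Set (L2 β) :=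
  {u | ∃ uc u' f w : ℝ → ℂ, Acts h α β b V₀ V₁ u uc u' f w ∧
    MemLp u 2 volume ∧ MemLp w 2 volume}

end MagSchr

namespace MagSchr

open MeasureTheory Set Filter Topology

/-! Put f = h α u' + i b u. Divided by `β`, the equation P(h)u = w becomes an identity of measures,
h df = h b D_x u dx + ((u V₁ - w)/β) dx + (u/β) V₀. Pairing it with v and integrating by parts gives
q(u, v) = ∫ w v/β, where q is the bilinear `form`. The sesquilinear form q(u, v̄) is hermitian, and
this is the symmetry of P(h) in L²(β⁻¹dx).

The form lives on H¹. The inequality |u(x)|² ≤ (2/δ)‖u‖² + 2δ‖u'‖², with δ > 0 free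
(`IsH1.norm_sq_le`), makes both the finite measure V₀ and the integrable weight b₀² perturbations of
relative bound zero. Hence q is bounded on H¹ and Re q(u, ū) ≥ κ‖u'‖² - Λ‖u‖² with κ > 0
(`exists_form_lower_bound`). Lax–Milgram then makes P(h) + l surjective for some real l, and a
symmetric operator with a surjective real shift is densely defined and self-adjoint (`dense_domain`,
`isSelfAdjoint_toLinearPMap`).

Three regularity facts connect q with the definition of the operator. Since `β` is merely Borel, φ/β
is not a test function; but an identity of measures that holds on test functions holds on bounded
Borel functions of compact support, which permits the division by `β` (`ActsOn.integral_flux`), and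
conversely a weak solution has a flux of locally bounded variation (`exists_actsOn`). The flux of an
H¹ solution is bounded, being square integrable with bounded oscillation on unit intervals
(`ActsOn.memLp_top_flux`). Finally, a function of the maximal domain has u' locally in L², because f
is locally bounded, and testing with χ²ū for cut-offs χ bounds u' in L² uniformly
(`re_integrand_cutoff`, `ActsOn.isH1`). -/

/-! ### Primitives of locally integrable functions and weak derivatives -/

/-- `u` is a primitive of the locally integrable function `u'`. -/
structure IsPrim (u u' : ℝ → ℂ) : Prop where
  locInt : LocallyIntegrable u' volume
  integral_eq : ∀ a b : ℝ, ∫ x in a..b, u' x = u b - u a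

theorem _root_.MeasureTheory.LocallyIntegrable.intervalIntegrable' {f : ℝ → ℂ}
    (hf : LocallyIntegrable f volume) (a b : ℝ) : IntervalIntegrable f volume a b :=
  intervalIntegrable_iff.mpr
    ((hf.integrableOn_isCompact isCompact_uIcc).mono_set uIoc_subset_uIcc)

theorem absolutelyContinuous_intervalIntegral {f : ℝ → ℂ} (hf : LocallyIntegrable f volume)
    {a b c : ℝ} (hc : c ∈ uIcc a b) :
    AbsolutelyContinuousOnInterval (fun x ↦ ∫ v in c..x, f v) a b := by
  have hi := hf.intervalIntegrable'
  have h1 : AbsolutelyContinuousOnInterval (fun x ↦ ∫ v in c..x, (f v).re) a b :=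
    IntervalIntegrable.absolutelyContinuousOnInterval_intervalIntegral
      ⟨(hi a b).1.re, (hi a b).2.re⟩ hc
  have h2 : AbsolutelyContinuousOnInterval (fun x ↦ ∫ v in c..x, (f v).im) a b :=
    IntervalIntegrable.absolutelyContinuousOnInterval_intervalIntegral
      ⟨(hi a b).1.im, (hi a b).2.im⟩ hc
  have k1 : AbsolutelyContinuousOnInterval (fun _ : ℝ ↦ (1 : ℂ)) a b :=
    (LipschitzWith.const (1 : ℂ)).lipschitzOnWith.absolutelyContinuousOnInterval
  have kI : AbsolutelyContinuousOnInterval (fun _ : ℝ ↦ Complex.I) a b :=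
    (LipschitzWith.const Complex.I).lipschitzOnWith.absolutelyContinuousOnInterval
  have e : (fun x ↦ ∫ v in c..x, f v) = (fun x ↦ (∫ v in c..x, (f v).re) • (1 : ℂ)) +
      fun x ↦ (∫ v in c..x, (f v).im) • Complex.I := by
    funext x
    have e1 : ∫ v in c..x, (f v).re = (∫ v in c..x, f v).re :=
      intervalIntegral.intervalIntegral_re (hi c x)
    have e2 : ∫ v in c..x, (f v).im = (∫ v in c..x, f v).im :=
      intervalIntegral.intervalIntegral_im (hi c x)
    simp [e1, e2]
  rw [e]
  exact (h1.smul k1).add (h2.smul kI)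

namespace IsPrim

variable {u u' v v' : ℝ → ℂ}

theorem eq_add (hu : IsPrim u u') (c x : ℝ) : u x = u c + ∫ t in c..x, u' t := by
  rw [hu.integral_eq]; ring

theorem continuous (hu : IsPrim u u') : Continuous u := by
  have : u = fun x ↦ u 0 + ∫ t in (0 : ℝ)..x, u' t := funext (hu.eq_add 0)
  rw [this]
  exact continuous_const.add (intervalIntegral.continuous_primitive hu.locInt.intervalIntegrable' 0)

theorem ae_hasDerivAt (hu : IsPrim u u') : ∀ᵐ x, HasDerivAt u (u' x) x := by
  have : u = fun x ↦ u 0 + ∫ t in (0 : ℝ)..x, u' t := funext (hu.eq_add 0)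
  filter_upwards [_root_.LocallyIntegrable.ae_hasDerivAt_integral hu.locInt] with x hx
  rw [this]
  exact (hx 0).const_add _

theorem absolutelyContinuous (hu : IsPrim u u') (a b : ℝ) :
    AbsolutelyContinuousOnInterval u a b := by
  have : u = (fun _ ↦ u a) + fun x ↦ ∫ t in a..x, u' t := funext (hu.eq_add a)
  rw [this]
  exact ((LipschitzWith.const (u a)).lipschitzOnWith.absolutelyContinuousOnInterval).add
    (absolutelyContinuous_intervalIntegral hu.locInt left_mem_uIcc)

/-- The difference between `u` and the integral of `u'` is absolutely continuous with derivative
zero almost everywhere, hence constant. -/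
theorem of_absolutelyContinuous (hl : LocallyIntegrable u' volume)
    (hu : ∀ a b, AbsolutelyContinuousOnInterval u a b) (hd : ∀ᵐ x, HasDerivAt u (u' x) x) :
    IsPrim u u' := by
  refine ⟨hl, fun a b ↦ ?_⟩
  have hg := (hu a b).sub
    (absolutelyContinuous_intervalIntegral hl (left_mem_uIcc (a := a) (b := b)))
  obtain ⟨C, hC⟩ := hg.const_of_ae_hasDerivAt_zero (by
    filter_upwards [hd, _root_.LocallyIntegrable.ae_hasDerivAt_integral hl] with x hx hx' _
    simpa using hx.sub (hx' a))
  have h1 := hC a left_mem_uIcc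
  have h2 := hC b right_mem_uIcc
  simp only [Pi.sub_apply, intervalIntegral.integral_same, sub_zero] at h1 h2
  rw [h1, ← h2]; ring

theorem mul (hu : IsPrim u u') (hv : IsPrim v v') :
    IsPrim (fun x ↦ u x * v x) (fun x ↦ u' x * v x + u x * v' x) := by
  refine of_absolutelyContinuous ?_ (fun a b ↦ ?_) ?_
  · have h1 := hu.locInt.mul_continuous hv.continuous
    have h2 := hv.locInt.continuous_mul hu.continuous
    exact h1.add h2
  · exact (hu.absolutelyContinuous a b).smul (hv.absolutelyContinuous a b)
  · filter_upwards [hu.ae_hasDerivAt, hv.ae_hasDerivAt] with x h1 h2 using h1.mul h2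

theorem add (hu : IsPrim u u') (hv : IsPrim v v') :
    IsPrim (fun x ↦ u x + v x) (fun x ↦ u' x + v' x) := by
  refine ⟨hu.locInt.add hv.locInt, fun a b ↦ ?_⟩
  rw [intervalIntegral.integral_add (hu.locInt.intervalIntegrable' a b)
    (hv.locInt.intervalIntegrable' a b), hu.integral_eq, hv.integral_eq]
  ring

theorem const_mul (c : ℂ) (hu : IsPrim u u') : IsPrim (fun x ↦ c * u x) (fun x ↦ c * u' x) := by
  refine ⟨hu.locInt.smul c, fun a b ↦ ?_⟩
  rw [intervalIntegral.integral_const_mul, hu.integral_eq]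
  ring

theorem conj (hu : IsPrim u u') :
    IsPrim (fun x ↦ starRingEnd ℂ (u x)) (fun x ↦ starRingEnd ℂ (u' x)) := by
  refine ⟨fun x ↦ ?_, fun a b ↦ ?_⟩
  · exact Complex.conjCLE.toContinuousLinearMap.integrableAtFilter_comp (hu.locInt x)
  · rw [intervalIntegral.intervalIntegral_eq_integral_uIoc]
    have := hu.integral_eq a b
    rw [intervalIntegral.intervalIntegral_eq_integral_uIoc] at this
    rw [integral_conj, ← map_sub, ← this]
    split_ifs <;> simp

theorem of_contDiff (hu : ContDiff ℝ 1 u) : IsPrim u (deriv u) := by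
  have hd : Continuous (deriv u) := hu.continuous_deriv le_rfl
  refine ⟨hd.locallyIntegrable, fun a b ↦ ?_⟩
  exact intervalIntegral.integral_deriv_eq_sub
    (fun x _ ↦ (hu.differentiable one_ne_zero).differentiableAt) (hd.intervalIntegrable _ _)

theorem congr_deriv (hu : IsPrim u u') (h : u' =ᵐ[volume] v') : IsPrim u v' :=
  ⟨hu.locInt.congr h, fun a b ↦ by
    rw [← hu.integral_eq]; exact intervalIntegral.integral_congr_ae' (h.mono fun x hx _ ↦ hx.symm)
      (h.mono fun x hx _ ↦ hx.symm)⟩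

theorem deriv_ae_eq (hu : IsPrim u u') (hv : IsPrim u v') : u' =ᵐ[volume] v' := by
  filter_upwards [hu.ae_hasDerivAt, hv.ae_hasDerivAt] with x h1 h2 using h1.unique h2

theorem ae_eq_zero_of_abs_lt (hu : IsPrim u u') {R : ℝ} (hR : ∀ x, R ≤ |x| → u x = 0) :
    ∀ᵐ x, R < |x| → u' x = 0 := by
  filter_upwards [hu.ae_hasDerivAt] with x hx hRx
  have : u =ᶠ[𝓝 x] fun _ ↦ 0 := by
    filter_upwards [(isOpen_lt continuous_const continuous_abs).mem_nhds hRx] with y hy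
    exact hR y (le_of_lt hy)
  exact hx.unique ((hasDerivAt_const x (0 : ℂ)).congr_of_eventuallyEq this)

theorem exists_radius (hc : HasCompactSupport u) : ∃ R : ℝ, 0 < R ∧ ∀ x, R ≤ |x| → u x = 0 :=
  hc.exists_pos_le_norm

theorem integrable_deriv (hu : IsPrim u u') (hc : HasCompactSupport u) : Integrable u' := by
  obtain ⟨R, -, hR⟩ := exists_radius hc
  have h := hu.ae_eq_zero_of_abs_lt hR
  have h1 : IntegrableOn u' (Icc (-R) R) := hu.locInt.integrableOn_isCompact isCompact_Icc
  refine (integrableOn_iff_integrable_of_support_subset (s := univ) (subset_univ _)).mp ?_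
  refine (IntegrableOn.of_ae_sdiff_eq_zero (s := Icc (-R) R) h1
    MeasurableSet.univ.nullMeasurableSet ?_)
  filter_upwards [h] with x hx hxs
  apply hx
  by_contra hcon
  exact hxs.2 (abs_le.mp (not_lt.mp hcon))

theorem integral_deriv (hu : IsPrim u u') (hc : HasCompactSupport u) : ∫ x, u' x = 0 := by
  obtain ⟨R, hR0, hR⟩ := exists_radius hc
  have h := hu.ae_eq_zero_of_abs_lt hR
  have h1 : ∫ x in (-R)..R, u' x = ∫ x, u' x := by
    rw [intervalIntegral.integral_of_le (by linarith), ← integral_Icc_eq_integral_Ioc]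
    apply setIntegral_eq_integral_of_ae_compl_eq_zero
    filter_upwards [h] with x hx hxs
    apply hx
    by_contra hcon
    exact hxs (abs_le.mp (not_lt.mp hcon))
  rw [← h1, hu.integral_eq, hR R (le_abs_self R), hR (-R) (by simp [abs_of_pos hR0]), sub_zero]

/-- Only `v` needs compact support: the product is then a compactly supported primitive, and its
derivative integrates to zero. -/
theorem integral_mul_deriv (hu : IsPrim u u') (hv : IsPrim v v') (hc : HasCompactSupport v) :
    ∫ x, u x * v' x = -∫ x, u' x * v x := by
  have h := (hu.mul hv).integral_deriv hc.mul_left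
  have hi1 : Integrable fun x ↦ u' x * v x := by
    have := hu.locInt.integrable_smul_left_of_hasCompactSupport hv.continuous hc
    simpa [mul_comm] using this
  have hi2 : Integrable fun x ↦ u x * v' x := by
    have := ((hu.mul hv).integrable_deriv hc.mul_left).sub hi1
    exact this.congr (.of_forall fun x ↦ by simp)
  rw [integral_add hi1 hi2] at h
  exact eq_neg_of_add_eq_zero_right h

end IsPrim

theorem IsTest.isPrim {φ : ℝ → ℂ} (h : IsTest φ) : IsPrim φ (deriv φ) :=
  .of_contDiff (h.1.of_le (by exact_mod_cast le_top))

theorem isTest_ofReal {g : ℝ → ℝ} (hg : ContDiff ℝ (⊤ : ℕ∞) g) (hc : HasCompactSupport g) :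
    IsTest fun x ↦ (g x : ℂ) :=
  ⟨Complex.ofRealCLM.contDiff.comp hg, hc.comp_left Complex.ofReal_zero⟩

/-- The lemma of du Bois-Reymond. -/
theorem exists_ae_eq_const {g : ℝ → ℂ} (hg : LocallyIntegrable g volume)
    (h : ∀ φ, IsTest φ → ∫ x, g x * deriv φ x = 0) : ∃ c : ℂ, g =ᵐ[volume] fun _ ↦ c := by
  obtain ⟨ψ, hψs, hψ1⟩ : ∃ ψ : ℝ → ℝ, (ContDiff ℝ (⊤ : ℕ∞) ψ ∧ HasCompactSupport ψ) ∧
      ∫ x, ψ x = 1 := by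
    let b : ContDiffBump (0 : ℝ) := default
    exact ⟨b.normed volume, ⟨b.contDiff_normed, b.hasCompactSupport_normed⟩, b.integral_normed⟩
  -- The constant is forced: if `g = c` almost everywhere then `∫ g ψ = c`, as `ψ` has integral one.
  refine ⟨∫ x, g x * ψ x, ?_⟩
  refine ae_eq_of_integral_contDiff_smul_eq hg (locallyIntegrable_const _) fun φ hφ hφc ↦ ?_
  set m : ℝ := ∫ x, φ x with hm
  -- Subtracting `m ψ` removes the mean, so the primitive `Θ` of `θ` has compact support and is an
  -- admissible test function.
  set θ : ℝ → ℝ := fun x ↦ φ x - m * ψ x with hθ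
  have hθs : ContDiff ℝ (⊤ : ℕ∞) θ := hφ.sub (contDiff_const.mul hψs.1)
  have hθc : HasCompactSupport θ := hφc.sub hψs.2.mul_left
  have hθi : Integrable θ := hθs.continuous.integrable_of_hasCompactSupport hθc
  have hφi : Integrable φ := hφ.continuous.integrable_of_hasCompactSupport hφc
  have hψi : Integrable ψ := hψs.1.continuous.integrable_of_hasCompactSupport hψs.2
  have hθ0 : ∫ x, θ x = 0 := by
    simp only [hθ]
    rw [integral_sub hφi (hψi.const_mul m), integral_const_mul, hψ1, mul_one, sub_self]
  obtain ⟨R, hR0, hR⟩ : ∃ R : ℝ, 0 < R ∧ ∀ x, R ≤ |x| → θ x = 0 := hθc.exists_pos_le_norm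
  set Θ : ℝ → ℝ := fun x ↦ ∫ t in (-R)..x, θ t with hΘ
  have hΘd : ∀ x, HasDerivAt Θ (θ x) x := fun x ↦
    intervalIntegral.integral_hasDerivAt_right (hθs.continuous.intervalIntegrable _ _)
      (hθs.continuous.stronglyMeasurableAtFilter _ _) hθs.continuous.continuousAt
  have hΘd' : deriv Θ = θ := funext fun x ↦ (hΘd x).deriv
  have hΘs : ContDiff ℝ (⊤ : ℕ∞) Θ := by
    rw [contDiff_infty_iff_deriv]
    exact ⟨fun x ↦ (hΘd x).differentiableAt, hΘd' ▸ hθs⟩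
  have hΘR : Θ R = 0 := by
    rw [← hθ0, hΘ]
    simp only
    rw [intervalIntegral.integral_of_le (by linarith)]
    apply setIntegral_eq_integral_of_forall_compl_eq_zero
    intro x hx
    apply hR
    by_contra hcon
    have := abs_lt.mp (not_le.mp hcon)
    exact hx ⟨this.1, this.2.le⟩
  have hΘc : HasCompactSupport Θ := by
    refine HasCompactSupport.intro (isCompact_Icc (a := -R) (b := R)) fun x hx ↦ ?_
    rcases lt_or_ge x (-R) with h1 | h1
    · simp only [hΘ]
      rw [intervalIntegral.integral_congr (g := fun _ ↦ 0)]
      · simp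
      · intro t ht
        rw [uIcc_of_ge h1.le] at ht
        exact hR t (by rw [abs_of_nonpos (by linarith [ht.2])]; linarith [ht.2])
    · have h2 : R < x := by
        by_contra hcon
        exact hx ⟨h1, not_lt.mp hcon⟩
      have : Θ x = Θ R + ∫ t in R..x, θ t :=
        (intervalIntegral.integral_add_adjacent_intervals
          (hθs.continuous.intervalIntegrable _ _) (hθs.continuous.intervalIntegrable _ _)).symm
      rw [this, hΘR, zero_add, intervalIntegral.integral_congr (g := fun _ ↦ 0)]
      · simp
      · intro t ht
        rw [uIcc_of_le h2.le] at ht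
        exact hR t (le_trans ht.1 (le_abs_self t))
  have key := h _ (isTest_ofReal hΘs hΘc)
  have hder : (deriv fun x ↦ (Θ x : ℂ)) = fun x ↦ (θ x : ℂ) :=
    funext fun x ↦ (hΘd x).ofReal_comp.deriv
  rw [hder] at key
  have i1 : Integrable fun x ↦ φ x • g x :=
    hg.integrable_smul_left_of_hasCompactSupport hφ.continuous hφc
  have i2 : Integrable fun x ↦ ψ x • g x :=
    hg.integrable_smul_left_of_hasCompactSupport hψs.1.continuous hψs.2
  have e : (fun x ↦ g x * (θ x : ℂ)) = fun x ↦ φ x • g x - (m : ℂ) * (ψ x • g x) := by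
    funext x
    simp only [hθ, Complex.real_smul]
    push_cast
    ring
  rw [e, integral_sub i1 (i2.const_mul _), integral_const_mul, sub_eq_zero] at key
  rw [key]
  simp only [Complex.real_smul]
  rw [integral_mul_const, integral_complex_ofReal, ← hm]
  congr 2
  funext x
  ring

theorem IsPrim.isWeakDeriv {u u' : ℝ → ℂ} (hu : IsPrim u u') : IsWeakDeriv u u' :=
  ⟨hu.continuous.locallyIntegrable, hu.locInt, fun _ hφ ↦ hu.integral_mul_deriv hφ.isPrim hφ.2⟩

theorem isPrim_primitive {u' : ℝ → ℂ} (h : LocallyIntegrable u' volume) :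
    IsPrim (fun x ↦ ∫ t in (0 : ℝ)..x, u' t) u' :=
  ⟨h, fun _ _ ↦ (intervalIntegral.integral_interval_sub_left
    (h.intervalIntegrable' _ _) (h.intervalIntegrable' _ _)).symm⟩

/-- A locally integrable function with a weak derivative agrees a.e. with a primitive of it. -/
theorem exists_isPrim {u u' : ℝ → ℂ} (hu : LocallyIntegrable u volume)
    (hu' : LocallyIntegrable u' volume)
    (h : ∀ φ, IsTest φ → ∫ x, u x * deriv φ x = -∫ x, u' x * φ x) :
    ∃ uc, IsPrim uc u' ∧ u =ᵐ[volume] uc := by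
  have hp := isPrim_primitive hu'
  set U := fun x ↦ ∫ t in (0 : ℝ)..x, u' t with hU
  obtain ⟨c, hc⟩ := exists_ae_eq_const (hu.sub hp.continuous.locallyIntegrable) (fun φ hφ ↦ by
    have hd : Continuous (deriv φ) := hφ.1.continuous_deriv (by exact_mod_cast le_top)
    have i1 : Integrable fun x ↦ u x * deriv φ x := by
      simpa [mul_comm] using
        hu.integrable_smul_left_of_hasCompactSupport hd hφ.2.deriv
    have i2 : Integrable fun x ↦ U x * deriv φ x :=
      (hp.continuous.mul hd).integrable_of_hasCompactSupport hφ.2.deriv.mul_left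
    have e : (fun x ↦ (u - U) x * deriv φ x) = fun x ↦ u x * deriv φ x - U x * deriv φ x := by
      funext x; simp [sub_mul]
    rw [e, integral_sub i1 i2, h φ hφ, hp.integral_mul_deriv hφ.isPrim hφ.2, sub_self])
  refine ⟨fun x ↦ c + U x, ⟨hu', fun a b ↦ ?_⟩, ?_⟩
  · rw [hp.integral_eq]; ring
  · filter_upwards [hc] with x hx
    simp only [Pi.sub_apply] at hx
    rw [← hx]; ring

theorem IsWeakDeriv.isPrim {u u' : ℝ → ℂ} (h : IsWeakDeriv u u') (hc : Continuous u) :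
    IsPrim u u' := by
  obtain ⟨uc, h1, h2⟩ := exists_isPrim h.1 h.2.1 h.2.2
  rwa [(hc.ae_eq_iff_eq volume h1.continuous).mp h2]

/-! ### Finite sums of measures with densities -/

section Density

variable {ι : Type*} [Fintype ι] {μ : ι → Measure ℝ} {k : ι → ℝ → ℂ}

theorem isLocallyFiniteMeasure_sum (hμ : ∀ i, IsLocallyFiniteMeasure (μ i)) :
    IsLocallyFiniteMeasure (∑ i, μ i) := by
  refine ⟨fun x ↦ ?_⟩
  choose s hs hfin using fun i ↦ (hμ i).1 x
  refine ⟨⋂ i, s i, (Filter.iInter_mem).2 hs, ?_⟩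
  rw [Measure.finsetSum_apply]
  exact ENNReal.sum_lt_top.2 fun i _ ↦ (measure_mono (iInter_subset _ i)).trans_lt (hfin i)

/-- A finite sum of measures with densities has a density for a single locally finite measure. -/
theorem exists_common_density (hμ : ∀ i, IsLocallyFiniteMeasure (μ i))
    (hk : ∀ i, LocallyIntegrable (k i) (μ i)) :
    ∃ (ν : Measure ℝ) (_ : IsLocallyFiniteMeasure ν) (K : ℝ → ℂ), LocallyIntegrable K ν ∧
      (∀ i, μ i ≪ ν) ∧
      ∀ g : ℝ → ℂ, (∀ i, Integrable (fun x ↦ g x * k i x) (μ i)) →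
        Integrable (fun x ↦ g x * K x) ν ∧
          ∑ i, ∫ x, g x * k i x ∂μ i = ∫ x, g x * K x ∂ν := by
  have hν := isLocallyFiniteMeasure_sum hμ
  set ν : Measure ℝ := ∑ i, μ i with hνdef
  -- Each `μ i` has a Radon–Nikodym derivative with respect to the sum `ν`, so all the densities can
  -- be carried over to `ν` and added.
  set K : ℝ → ℂ := fun x ↦ ∑ i, ((μ i).rnDeriv ν x).toReal • k i x with hK
  have hle : ∀ i, μ i ≪ ν := fun i ↦
    Measure.AbsolutelyContinuous.mk fun s _ hs ↦ by
      rw [hνdef, Measure.finsetSum_apply, Finset.sum_eq_zero_iff] at hs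
      exact hs i (Finset.mem_univ i)
  have key : ∀ g : ℝ → ℂ, (∀ i, Integrable (fun x ↦ g x * k i x) (μ i)) →
        Integrable (fun x ↦ g x * K x) ν ∧
          ∑ i, ∫ x, g x * k i x ∂μ i = ∫ x, g x * K x ∂ν := by
    intro g hg
    have e : (fun x ↦ g x * K x) =
        fun x ↦ ∑ i, ((μ i).rnDeriv ν x).toReal • (g x * k i x) := by
      funext x
      simp only [hK, Finset.mul_sum]
      exact Finset.sum_congr rfl fun i _ ↦ by rw [mul_smul_comm]
    have hi : ∀ i, Integrable (fun x ↦ ((μ i).rnDeriv ν x).toReal • (g x * k i x)) ν := fun i ↦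
      (integrable_rnDeriv_smul_iff (hle i)).2 (hg i)
    rw [e]
    refine ⟨integrable_finsetSum _ fun i _ ↦ hi i, ?_⟩
    rw [integral_finsetSum _ fun i _ ↦ hi i]
    exact Finset.sum_congr rfl fun i _ ↦ (integral_rnDeriv_smul (hle i)).symm
  refine ⟨ν, hν, K, ?_, hle, key⟩
  rw [locallyIntegrable_iff]
  intro s hs
  -- Indicators of compact sets turn the integrability clause of `key` into local integrability of
  -- `K`.
  have h1 := (key (s.indicator fun _ ↦ 1) fun i ↦ ?_).1
  · rw [← integrable_indicator_iff hs.measurableSet]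
    refine h1.congr (.of_forall fun x ↦ ?_)
    by_cases hx : x ∈ s <;> simp [hx]
  · have := (integrable_indicator_iff hs.measurableSet).2 ((hk i).integrableOn_isCompact hs)
    refine this.congr (.of_forall fun x ↦ ?_)
    by_cases hx : x ∈ s <;> simp [hx]

/-- If a finite sum of measures with locally integrable densities vanishes on test functions, then
it vanishes on all integrable functions. -/
theorem sum_integral_eq_zero (hμ : ∀ i, IsLocallyFiniteMeasure (μ i))
    (hk : ∀ i, LocallyIntegrable (k i) (μ i))
    (h : ∀ φ, IsTest φ → ∑ i, ∫ x, φ x * k i x ∂μ i = 0) {g : ℝ → ℂ}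
    (hg : ∀ i, Integrable (fun x ↦ g x * k i x) (μ i)) :
    ∑ i, ∫ x, g x * k i x ∂μ i = 0 := by
  obtain ⟨ν, _, K, hK, -, hν⟩ := exists_common_density hμ hk
  -- Test functions already force the common density to vanish; after that `g` need not be
  -- continuous.
  have hK0 : ∀ᵐ x ∂ν, K x = 0 := by
    refine ae_eq_zero_of_integral_contDiff_smul_eq_zero hK fun φ hφ hφc ↦ ?_
    have ht := isTest_ofReal hφ hφc
    rw [← h _ ht, (hν (fun x ↦ φ x) fun i ↦ ?_).2]
    · simp
    · simpa using (hk i).integrable_smul_left_of_hasCompactSupport hφ.continuous hφc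
  rw [(hν g hg).2]
  refine integral_eq_zero_of_ae ?_
  filter_upwards [hK0] with x hx
  simp [hx]

end Density

instance {g : ℝ → ℝ} (hg : Monotone g) : IsLocallyFiniteMeasure (monoMeasure hg) := by
  unfold monoMeasure; infer_instance

/-! ### Distribution functions and integration by parts for Stieltjes measures -/

section Distribution

variable (m : Measure ℝ)

/-- The distribution function of a locally finite measure, normalised to vanish at `0`. -/
noncomputable def distr (x : ℝ) : ℝ :=
  if 0 ≤ x then m.real (Ioc 0 x) else -m.real (Ioc x 0)

variable [IsLocallyFiniteMeasure m]

theorem distr_sub {a b : ℝ} (hab : a ≤ b) : distr m b - distr m a = m.real (Ioc a b) := by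
  have hadd : ∀ {x y z : ℝ}, x ≤ y → y ≤ z → m.real (Ioc x y) + m.real (Ioc y z) =
      m.real (Ioc x z) := fun {x y z} h1 h2 ↦ by
    rw [← measureReal_union (Ioc_disjoint_Ioc_of_le le_rfl) measurableSet_Ioc
      measure_Ioc_lt_top.ne measure_Ioc_lt_top.ne, Ioc_union_Ioc_eq_Ioc h1 h2]
  unfold distr
  split_ifs with h1 h2 h2
  · linarith [hadd h2 hab]
  · linarith [hadd (not_le.mp h2).le h1]
  · linarith
  · linarith [hadd hab (not_le.mp h1).le]

theorem monotone_distr : Monotone (distr m) := fun a b hab ↦ by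
  have := distr_sub m hab
  linarith [measureReal_nonneg (μ := m) (s := Ioc a b)]

/-- Continuity of `m` from above along the intervals `Ioc a r`, which decrease to the empty set as
`r` decreases to `a`. -/
theorem rightLim_distr (a : ℝ) : Function.rightLim (distr m) a = distr m a := by
  rw [← Monotone.continuousWithinAt_Ioi_iff_rightLim_eq (monotone_distr m)]
  have h := tendsto_measure_biInter_gt (μ := m) (s := fun r ↦ Ioc a r) (a := a)
    (fun r _ ↦ measurableSet_Ioc.nullMeasurableSet) (fun i j _ hij ↦ Ioc_subset_Ioc_right hij)
    ⟨a + 1, by simp, measure_Ioc_lt_top.ne⟩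
  have he : ⋂ r > a, Ioc a r = ∅ := by
    ext x
    simp only [mem_iInter, mem_Ioc, mem_empty_iff_false, iff_false, not_forall]
    rcases le_or_gt x a with hx | hx
    · exact ⟨a + 1, by simp, fun h ↦ absurd h.1 (not_lt.2 hx)⟩
    · exact ⟨(a + x) / 2, by simp only [gt_iff_lt]; linarith, fun h ↦ by linarith [h.2]⟩
  rw [he, measure_empty] at h
  have h2 := (ENNReal.tendsto_toReal ENNReal.zero_ne_top).comp h
  have h3 : Tendsto (fun r ↦ distr m a + m.real (Ioc a r)) (𝓝[>] a) (𝓝 (distr m a)) := by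
    simpa [Measure.real] using h2.const_add (distr m a)
  refine h3.congr' ?_
  filter_upwards [self_mem_nhdsWithin] with r hr
  rw [← distr_sub m (le_of_lt hr)]
  ring

theorem monoMeasure_distr : monoMeasure (monotone_distr m) = m := by
  refine Measure.ext_of_Ioc _ _ fun a b hab ↦ ?_
  rw [monoMeasure, StieltjesFunction.measure_Ioc, Monotone.stieltjesFunction_eq,
    Monotone.stieltjesFunction_eq, rightLim_distr, rightLim_distr, distr_sub m hab.le,
    ofReal_measureReal measure_Ioc_lt_top.ne]

end Distribution

theorem monoMeasure_add_const {g : ℝ → ℝ} (hg : Monotone g) (c : ℝ)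
    (hg' : Monotone fun x ↦ g x + c) : monoMeasure hg' = monoMeasure hg := by
  have hr : ∀ x, Function.rightLim (fun x ↦ g x + c) x = Function.rightLim g x + c := fun x ↦
    tendsto_nhds_unique (hg'.tendsto_rightLim x) ((hg.tendsto_rightLim x).add_const c)
  refine Measure.ext_of_Ioc _ _ fun a b hab ↦ ?_
  simp only [monoMeasure, StieltjesFunction.measure_Ioc, Monotone.stieltjesFunction_eq, hr]
  congr 1; ring

/-- Fubini: write `v x` as minus the integral of `v'` over `(x, R]` and exchange the integrals. The
inner one becomes `(S(t-) - S(-R)) v' t` with `S` the right limit of `g`; the constant drops out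
because `v'` has integral zero. -/
theorem integral_monoMeasure {g : ℝ → ℝ} (hg : Monotone g) {v v' : ℝ → ℂ} (hv : IsPrim v v')
    (hc : HasCompactSupport v) : ∫ x, v x ∂monoMeasure hg = -∫ x, g x * v' x := by
  obtain ⟨R, hR0, hR⟩ := IsPrim.exists_radius hc
  set S := hg.stieltjesFunction with hS
  set m := monoMeasure hg with hm
  have hmS : m = S.measure := rfl
  set I := Ioc (-R) R with hI
  have hv'0 : ∀ᵐ x, x ∉ I → v' x = 0 := by
    have hne : ∀ᵐ x : ℝ, x ≠ -R := by simp [ae_iff, measure_singleton]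
    filter_upwards [hv.ae_eq_zero_of_abs_lt hR, hne] with x hx hx1 hxI
    apply hx
    by_contra hcon
    have := abs_le.mp (not_lt.mp hcon)
    exact hxI ⟨lt_of_le_of_ne this.1 (Ne.symm hx1), this.2⟩
  have hv'I : IntegrableOn v' I volume :=
    (hv.locInt.integrableOn_isCompact isCompact_Icc).mono_set Ioc_subset_Icc_self
  have hint0 : ∫ t in I, v' t = 0 := by
    rw [hI, ← intervalIntegral.integral_of_le (by linarith), hv.integral_eq,
      hR R (le_abs_self R), hR (-R) (by simp [abs_of_pos hR0]), sub_zero]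
  have hfin : IsFiniteMeasure (m.restrict I) := ⟨by
    rw [Measure.restrict_apply_univ]; exact measure_Ioc_lt_top⟩
  have h1 : ∫ x, v x ∂m = ∫ x in I, v x ∂m := by
    refine (setIntegral_eq_integral_of_forall_compl_eq_zero fun x hx ↦ hR x ?_).symm
    by_contra hcon
    have := abs_lt.mp (not_le.mp hcon)
    exact hx ⟨this.1, this.2.le⟩
  have h2 : ∀ x ∈ I, v x = -∫ t in I, (Ioi x).indicator v' t := by
    intro x hx
    rw [setIntegral_indicator measurableSet_Ioi]
    have : I ∩ Ioi x = Ioc x R := by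
      ext t; simp only [hI, mem_inter_iff, mem_Ioc, mem_Ioi]
      exact ⟨fun h ↦ ⟨h.2, h.1.2⟩, fun h ↦ ⟨⟨hx.1.trans h.1, h.2⟩, h.1⟩⟩
    rw [this, ← intervalIntegral.integral_of_le hx.2, hv.integral_eq, hR R (le_abs_self R)]
    ring
  have hInt : Integrable (Function.uncurry fun x t ↦ (Ioi x).indicator v' t)
      ((m.restrict I).prod (volume.restrict I)) := by
    have hb : Integrable (fun z : ℝ × ℝ ↦ (1 : ℂ) * v' z.2)
        ((m.restrict I).prod (volume.restrict I)) :=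
      Integrable.mul_prod (integrable_const _) hv'I
    have hms : MeasurableSet {z : ℝ × ℝ | z.1 < z.2} := measurableSet_lt measurable_fst measurable_snd
    refine (hb.indicator hms).congr (.of_forall fun z ↦ ?_)
    by_cases hz : z.1 < z.2 <;> simp [Function.uncurry, indicator, hz]
  have h3 : ∫ x in I, v x ∂m = -∫ t in I, ∫ x in I, (Ioi x).indicator v' t ∂m := by
    rw [setIntegral_congr_fun measurableSet_Ioc h2, integral_neg, integral_integral_swap hInt]
  have h4 : ∀ t ∈ I, ∫ x in I, (Ioi x).indicator v' t ∂m =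
      ((Function.leftLim S t - S (-R) : ℝ) : ℂ) * v' t := by
    intro t ht
    have e : (fun x ↦ (Ioi x).indicator v' t) = (Iio t).indicator fun _ ↦ v' t := by
      funext x; by_cases hx : x < t <;> simp [indicator, hx]
    rw [e, setIntegral_indicator measurableSet_Iio, setIntegral_const]
    have : I ∩ Iio t = Ioo (-R) t := by
      ext x; simp only [hI, mem_inter_iff, mem_Ioc, mem_Iio, mem_Ioo]
      exact ⟨fun h ↦ ⟨h.1.1, h.2⟩, fun h ↦ ⟨⟨h.1, h.2.le.trans ht.2⟩, h.2⟩⟩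
    rw [this, Measure.real, hmS, StieltjesFunction.measure_Ioo, ENNReal.toReal_ofReal,
      Complex.real_smul]
    exact sub_nonneg.2 (S.mono.le_leftLim ht.1)
  -- Passing to right limits and then to left limits alters `g` at countably many points only.
  have hae : ∀ᵐ t : ℝ, Function.leftLim S t = g t := by
    have c1 : ∀ᵐ t : ℝ, Function.leftLim S t = S t := by
      rw [ae_iff]; exact S.countable_leftLim_ne.measure_zero _
    have c2 : ∀ᵐ t : ℝ, ContinuousAt g t := by
      rw [ae_iff]; exact hg.countable_not_continuousAt.measure_zero _
    filter_upwards [c1, c2] with t h1 h2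
    rw [h1, hS, Monotone.stieltjesFunction_eq]
    exact (Monotone.continuousWithinAt_Ioi_iff_rightLim_eq hg).1 h2.continuousWithinAt
  have hgI : IntegrableOn (fun t ↦ (g t : ℂ) * v' t) I volume := by
    refine Integrable.bdd_mul (c := max |g (-R)| |g R|) hv'I ?_ ?_
    · exact (Complex.measurable_ofReal.comp hg.measurable).aestronglyMeasurable
    · filter_upwards [ae_restrict_mem measurableSet_Ioc] with t ht
      rw [Complex.norm_real, Real.norm_eq_abs]
      exact abs_le_max_abs_abs (hg ht.1.le) (hg ht.2)
  rw [h1, h3, setIntegral_congr_fun measurableSet_Ioc h4]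
  have h5 : ∫ t in I, ((Function.leftLim S t - S (-R) : ℝ) : ℂ) * v' t =
      ∫ t in I, ((g t : ℂ) * v' t - (S (-R) : ℂ) * v' t) := by
    refine setIntegral_congr_ae measurableSet_Ioc ?_
    filter_upwards [hae] with t ht _
    rw [ht]; push_cast; ring
  rw [h5, integral_sub hgI (hv'I.const_mul _), integral_const_mul, hint0, mul_zero, sub_zero]
  congr 1
  refine setIntegral_eq_integral_of_ae_compl_eq_zero ?_
  filter_upwards [hv'0] with x hx hxI
  rw [hx hxI, mul_zero]

namespace LocBV

variable {f : ℝ → ℂ}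

/-- The four measures of a function of locally bounded variation. -/
noncomputable def meas (F : LocBV f) : Fin 4 → Measure ℝ :=
  ![monoMeasure F.rePos_mono, monoMeasure F.reNeg_mono, monoMeasure F.imPos_mono,
    monoMeasure F.imNeg_mono]

/-- The coefficients with which the four measures enter. -/
noncomputable def coef : Fin 4 → ℂ := ![1, -1, Complex.I, -Complex.I]

theorem meas_isLocallyFinite (F : LocBV f) (i : Fin 4) : IsLocallyFiniteMeasure (F.meas i) := by
  match i with
  | 0 => exact inferInstanceAs (IsLocallyFiniteMeasure (monoMeasure F.rePos_mono))
  | 1 => exact inferInstanceAs (IsLocallyFiniteMeasure (monoMeasure F.reNeg_mono))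
  | 2 => exact inferInstanceAs (IsLocallyFiniteMeasure (monoMeasure F.imPos_mono))
  | 3 => exact inferInstanceAs (IsLocallyFiniteMeasure (monoMeasure F.imNeg_mono))

theorem integral_eq_sum (F : LocBV f) (g : ℝ → ℂ) :
    F.integral g = ∑ i, coef i * ∫ x, g x ∂F.meas i := by
  simp only [integral, Fin.sum_univ_four, coef, meas]
  simp
  ring

theorem locInt_iff (F : LocBV f) (β : ℝ → ℝ) : F.LocInt β ↔ ∀ i, LocallyIntegrable β (F.meas i) := by
  simp [LocInt, Fin.forall_fin_succ, meas]

theorem measurable (F : LocBV f) : Measurable f := by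
  have : f = fun x ↦ ((F.rePos x - F.reNeg x : ℝ) : ℂ) +
      Complex.I * ((F.imPos x - F.imNeg x : ℝ) : ℂ) := funext F.eq
  rw [this]
  have h1 := F.rePos_mono.measurable
  have h2 := F.reNeg_mono.measurable
  have h3 := F.imPos_mono.measurable
  have h4 := F.imNeg_mono.measurable
  fun_prop

/-- A function of locally bounded variation is bounded on bounded intervals. -/
theorem exists_bound (F : LocBV f) (R : ℝ) : ∃ C : ℝ, ∀ x ∈ Icc (-R) R, ‖f x‖ ≤ C := by
  have hb : ∀ {g : ℝ → ℝ}, Monotone g → ∀ x ∈ Icc (-R) R, |g x| ≤ max |g (-R)| |g R| :=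
    fun hg x hx ↦ abs_le_max_abs_abs (hg hx.1) (hg hx.2)
  refine ⟨max |F.rePos (-R)| |F.rePos R| + max |F.reNeg (-R)| |F.reNeg R| +
    (max |F.imPos (-R)| |F.imPos R| + max |F.imNeg (-R)| |F.imNeg R|), fun x hx ↦ ?_⟩
  rw [F.eq]
  refine (norm_add_le _ _).trans (add_le_add ?_ ?_)
  · rw [Complex.norm_real]
    exact (norm_sub_le _ _).trans (add_le_add (hb F.rePos_mono x hx) (hb F.reNeg_mono x hx))
  · rw [norm_mul, Complex.norm_I, one_mul, Complex.norm_real]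
    exact (norm_sub_le _ _).trans (add_le_add (hb F.imPos_mono x hx) (hb F.imNeg_mono x hx))

/-- Integration by parts against a compactly supported absolutely continuous function. -/
theorem integral_eq_neg (F : LocBV f) {v v' : ℝ → ℂ} (hv : IsPrim v v') (hc : HasCompactSupport v) :
    F.integral v = -∫ x, f x * v' x := by
  have hi : ∀ {g : ℝ → ℝ}, Monotone g → Integrable fun x ↦ (g x : ℂ) * v' x := by
    intro g hg
    obtain ⟨R, -, hR⟩ := IsPrim.exists_radius hc
    refine ((hv.integrable_deriv hc).norm.const_mul (max |g (-R)| |g R|)).mono' ?_ ?_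
    · exact ((Complex.measurable_ofReal.comp hg.measurable).aestronglyMeasurable).mul
        hv.locInt.aestronglyMeasurable
    · filter_upwards [hv.ae_eq_zero_of_abs_lt hR] with x hx
      rcases lt_or_ge R |x| with h | h
      · simp [hx h]
      · rw [norm_mul, Complex.norm_real, Real.norm_eq_abs]
        have := abs_le.mp h
        gcongr
        exact abs_le_max_abs_abs (hg this.1) (hg this.2)
  have e : (fun x ↦ f x * v' x) = fun x ↦
      ((F.rePos x : ℂ) * v' x - (F.reNeg x : ℂ) * v' x) +
        Complex.I * ((F.imPos x : ℂ) * v' x - (F.imNeg x : ℂ) * v' x) := by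
    funext x
    rw [F.eq]; push_cast; ring
  have i1 := hi F.rePos_mono
  have i2 := hi F.reNeg_mono
  have i3 := hi F.imPos_mono
  have i4 := hi F.imNeg_mono
  have e2 : ∫ x, f x * v' x = ((∫ x, (F.rePos x : ℂ) * v' x) - ∫ x, (F.reNeg x : ℂ) * v' x) +
      Complex.I * ((∫ x, (F.imPos x : ℂ) * v' x) - ∫ x, (F.imNeg x : ℂ) * v' x) := by
    rw [e, ← integral_sub i1 i2, ← integral_sub i3 i4, ← integral_const_mul]
    exact integral_add (i1.sub i2) ((i3.sub i4).const_mul _)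
  rw [e2, integral, integral_monoMeasure F.rePos_mono hv hc,
    integral_monoMeasure F.reNeg_mono hv hc, integral_monoMeasure F.imPos_mono hv hc,
    integral_monoMeasure F.imNeg_mono hv hc]
  ring

/-- Adding a constant does not change the measure. -/
def addConst (F : LocBV f) (c : ℂ) : LocBV fun x ↦ f x + c where
  rePos x := F.rePos x + c.re
  reNeg := F.reNeg
  imPos x := F.imPos x + c.im
  imNeg := F.imNeg
  rePos_mono _ _ h := add_le_add_left (F.rePos_mono h) _
  reNeg_mono := F.reNeg_mono
  imPos_mono _ _ h := add_le_add_left (F.imPos_mono h) _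
  imNeg_mono := F.imNeg_mono
  eq x := by
    rw [F.eq]
    conv_lhs => rw [← Complex.re_add_im c]
    push_cast
    ring

theorem meas_addConst (F : LocBV f) (c : ℂ) : (F.addConst c).meas = F.meas := by
  have h1 := monoMeasure_add_const F.rePos_mono _ (F.addConst c).rePos_mono
  have h2 := monoMeasure_add_const F.imPos_mono _ (F.addConst c).imPos_mono
  funext i
  match i with
  | 0 => exact h1
  | 1 => rfl
  | 2 => exact h2
  | 3 => rfl

end LocBV

/-! ### Functions of locally bounded variation with a prescribed measure -/

section OfDensity

variable {ν : Measure ℝ} {K : ℝ → ℂ} {r : ℝ → ℝ}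

/-- Here `r` will be plus or minus the real or imaginary part of `K`. `ENNReal.ofReal` discards
negative values, so the four measures carry the positive and negative parts. -/
theorem isLocallyFiniteMeasure_withDensity (hK : LocallyIntegrable K ν)
    (hr : ∀ x, r x ≤ ‖K x‖) :
    IsLocallyFiniteMeasure (ν.withDensity fun x ↦ ENNReal.ofReal (r x)) := by
  refine ⟨fun x ↦ ?_⟩
  obtain ⟨s, hs, hi⟩ := hK x
  obtain ⟨t, hts, ht, hxt⟩ := mem_nhds_iff.1 hs
  refine ⟨t, ht.mem_nhds hxt, ?_⟩
  rw [withDensity_apply _ ht.measurableSet]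
  refine lt_of_le_of_lt (lintegral_mono fun y ↦ ?_) (hi.mono_set hts).2
  rw [← ofReal_norm]
  exact ENNReal.ofReal_le_ofReal (hr y)

theorem locallyIntegrable_withDensity [SFinite ν] (hrm : AEMeasurable r ν)
    (hr : ∀ x, r x ≤ ‖K x‖)
    {β : ℝ → ℝ} (hβ : Measurable β) (hβK : LocallyIntegrable (fun x ↦ (β x : ℂ) * K x) ν) :
    LocallyIntegrable β (ν.withDensity fun x ↦ ENNReal.ofReal (r x)) := by
  rw [locallyIntegrable_iff]
  intro s hs
  rw [IntegrableOn, restrict_withDensity hs.measurableSet,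
    integrable_withDensity_iff_integrable_smul₀' hrm.ennreal_ofReal.restrict
      (.of_forall fun _ ↦ ENNReal.ofReal_lt_top)]
  refine (hβK.integrableOn_isCompact hs).norm.mono' ?_ (.of_forall fun x ↦ ?_)
  · exact (hrm.restrict.ennreal_ofReal.ennreal_toReal.aestronglyMeasurable).smul
      hβ.aestronglyMeasurable
  · rw [norm_smul, norm_mul, Complex.norm_real, Real.norm_of_nonneg ENNReal.toReal_nonneg,
      ENNReal.toReal_ofReal', mul_comm]
    gcongr
    exact max_le (hr x) (norm_nonneg _)

theorem integrable_max_mul (hrm : AEMeasurable r ν) (hr : ∀ x, r x ≤ ‖K x‖)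
    {g : ℝ → ℂ} (hg : Measurable g) (hgK : Integrable (fun x ↦ g x * K x) ν) :
    Integrable (fun x ↦ ((max (r x) 0 : ℝ) : ℂ) * g x) ν := by
  refine hgK.norm.mono' ?_ (.of_forall fun x ↦ ?_)
  · exact ((Complex.measurable_ofReal.comp_aemeasurable
      (hrm.max aemeasurable_const)).aestronglyMeasurable).mul hg.aestronglyMeasurable
  · rw [norm_mul, norm_mul, Complex.norm_real, Real.norm_of_nonneg (le_max_right _ _), mul_comm]
    gcongr
    exact max_le (hr x) (norm_nonneg _)

theorem integral_withDensity_ofReal (hrm : AEMeasurable r ν) (g : ℝ → ℂ) :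
    ∫ x, g x ∂ν.withDensity (fun x ↦ ENNReal.ofReal (r x)) =
      ∫ x, ((max (r x) 0 : ℝ) : ℂ) * g x ∂ν := by
  rw [integral_withDensity_eq_integral_toReal_smul₀ hrm.ennreal_ofReal
    (.of_forall fun _ ↦ ENNReal.ofReal_lt_top)]
  simp [ENNReal.toReal_ofReal', Complex.real_smul]

/-- A locally integrable density with respect to a locally finite measure is the measure of a
function of locally bounded variation. -/
theorem exists_locBV_of_density [IsLocallyFiniteMeasure ν] (hK : LocallyIntegrable K ν) :
    ∃ (f : ℝ → ℂ) (F : LocBV f),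
      (∀ g : ℝ → ℂ, Measurable g → Integrable (fun x ↦ g x * K x) ν →
        F.integral g = ∫ x, g x * K x ∂ν) ∧
      ∀ β : ℝ → ℝ, Measurable β → LocallyIntegrable (fun x ↦ (β x : ℂ) * K x) ν →
        F.LocInt β := by
  have hKm : AEMeasurable K ν := hK.aestronglyMeasurable.aemeasurable
  have m1 : AEMeasurable (fun x ↦ (K x).re) ν := Complex.measurable_re.comp_aemeasurable hKm
  have m3 : AEMeasurable (fun x ↦ (K x).im) ν := Complex.measurable_im.comp_aemeasurable hKm
  have m2 : AEMeasurable (fun x ↦ -(K x).re) ν := m1.neg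
  have m4 : AEMeasurable (fun x ↦ -(K x).im) ν := m3.neg
  have b1 : ∀ x, (K x).re ≤ ‖K x‖ := fun x ↦ Complex.re_le_norm _
  have b2 : ∀ x, -(K x).re ≤ ‖K x‖ := fun x ↦ (neg_le_abs _).trans (Complex.abs_re_le_norm _)
  have b3 : ∀ x, (K x).im ≤ ‖K x‖ := fun x ↦ Complex.im_le_norm _
  have b4 : ∀ x, -(K x).im ≤ ‖K x‖ := fun x ↦ (neg_le_abs _).trans (Complex.abs_im_le_norm _)
  have l1 := isLocallyFiniteMeasure_withDensity hK b1
  have l2 := isLocallyFiniteMeasure_withDensity hK b2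
  have l3 := isLocallyFiniteMeasure_withDensity hK b3
  have l4 := isLocallyFiniteMeasure_withDensity hK b4
  set n1 := ν.withDensity fun x ↦ ENNReal.ofReal (K x).re
  set n2 := ν.withDensity fun x ↦ ENNReal.ofReal (-(K x).re)
  set n3 := ν.withDensity fun x ↦ ENNReal.ofReal (K x).im
  set n4 := ν.withDensity fun x ↦ ENNReal.ofReal (-(K x).im)
  let F : LocBV fun x ↦ ((distr n1 x - distr n2 x : ℝ) : ℂ) +
      Complex.I * ((distr n3 x - distr n4 x : ℝ) : ℂ) :=
    ⟨distr n1, distr n2, distr n3, distr n4, monotone_distr _, monotone_distr _,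
      monotone_distr _, monotone_distr _, fun _ ↦ rfl⟩
  refine ⟨_, F, fun g hg hgK ↦ ?_, fun β hβ hβK ↦ ?_⟩
  · have e : F.integral g = ((∫ x, g x ∂n1) - ∫ x, g x ∂n2) +
        Complex.I * ((∫ x, g x ∂n3) - ∫ x, g x ∂n4) := by
      simp only [LocBV.integral, F, monoMeasure_distr]
    have i1 := integrable_max_mul m1 b1 hg hgK
    have i2 := integrable_max_mul m2 b2 hg hgK
    have i3 := integrable_max_mul m3 b3 hg hgK
    have i4 := integrable_max_mul m4 b4 hg hgK
    rw [e, integral_withDensity_ofReal m1, integral_withDensity_ofReal m2,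
      integral_withDensity_ofReal m3, integral_withDensity_ofReal m4,
      ← integral_sub i1 i2, ← integral_sub i3 i4, ← integral_const_mul]
    refine (integral_add (i1.sub i2) ((i3.sub i4).const_mul _)).symm.trans ?_
    refine integral_congr_ae (.of_forall fun x ↦ ?_)
    have hm : ∀ a : ℝ, max a 0 - max (-a) 0 = a := fun a ↦ by
      rcases le_total a 0 with h | h <;> simp [h]
    have h1 := hm (K x).re
    have h2 := hm (K x).im
    simp only [Pi.sub_apply, ← sub_mul, ← Complex.ofReal_sub, h1, h2]
    conv_rhs => rw [← Complex.re_add_im (K x)]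
    ring
  · simp only [LocBV.LocInt, F, monoMeasure_distr]
    exact ⟨locallyIntegrable_withDensity m1 b1 hβ hβK,
      locallyIntegrable_withDensity m2 b2 hβ hβK,
      locallyIntegrable_withDensity m3 b3 hβ hβK,
      locallyIntegrable_withDensity m4 b4 hβ hβK⟩

/-- The two clauses answer the two demands of `Acts`: the first admits Borel functions such as `φ
β`, the second yields `LocInt`. -/
theorem exists_locBV {ι : Type*} [Fintype ι] {μ : ι → Measure ℝ} {k : ι → ℝ → ℂ}
    (hμ : ∀ i, IsLocallyFiniteMeasure (μ i)) (hk : ∀ i, LocallyIntegrable (k i) (μ i)) :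
    ∃ (f : ℝ → ℂ) (F : LocBV f),
      (∀ g : ℝ → ℂ, Measurable g → (∀ i, Integrable (fun x ↦ g x * k i x) (μ i)) →
        F.integral g = ∑ i, ∫ x, g x * k i x ∂μ i) ∧
      ∀ β : ℝ → ℝ, Measurable β → (∀ i, LocallyIntegrable (fun x ↦ (β x : ℂ) * k i x) (μ i)) →
        F.LocInt β := by
  obtain ⟨ν, _, K, hK, -, hν⟩ := exists_common_density hμ hk
  obtain ⟨f, F, h1, h2⟩ := exists_locBV_of_density hK
  refine ⟨f, F, fun g hg hgk ↦ ?_, fun β hβ hβk ↦ h2 β hβ ?_⟩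
  · rw [(hν g hgk).2]
    exact h1 g hg (hν g hgk).1
  · rw [locallyIntegrable_iff]
    intro s hs
    have h3 := (hν (s.indicator fun x ↦ (β x : ℂ)) fun i ↦ ?_).1
    · rw [← integrable_indicator_iff hs.measurableSet]
      refine h3.congr (.of_forall fun x ↦ ?_)
      by_cases hx : x ∈ s <;> simp [hx]
    · have := (integrable_indicator_iff hs.measurableSet).2 ((hβk i).integrableOn_isCompact hs)
      refine this.congr (.of_forall fun x ↦ ?_)
      by_cases hx : x ∈ s <;> simp [hx]

end OfDensity

/-! ### Local square integrability -/

section LocL2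

/-- Local square integrability. -/
def LocL2 (f : ℝ → ℂ) : Prop := ∀ R : ℝ, MemLp f 2 (volume.restrict (Icc (-R) R))

variable {f g k : ℝ → ℂ}

theorem locallyIntegrable_of_Icc {μ : Measure ℝ} (h : ∀ R : ℝ, IntegrableOn f (Icc (-R) R) μ) :
    LocallyIntegrable f μ := by
  rw [locallyIntegrable_iff]
  intro s hs
  obtain ⟨R, hR⟩ := hs.isBounded.subset_closedBall 0
  refine (h R).mono_set fun x hx ↦ ?_
  have := hR hx
  rw [Real.closedBall_eq_Icc] at this
  simpa using this

theorem _root_.MeasureTheory.MemLp.locL2 (hf : MemLp f 2 volume) : LocL2 f := fun _ ↦ hf.restrict _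

theorem _root_.Continuous.memLp_restrict_Icc (hf : Continuous f) (R : ℝ) (p : ENNReal) :
    MemLp f p (volume.restrict (Icc (-R) R)) := by
  obtain ⟨C, hC⟩ := (isCompact_Icc (a := -R) (b := R)).exists_bound_of_continuousOn
    hf.continuousOn
  exact MemLp.of_bound hf.aestronglyMeasurable C
    ((ae_restrict_mem measurableSet_Icc).mono fun x hx ↦ hC x hx)

theorem _root_.Continuous.locL2 (hf : Continuous f) : LocL2 f := fun R ↦ hf.memLp_restrict_Icc R 2

theorem LocL2.top_mul (hf : LocL2 f) (hk : MemLp k ⊤ volume) : LocL2 fun x ↦ k x * f x :=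
  fun R ↦ (hf R).mul' (hk.restrict _)

theorem LocL2.continuous_mul (hf : LocL2 f) (hk : Continuous k) : LocL2 fun x ↦ k x * f x :=
  fun R ↦ (hf R).mul' (hk.memLp_restrict_Icc R ⊤)

theorem _root_.MeasureTheory.MemLp.locL2_of_top (hk : MemLp k ⊤ volume) : LocL2 k := by
  simpa using (continuous_const (y := (1 : ℂ))).locL2.top_mul hk

theorem LocL2.add (hf : LocL2 f) (hg : LocL2 g) : LocL2 fun x ↦ f x + g x :=
  fun R ↦ (hf R).add (hg R)

theorem LocL2.sub (hf : LocL2 f) (hg : LocL2 g) : LocL2 fun x ↦ f x - g x :=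
  fun R ↦ (hf R).sub (hg R)

theorem LocL2.const_mul (hf : LocL2 f) (c : ℂ) : LocL2 fun x ↦ c * f x :=
  fun R ↦ (hf R).const_mul c

theorem LocL2.mul (hf : LocL2 f) (hg : LocL2 g) : LocallyIntegrable (fun x ↦ f x * g x) volume :=
  locallyIntegrable_of_Icc fun R ↦ (hf R).integrable_mul (hg R)

theorem LocL2.locallyIntegrable (hf : LocL2 f) : LocallyIntegrable f volume := by
  simpa using hf.mul (continuous_const (y := (1 : ℂ))).locL2

theorem integrable_of_ae_eq_zero (hf : LocallyIntegrable f volume) {R : ℝ}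
    (h : ∀ᵐ x, R < |x| → f x = 0) : Integrable f := by
  have h1 : IntegrableOn f (Icc (-R) R) := hf.integrableOn_isCompact isCompact_Icc
  refine (integrableOn_iff_integrable_of_support_subset (s := univ) (subset_univ _)).mp ?_
  refine (IntegrableOn.of_ae_sdiff_eq_zero (s := Icc (-R) R) h1
    MeasurableSet.univ.nullMeasurableSet ?_)
  filter_upwards [h] with x hx hxs
  apply hx
  by_contra hcon
  exact hxs.2 (abs_le.mp (not_lt.mp hcon))

theorem integrable_bounded_mul {μ : Measure ℝ} {v : ℝ → ℂ} (hk : LocallyIntegrable k μ)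
    (hv : Measurable v) {R C : ℝ} (hR : ∀ x, R < |x| → v x = 0) (hC : ∀ x, ‖v x‖ ≤ C) :
    Integrable (fun x ↦ v x * k x) μ := by
  have h1 : IntegrableOn k (Icc (-R) R) μ := hk.integrableOn_isCompact isCompact_Icc
  have h2 : IntegrableOn (fun x ↦ v x * k x) (Icc (-R) R) μ :=
    Integrable.bdd_mul (c := C) h1 hv.aestronglyMeasurable (.of_forall hC)
  refine (integrableOn_iff_integrable_of_support_subset fun x hx ↦ ?_).mp h2
  by_contra hcon
  apply hx
  have : R < |x| := by
    by_contra h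
    exact hcon (abs_le.mp (not_lt.mp h))
  simp [hR x this]

end LocL2

/-! ### The coefficients and the bilinear form -/

/-- The coefficients of the operator, with bounds for them. -/
structure Coeffs where
  h : ℝ
  (α β b₀ b₁ V₁ : ℝ → ℝ)
  V₀ : SignedMeasure ℝ
  h_pos : 0 < h
  memLp_α : MemLp α ⊤ volume
  a : ℝ
  a_pos : 0 < a
  a_le : ∀ᵐ x, a ≤ α x
  measurable_β : Measurable β
  memLp_β : MemLp β ⊤ volume
  c : ℝ
  c_pos : 0 < c
  c_le : ∀ x, c ≤ β x
  memLp_V₁ : MemLp V₁ ⊤ volume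
  memLp_b₀ : MemLp b₀ 2 volume
  memLp_b₁ : MemLp b₁ ⊤ volume

namespace Coeffs

/-- The integrand of the absolutely continuous part of the form. -/
noncomputable def integrand (S : Coeffs) (u u' v v' : ℝ → ℂ) (x : ℝ) : ℂ :=
  (S.h : ℂ) ^ 2 * (S.α x : ℂ) * u' x * v' x +
    Complex.I * S.h * ((S.b₀ + S.b₁) x : ℝ) * (u x * v' x - u' x * v x) +
    u x * v x * (S.V₁ x : ℂ) / (S.β x : ℂ)

/-- The bilinear form of the operator. -/
noncomputable def form (S : Coeffs) (u u' v v' : ℝ → ℂ) : ℂ :=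
  (∫ x, S.integrand u u' v v' x) + signedIntegral S.V₀ fun x ↦ u x * v x / (S.β x : ℂ)

variable {S : Coeffs} {u uc u' f w v v' : ℝ → ℂ}

theorem β_pos (S : Coeffs) (x : ℝ) : 0 < S.β x := S.c_pos.trans_le (S.c_le x)

theorem β_ne (S : Coeffs) (x : ℝ) : (S.β x : ℂ) ≠ 0 := by exact_mod_cast (S.β_pos x).ne'

theorem inv_β_le (S : Coeffs) (x : ℝ) : (S.β x)⁻¹ ≤ S.c⁻¹ := inv_anti₀ S.c_pos (S.c_le x)

theorem norm_inv_β_le (S : Coeffs) (x : ℝ) : ‖(S.β x : ℂ)⁻¹‖ ≤ S.c⁻¹ := by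
  rw [norm_inv, Complex.norm_real, Real.norm_of_nonneg (S.β_pos x).le]
  exact S.inv_β_le x

theorem memLp_inv_β (S : Coeffs) : MemLp (fun x ↦ (S.β x : ℂ)⁻¹) ⊤ volume :=
  memLp_top_of_bound (Complex.measurable_ofReal.comp S.measurable_β).inv.aestronglyMeasurable
    S.c⁻¹ (.of_forall S.norm_inv_β_le)

theorem locL2_b (S : Coeffs) : LocL2 fun x ↦ (((S.b₀ + S.b₁) x : ℝ) : ℂ) := by
  have h0 : MemLp (fun x ↦ (S.b₀ x : ℂ)) 2 volume := S.memLp_b₀.ofReal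
  have h1 : MemLp (fun x ↦ (S.b₁ x : ℂ)) ⊤ volume := S.memLp_b₁.ofReal
  simpa using h0.locL2.add h1.locL2_of_top

theorem memLp_V₁_div (S : Coeffs) : MemLp (fun x ↦ (S.V₁ x : ℂ) * (S.β x : ℂ)⁻¹) ⊤ volume :=
  S.memLp_inv_β.mul' S.memLp_V₁.ofReal

/-- The coefficient `b` is only locally square integrable, so `u'` and `v'` have to be as well:
every term is then a product of two `LocL2` factors. -/
theorem locallyIntegrable_integrand (hu : Continuous u) (hu' : LocL2 u') (hv : Continuous v)
    (hv' : LocL2 v') : LocallyIntegrable (S.integrand u u' v v') volume := by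
  have hα : MemLp (fun x ↦ (S.α x : ℂ)) ⊤ volume := S.memLp_α.ofReal
  have t1 := ((hu'.top_mul hα).const_mul ((S.h : ℂ) ^ 2)).mul hv'
  have t2 := ((S.locL2_b.continuous_mul hu).const_mul (Complex.I * S.h)).mul hv'
  have t3 := (S.locL2_b.const_mul (Complex.I * S.h)).mul (hu'.continuous_mul hv)
  have t4 := (hv.locL2.top_mul S.memLp_V₁_div).continuous_mul hu
  refine ((t1.add (t2.sub t3)).add t4.locallyIntegrable).congr (.of_forall fun x ↦ ?_)
  simp only [integrand, Pi.add_apply, Pi.sub_apply]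
  ring

theorem integrand_eq_zero_of_abs_lt (S : Coeffs) (u u' : ℝ → ℂ) (hv : IsPrim v v') {R : ℝ}
    (hR : ∀ x, R ≤ |x| → v x = 0) : ∀ᵐ x, R < |x| → S.integrand u u' v v' x = 0 := by
  filter_upwards [hv.ae_eq_zero_of_abs_lt hR] with x hx h
  simp [integrand, hx h, hR x h.le]

theorem integrable_integrand_of_compact (hu : Continuous u) (hu' : LocL2 u') (hv : IsPrim v v')
    (hv' : LocL2 v') (hc : HasCompactSupport v) : Integrable (S.integrand u u' v v') := by
  obtain ⟨R, -, hR⟩ := IsPrim.exists_radius hc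
  exact integrable_of_ae_eq_zero (locallyIntegrable_integrand hu hu' hv.continuous hv')
    (S.integrand_eq_zero_of_abs_lt u u' hv hR)

end Coeffs

/-! ### From the distributional equation to the weak form -/

namespace Coeffs

variable {S : Coeffs} {u uc u' f w v v' : ℝ → ℂ}

/-- The action of the operator with the coefficients `S`. -/
def ActsOn (S : Coeffs) (u uc u' f w : ℝ → ℂ) : Prop :=
  Acts S.h S.α S.β (S.b₀ + S.b₁) S.V₀ S.V₁ u uc u' f w

theorem ActsOn.isPrim (H : S.ActsOn u uc u' f w) : IsPrim uc u' := H.2.2.1.isPrim H.1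

/-- A function of locally bounded variation is locally bounded, and `b uc` is locally square
integrable. Their combination is `h α u'`, and `α` is bounded below. This is the first gain of
regularity on the maximal domain, where `u'` is only locally integrable a priori. -/
theorem ActsOn.locL2_deriv (H : S.ActsOn u uc u' f w) : LocL2 u' := by
  obtain ⟨hc, -, hw, hf, F, -⟩ := H
  have hflux : LocL2 f := fun R ↦ by
    obtain ⟨C, hC⟩ := F.exists_bound R
    exact MemLp.of_bound F.measurable.aestronglyMeasurable C
      ((ae_restrict_mem measurableSet_Icc).mono fun x hx ↦ hC x hx)
  have h1 := hflux.sub ((S.locL2_b.continuous_mul hc).const_mul Complex.I)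
  intro R
  refine (h1 R).of_le_mul (c := (S.h * S.a)⁻¹) hw.2.1.aestronglyMeasurable.restrict ?_
  refine ae_restrict_of_ae ?_
  filter_upwards [hf, S.a_le] with x hx ha
  have e : f x - Complex.I * (uc x * (((S.b₀ + S.b₁) x : ℝ) : ℂ)) = (S.h : ℂ) * S.α x * u' x := by
    rw [hx]; ring
  have hp : 0 < S.h * S.a := mul_pos S.h_pos S.a_pos
  rw [e, norm_mul, norm_mul, Complex.norm_real, Complex.norm_real,
    Real.norm_of_nonneg S.h_pos.le, Real.norm_of_nonneg (S.a_pos.le.trans ha),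
    inv_mul_eq_div, le_div_iff₀ hp, mul_comm]
  have := S.h_pos
  gcongr

/-- The density of the absolutely continuous part of the measure `h df`. -/
noncomputable def dens (S : Coeffs) (u u' w : ℝ → ℂ) (x : ℝ) : ℂ :=
  (S.h : ℂ) * ((S.b₀ + S.b₁) x : ℝ) * (-Complex.I * u' x) +
    (u x * (S.V₁ x : ℂ) - w x) / (S.β x : ℂ)

theorem locallyIntegrable_dens (hu : Continuous u) (hu' : LocL2 u')
    (hw : MemLp w 2 volume) : LocallyIntegrable (S.dens u u' w) volume := by
  have t1 := (S.locL2_b.const_mul (-Complex.I * S.h)).mul hu'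
  have t2 := hu.locL2.top_mul S.memLp_V₁_div
  have t3 := hw.locL2.top_mul S.memLp_inv_β
  refine (t1.add (t2.sub t3).locallyIntegrable).congr (.of_forall fun x ↦ ?_)
  simp only [dens, Pi.add_apply]
  ring

/-- Needed alongside `locallyIntegrable_dens`, because the equation is given multiplied by `β` and
used divided by it. -/
theorem locallyIntegrable_β_dens (hu : Continuous u) (hu' : LocL2 u')
    (hw : MemLp w 2 volume) :
    LocallyIntegrable (fun x ↦ (S.β x : ℂ) * S.dens u u' w x) volume := by
  have hβ : MemLp (fun x ↦ (S.β x : ℂ)) ⊤ volume := S.memLp_β.ofReal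
  have hV : MemLp (fun x ↦ (S.V₁ x : ℂ)) ⊤ volume := S.memLp_V₁.ofReal
  have t1 := ((S.locL2_b.top_mul hβ).const_mul (-Complex.I * S.h)).mul hu'
  have t2 := hu.locL2.top_mul hV
  refine (t1.add (t2.sub hw.locL2).locallyIntegrable).congr (.of_forall fun x ↦ ?_)
  have := S.β_ne x
  simp only [dens, Pi.add_apply]
  field_simp

theorem integral_mul_β_dens (S : Coeffs) (hu : Continuous u) (hu' : LocL2 u')
    (hw : MemLp w 2 volume) (hv : Continuous v) (hc : HasCompactSupport v) :
    ∫ x, v x * ((S.β x : ℂ) * S.dens u u' w x) = (∫ x, v x *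
      ((S.h : ℂ) * S.β x * ((S.b₀ + S.b₁) x : ℝ) * (-Complex.I * u' x))) +
      (∫ x, v x * (u x * (S.V₁ x : ℂ))) - ∫ x, v x * w x := by
  have hV : MemLp (fun x ↦ (S.V₁ x : ℂ)) ⊤ volume := S.memLp_V₁.ofReal
  have hβ : MemLp (fun x ↦ (S.β x : ℂ)) ⊤ volume := S.memLp_β.ofReal
  have hi : ∀ {p : ℝ → ℂ}, LocallyIntegrable p volume → Integrable fun x ↦ v x * p x :=
    fun hp ↦ hp.integrable_smul_left_of_hasCompactSupport hv hc
  have i1 : Integrable fun x ↦ v x *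
      ((S.h : ℂ) * S.β x * ((S.b₀ + S.b₁) x : ℝ) * (-Complex.I * u' x)) := by
    refine hi ((((S.locL2_b.top_mul hβ).const_mul (-Complex.I * S.h)).mul hu').congr
      (.of_forall fun x ↦ ?_))
    ring
  have i2 : Integrable fun x ↦ v x * (u x * (S.V₁ x : ℂ)) := by
    refine hi ((hu.locL2.top_mul hV).locallyIntegrable.congr (.of_forall fun x ↦ ?_))
    ring
  have i3 : Integrable fun x ↦ v x * w x := hi hw.locL2.locallyIntegrable
  rw [← integral_add i1 i2]
  refine Eq.trans ?_ (integral_sub (i1.add i2) i3)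
  refine integral_congr_ae (.of_forall fun x ↦ ?_)
  have := S.β_ne x
  simp only [dens, Pi.add_apply]
  field_simp
  ring

/-- The flux `h α u' + i b u`. -/
noncomputable def flux (S : Coeffs) (u u' : ℝ → ℂ) (x : ℝ) : ℂ :=
  (S.h : ℂ) * (S.α x : ℂ) * u' x + Complex.I * ((S.b₀ + S.b₁) x : ℝ) * u x

/-- Pure algebra: `w` enters through `dens` and through `∫ w v / β` with opposite signs, so the
identity holds for every square integrable `w`, whether or not `u` solves the equation. -/
theorem form_eq_flux (S : Coeffs) (hu : Continuous u) (hu' : LocL2 u') (hw : MemLp w 2 volume)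
    (hv : IsPrim v v') (hv' : LocL2 v') (hc : HasCompactSupport v) :
    S.form u u' v v' = (S.h : ℂ) * (∫ x, S.flux u u' x * v' x) + (∫ x, v x * S.dens u u' w x) +
      (∫ x, w x * v x / (S.β x : ℂ)) + signedIntegral S.V₀ fun x ↦ v x * u x / (S.β x : ℂ) := by
  have i1 : Integrable fun x ↦ v x * S.dens u u' w x :=
    (locallyIntegrable_dens hu hu' hw).integrable_smul_left_of_hasCompactSupport hv.continuous hc
  have i2 := integrable_integrand_of_compact (S := S) hu hu' hv hv' hc
  have i3 : Integrable fun x ↦ w x * v x / (S.β x : ℂ) := by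
    refine ((hw.locL2.top_mul S.memLp_inv_β).locallyIntegrable
      |>.integrable_smul_left_of_hasCompactSupport hv.continuous hc).congr (.of_forall fun x ↦ ?_)
    simp only [smul_eq_mul]; ring
  have hpt : ∀ x, (S.h : ℂ) * (S.flux u u' x * v' x) = S.integrand u u' v v' x -
      v x * S.dens u u' w x - w x * v x / (S.β x : ℂ) := by
    intro x; simp only [integrand, dens, flux]; ring
  have e : (S.h : ℂ) * (∫ x, S.flux u u' x * v' x) = (∫ x, S.integrand u u' v v' x) -
      (∫ x, v x * S.dens u u' w x) - ∫ x, w x * v x / (S.β x : ℂ) := by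
    rw [← integral_const_mul]
    simp only [hpt]
    refine (integral_sub (i2.sub i1) i3).trans (congrArg₂ _ ?_ rfl)
    exact integral_sub i2 i1
  have e2 : signedIntegral S.V₀ (fun x ↦ u x * v x / (S.β x : ℂ)) =
      signedIntegral S.V₀ (fun x ↦ v x * u x / (S.β x : ℂ)) := by
    congr 1; funext x; ring
  rw [e, form, e2]
  ring

/-- The measures occurring in the equation of the operator. -/
noncomputable def measures (S : Coeffs) : Fin 3 → Measure ℝ :=
  ![S.V₀.toJordanDecomposition.posPart, S.V₀.toJordanDecomposition.negPart, volume]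

theorem measures_isLocallyFinite (S : Coeffs) (i : Fin 3) :
    IsLocallyFiniteMeasure (S.measures i) := by
  match i with
  | 0 => exact inferInstanceAs
      (IsLocallyFiniteMeasure S.V₀.toJordanDecomposition.posPart)
  | 1 => exact inferInstanceAs
      (IsLocallyFiniteMeasure S.V₀.toJordanDecomposition.negPart)
  | 2 => exact inferInstanceAs (IsLocallyFiniteMeasure (volume : Measure ℝ))

/-- The measure `df` of the flux `f`, against bounded measurable functions of compact support. -/
theorem ActsOn.integral_flux (H : S.ActsOn u uc u' f w) (hw : MemLp w 2 volume) :
    ∃ F : LocBV f, ∀ (g : ℝ → ℂ) (R C : ℝ), Measurable g → (∀ x, R < |x| → g x = 0) →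
      (∀ x, ‖g x‖ ≤ C) →
      (S.h : ℂ) * F.integral g = (∫ x, g x * S.dens uc u' w x) +
        signedIntegral S.V₀ fun x ↦ g x * uc x / (S.β x : ℂ) := by
  have hu' := H.locL2_deriv
  obtain ⟨hc, -, -, hf, F, hF, hφ⟩ := H
  refine ⟨F, fun g R C hg hR hC ↦ ?_⟩
  rw [F.locInt_iff] at hF
  set d : ℝ → ℂ := fun x ↦ (S.β x : ℂ) * S.dens uc u' w x with hd
  have hdl : LocallyIntegrable d volume := locallyIntegrable_β_dens hc hu' hw
  -- The whole equation is one sum over seven measures: the four of `f`, with multiples of `β` as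
  -- densities, the two Jordan parts of `V₀`, and Lebesgue measure.
  let μ : Fin 4 ⊕ Fin 3 → Measure ℝ := Sum.elim F.meas S.measures
  let k : Fin 4 ⊕ Fin 3 → ℝ → ℂ := Sum.elim
    (fun i x ↦ (-(S.h : ℂ) * LocBV.coef i) * (S.β x : ℂ)) ![uc, fun x ↦ -uc x, d]
  have hμ : ∀ i, IsLocallyFiniteMeasure (μ i) := by
    rintro (i | i)
    · exact F.meas_isLocallyFinite i
    · exact S.measures_isLocallyFinite i
  have hk : ∀ i, LocallyIntegrable (k i) (μ i) := by
    rintro (i | i)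
    · intro x
      exact ((Complex.ofRealCLM.integrableAtFilter_comp (hF i x))).smul
        (-(S.h : ℂ) * LocBV.coef i)
    · match i with
      | 0 => exact hc.locallyIntegrable
      | 1 => exact hc.neg.locallyIntegrable
      | 2 => exact hdl
  have hsum : ∀ g : ℝ → ℂ, ∑ i, ∫ x, g x * k i x ∂μ i =
      -(S.h : ℂ) * F.integral (fun x ↦ g x * (S.β x : ℂ)) +
        signedIntegral S.V₀ (fun x ↦ g x * uc x) + ∫ x, g x * d x := by
    intro g
    have e1 : ∀ i : Fin 4, ∫ x, g x * k (Sum.inl i) x ∂μ (Sum.inl i) =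
        -(S.h : ℂ) * (LocBV.coef i * ∫ x, g x * (S.β x : ℂ) ∂F.meas i) := by
      intro i
      rw [← mul_assoc, ← integral_const_mul]
      congr 1
      funext x
      simp only [k, Sum.elim_inl]
      ring
    rw [Fintype.sum_sum_type, F.integral_eq_sum, Finset.mul_sum, Fin.sum_univ_three,
      Finset.sum_congr rfl fun i _ ↦ e1 i]
    simp only [k, μ, measures, Sum.elim_inr, signedIntegral]
    simp only [Matrix.cons_val_zero, Matrix.cons_val_one, Matrix.cons_val, mul_neg, integral_neg]
    ring
  have hβm : Measurable fun x ↦ (S.β x : ℂ) := Complex.measurable_ofReal.comp S.measurable_β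
  -- The sum vanishes on test functions, hence on the Borel function `g / β`. This is the division
  -- of the equation by `β`.
  have key := sum_integral_eq_zero hμ hk (fun φ hφt ↦ ?_) (g := fun x ↦ g x * (S.β x : ℂ)⁻¹)
    fun i ↦ ?_
  · rw [hsum] at key
    have hg1 : (fun x ↦ g x * (S.β x : ℂ)⁻¹ * (S.β x : ℂ)) = g := by
      funext x; rw [mul_assoc, inv_mul_cancel₀ (S.β_ne x), mul_one]
    have hg2 : (fun x ↦ g x * (S.β x : ℂ)⁻¹ * uc x) = fun x ↦ g x * uc x / (S.β x : ℂ) := by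
      funext x; rw [div_eq_mul_inv]; ring
    have hg3 : (fun x ↦ g x * (S.β x : ℂ)⁻¹ * d x) = fun x ↦ g x * S.dens uc u' w x := by
      funext x
      simp only [hd]
      have := S.β_ne x
      field_simp
    rw [hg1, hg2, hg3] at key
    linear_combination -key
  · rw [hsum]
    have h1 := hφ φ hφt
    have e := S.integral_mul_β_dens hc hu' hw hφt.isPrim.continuous hφt.2
    rw [e]
    linear_combination h1
  · refine integrable_bounded_mul (hk i) (R := R) (C := C * S.c⁻¹) (hg.mul hβm.inv)
      (fun x hx ↦ by simp [hR x hx]) fun x ↦ ?_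
    rw [norm_mul]
    exact mul_le_mul (hC x) (S.norm_inv_β_le x) (norm_nonneg _) ((norm_nonneg _).trans (hC x))

theorem exists_bound_of_compact (hv : Continuous v) (hc : HasCompactSupport v) :
    ∃ C, ∀ x, ‖v x‖ ≤ C := hv.bounded_above_of_compact_support hc

/-- The weak form of the equation, against compactly supported functions. -/
theorem ActsOn.form_eq (H : S.ActsOn u uc u' f w) (hw : MemLp w 2 volume) (hv : IsPrim v v')
    (hv' : LocL2 v') (hc : HasCompactSupport v) :
    S.form uc u' v v' = ∫ x, w x * v x / (S.β x : ℂ) := by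
  have hu' := H.locL2_deriv
  have huc : Continuous uc := H.1
  have hf := H.2.2.2.1
  obtain ⟨F, hF⟩ := H.integral_flux hw
  obtain ⟨R, -, hR⟩ := IsPrim.exists_radius hc
  obtain ⟨C, hC⟩ := exists_bound_of_compact hv.continuous hc
  have h1 := hF v R C hv.continuous.measurable (fun x hx ↦ hR x hx.le) hC
  rw [F.integral_eq_neg hv hc] at h1
  have hfi : ∫ x, f x * v' x = ∫ x, S.flux uc u' x * v' x :=
    integral_congr_ae (hf.mono fun x hx ↦ by simp only [hx, flux])
  rw [hfi] at h1
  rw [S.form_eq_flux huc hu' hw hv hv' hc]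
  linear_combination -h1

end Coeffs

/-! ### The Sobolev inequality and bounds for the form -/

/-- The Sobolev space `H¹`, for a continuous function and its derivative. -/
structure IsH1 (u u' : ℝ → ℂ) : Prop where
  prim : IsPrim u u'
  memLp : MemLp u 2 volume
  memLp_deriv : MemLp u' 2 volume

/-- The square of the `L²` norm. -/
noncomputable def sqInt (u : ℝ → ℂ) : ℝ := ∫ x, ‖u x‖ ^ 2

theorem sqInt_nonneg (u : ℝ → ℂ) : 0 ≤ sqInt u := integral_nonneg fun _ ↦ by positivity

theorem integrable_sq {u : ℝ → ℂ} (hu : MemLp u 2 volume) : Integrable fun x ↦ ‖u x‖ ^ 2 :=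
  hu.norm.integrable_sq

/-- Cauchy–Schwarz, from expanding the nonnegative integral of `(g - m)²` with `m` the mean of `g`.
-/
theorem sq_setIntegral_le {g : ℝ → ℝ} {x δ : ℝ} (hδ : 0 < δ)
    (hg : MemLp g 2 (volume.restrict (Ioc x (x + δ)))) :
    (∫ t in Ioc x (x + δ), g t) ^ 2 ≤ δ * ∫ t in Ioc x (x + δ), g t ^ 2 := by
  have hv : (volume.restrict (Ioc x (x + δ))).real univ = δ := by
    simp [Measure.real, hδ.le]
  have i1 : IntegrableOn g (Ioc x (x + δ)) := hg.integrable (by norm_num)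
  have i2 : IntegrableOn (fun t ↦ g t ^ 2) (Ioc x (x + δ)) := hg.integrable_sq
  set m := (∫ t in Ioc x (x + δ), g t) / δ with hm
  have h0 : 0 ≤ ∫ t in Ioc x (x + δ), (g t - m) ^ 2 := integral_nonneg fun t ↦ sq_nonneg _
  have e : ∀ t, (g t - m) ^ 2 = g t ^ 2 - (2 * m) * g t + m ^ 2 := fun t ↦ by ring
  simp only [e] at h0
  have e2 : ∫ t in Ioc x (x + δ), (g t ^ 2 - (2 * m) * g t + m ^ 2) =
      (∫ t in Ioc x (x + δ), g t ^ 2) - (2 * m) * (∫ t in Ioc x (x + δ), g t) + δ * m ^ 2 := by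
    refine (integral_add (i2.sub (i1.const_mul _)) (integrable_const _)).trans
      (congrArg₂ _ ?_ (by rw [integral_const, hv, smul_eq_mul]))
    exact (integral_sub i2 (i1.const_mul _)).trans (congrArg₂ _ rfl (integral_const_mul _ _))
  rw [e2] at h0
  have hI : ∫ t in Ioc x (x + δ), g t = m * δ := by rw [hm]; field_simp
  rw [hI] at h0 ⊢
  nlinarith

theorem sq_setIntegral_norm_le {u : ℝ → ℂ} (hu : MemLp u 2 volume) (x : ℝ) {δ : ℝ} (hδ : 0 < δ) :
    (∫ t in Ioc x (x + δ), ‖u t‖) ^ 2 ≤ δ * sqInt u := by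
  refine (sq_setIntegral_le hδ (hu.norm.restrict _)).trans ?_
  gcongr
  exact setIntegral_le_integral (integrable_sq hu) (.of_forall fun _ ↦ by positivity)

theorem le_average {g : ℝ → ℝ} {a x δ : ℝ} (hδ : 0 < δ)
    (hg : IntegrableOn g (Ioc x (x + δ))) (h : ∀ᵐ t, t ∈ Ioc x (x + δ) → a ≤ g t) :
    δ * a ≤ ∫ t in Ioc x (x + δ), g t := by
  have hv : (volume.restrict (Ioc x (x + δ))).real univ = δ := by
    simp [Measure.real, hδ.le]
  have := setIntegral_mono_ae_restrict (μ := volume) (s := Ioc x (x + δ)) (f := fun _ ↦ a)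
    (integrable_const _) hg ((ae_restrict_iff' measurableSet_Ioc).2 h)
  rwa [integral_const, hv, smul_eq_mul] at this

namespace IsH1

variable {u u' v v' : ℝ → ℂ}

theorem conj (hu : IsH1 u u') :
    IsH1 (fun x ↦ starRingEnd ℂ (u x)) (fun x ↦ starRingEnd ℂ (u' x)) :=
  ⟨hu.prim.conj, hu.memLp.star, hu.memLp_deriv.star⟩

theorem add (hu : IsH1 u u') (hv : IsH1 v v') :
    IsH1 (fun x ↦ u x + v x) (fun x ↦ u' x + v' x) :=
  ⟨hu.prim.add hv.prim, hu.memLp.add hv.memLp, hu.memLp_deriv.add hv.memLp_deriv⟩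

theorem const_mul (c : ℂ) (hu : IsH1 u u') : IsH1 (fun x ↦ c * u x) (fun x ↦ c * u' x) :=
  ⟨hu.prim.const_mul c, hu.memLp.const_mul c, hu.memLp_deriv.const_mul c⟩

/-- Average `‖u x‖ ≤ ‖u t‖ + ∫ ‖u'‖` over `t` in an interval of length `δ` and apply Cauchy–Schwarz
to both integrals. A small `δ` makes the derivative term small at the expense of the other. -/
theorem norm_sq_le (hu : IsH1 u u') {δ : ℝ} (hδ : 0 < δ) (x : ℝ) :
    ‖u x‖ ^ 2 ≤ 2 / δ * sqInt u + 2 * δ * sqInt u' := by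
  have iu : IntegrableOn (fun t ↦ ‖u t‖) (Ioc x (x + δ)) :=
    (hu.prim.continuous.norm.integrableOn_Icc).mono_set Ioc_subset_Icc_self
  have iu' : IntegrableOn (fun t ↦ ‖u' t‖) (Ioc x (x + δ)) :=
    ((hu.prim.locInt.integrableOn_isCompact isCompact_Icc).mono_set Ioc_subset_Icc_self).norm
  have h1 : δ * (‖u x‖ - ∫ t in Ioc x (x + δ), ‖u' t‖) ≤ ∫ t in Ioc x (x + δ), ‖u t‖ := by
    refine le_average hδ iu (.of_forall fun t ht ↦ ?_)
    have e : u x = u t - ∫ s in x..t, u' s := by rw [hu.prim.integral_eq]; ring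
    have h2 : ‖∫ s in x..t, u' s‖ ≤ ∫ s in Ioc x (x + δ), ‖u' s‖ := by
      rw [intervalIntegral.integral_of_le ht.1.le]
      refine (norm_integral_le_integral_norm _).trans ?_
      exact setIntegral_mono_set iu' (.of_forall fun _ ↦ norm_nonneg _)
        (Ioc_subset_Ioc_right ht.2).eventuallyLE
    have h3 : ‖u x‖ ≤ ‖u t‖ + ‖∫ s in x..t, u' s‖ := by
      conv_lhs => rw [e]
      exact norm_sub_le _ _
    linarith
  have h4 := sq_setIntegral_norm_le hu.memLp x hδ
  have h5 := sq_setIntegral_norm_le hu.memLp_deriv x hδ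
  set P := ∫ t in Ioc x (x + δ), ‖u t‖
  set Q := ∫ t in Ioc x (x + δ), ‖u' t‖
  have h6 : ‖u x‖ ≤ P / δ + Q := by
    rw [← sub_le_iff_le_add, le_div_iff₀ hδ]; linarith
  calc ‖u x‖ ^ 2 ≤ (P / δ + Q) ^ 2 := by gcongr
    _ ≤ 2 * (P / δ) ^ 2 + 2 * Q ^ 2 := by nlinarith [sq_nonneg (P / δ - Q)]
    _ ≤ 2 * (δ * sqInt u / δ ^ 2) + 2 * (δ * sqInt u') := by rw [div_pow]; gcongr
    _ = _ := by field_simp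

theorem norm_sq_le_add (hu : IsH1 u u') (x : ℝ) : ‖u x‖ ^ 2 ≤ 2 * (sqInt u + sqInt u') := by
  have := hu.norm_sq_le one_pos x
  linarith

theorem exists_bound (hu : IsH1 u u') : ∃ C, ∀ x, ‖u x‖ ≤ C :=
  ⟨√(2 * (sqInt u + sqInt u')), fun x ↦ Real.le_sqrt_of_sq_le (hu.norm_sq_le_add x)⟩

theorem memLp_top (hu : IsH1 u u') : MemLp u ⊤ volume := by
  obtain ⟨C, hC⟩ := hu.exists_bound
  exact memLp_top_of_bound hu.prim.continuous.aestronglyMeasurable C (.of_forall hC)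

end IsH1

theorem exists_ae_bound {k : ℝ → ℝ} (hk : MemLp k ⊤ volume) :
    ∃ C, 0 ≤ C ∧ ∀ᵐ x, |k x| ≤ C := by
  refine ⟨(eLpNorm k ⊤ volume).toReal, ENNReal.toReal_nonneg, ?_⟩
  filter_upwards [ae_le_eLpNormEssSup (f := k) (μ := volume)] with x hx
  rw [← eLpNorm_exponent_top] at hx
  have := ENNReal.toReal_mono hk.2.ne hx
  simpa using this

theorem norm_integral_finite_le {μ : Measure ℝ} [IsFiniteMeasure μ] {g : ℝ → ℂ} {M : ℝ}
    (hg : ∀ x, ‖g x‖ ≤ M) : ‖∫ x, g x ∂μ‖ ≤ M * μ.real univ :=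
  norm_integral_le_of_norm_le_const (.of_forall hg)

/-- The total mass of the two parts of a signed measure. -/
noncomputable def totalMass (ν : SignedMeasure ℝ) : ℝ :=
  ν.toJordanDecomposition.posPart.real univ + ν.toJordanDecomposition.negPart.real univ

theorem totalMass_nonneg (ν : SignedMeasure ℝ) : 0 ≤ totalMass ν :=
  add_nonneg measureReal_nonneg measureReal_nonneg

theorem norm_signedIntegral_le (ν : SignedMeasure ℝ) {g : ℝ → ℂ} {M : ℝ}
    (hg : ∀ x, ‖g x‖ ≤ M) : ‖signedIntegral ν g‖ ≤ M * totalMass ν := by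
  refine (norm_sub_le _ _).trans ?_
  rw [totalMass, mul_add]
  exact add_le_add (norm_integral_finite_le hg) (norm_integral_finite_le hg)

namespace Coeffs

variable {u u' v v' : ℝ → ℂ}

theorem norm_div_β_le (S : Coeffs) (z : ℂ) (x : ℝ) : ‖z / (S.β x : ℂ)‖ ≤ ‖z‖ / S.c := by
  rw [div_eq_mul_inv, norm_mul, div_eq_mul_inv]
  gcongr
  exact S.norm_inv_β_le x

theorem integrable_b₀_sq (S : Coeffs) : Integrable fun x ↦ S.b₀ x ^ 2 := S.memLp_b₀.integrable_sq

/-- A pointwise bound for the integrand of the form. -/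
theorem exists_integrand_bound (S : Coeffs) : ∃ K : ℝ, 0 ≤ K ∧ ∀ u u' v v' : ℝ → ℂ,
    (∀ᵐ x, ‖S.integrand u u' v v' x‖ ≤ K * (‖u x‖ ^ 2 + ‖u' x‖ ^ 2 + ‖v x‖ ^ 2 + ‖v' x‖ ^ 2 +
      S.b₀ x ^ 2 * (‖u x‖ ^ 2 + ‖v x‖ ^ 2))) ∧
    ∀ᵐ x, ‖(S.h : ℂ) ^ 2 * S.α x * u' x * v x +
      Complex.I * S.h * ((S.b₀ + S.b₁) x : ℝ) * (u x * v x)‖ ≤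
        K * (‖u x‖ ^ 2 + ‖u' x‖ ^ 2 + ‖v x‖ ^ 2 + S.b₀ x ^ 2 * (‖u x‖ ^ 2)) := by
  obtain ⟨A, hA0, hA⟩ := exists_ae_bound S.memLp_α
  obtain ⟨B, hB0, hB⟩ := exists_ae_bound S.memLp_b₁
  obtain ⟨W, hW0, hW⟩ := exists_ae_bound S.memLp_V₁
  have hh := S.h_pos
  have hc := S.c_pos
  -- `A`, `B`, `W` bound `α`, `b₁`, `V₁`. The leading term costs `h² A`, the magnetic term at most
  -- `2 h` and `2 h B²` by way of `(b₀ + b₁)² ≤ 2 b₀² + 2 B²`, and the potential `W / c`.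
  refine ⟨S.h ^ 2 * A + 2 * S.h + 2 * S.h * B ^ 2 + W / S.c, by positivity,
    fun u u' v v' ↦ ⟨?_, ?_⟩⟩
  · filter_upwards [hA, hB, hW] with x ha hb hw
    have n1 : ‖S.integrand u u' v v' x‖ ≤ S.h ^ 2 * |S.α x| * ‖u' x‖ * ‖v' x‖ +
        S.h * |S.b₀ x + S.b₁ x| * (‖u x‖ * ‖v' x‖ + ‖u' x‖ * ‖v x‖) +
        ‖u x‖ * ‖v x‖ * |S.V₁ x| / S.c := by
      rw [integrand]
      refine (norm_add₃_le).trans (add_le_add (add_le_add ?_ ?_) ?_)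
      · simp [abs_of_pos hh]
      · rw [norm_mul, norm_mul, norm_mul, Complex.norm_I, one_mul, Complex.norm_real,
          Complex.norm_real, Real.norm_of_nonneg hh.le, ← norm_mul, ← norm_mul]
        gcongr
        · exact le_rfl
        · exact norm_sub_le _ _
      · refine (S.norm_div_β_le _ x).trans (le_of_eq ?_)
        simp
    refine n1.trans ?_
    set p := ‖u x‖
    set p' := ‖u' x‖
    set q := ‖v x‖
    set q' := ‖v' x‖
    have hp : 0 ≤ p := norm_nonneg _
    have hp' : 0 ≤ p' := norm_nonneg _
    have hq : 0 ≤ q := norm_nonneg _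
    have hq' : 0 ≤ q' := norm_nonneg _
    set b := S.b₀ x
    have hbb : (b + S.b₁ x) ^ 2 ≤ 2 * b ^ 2 + 2 * B ^ 2 := by
      nlinarith [sq_nonneg (b - S.b₁ x), sq_le_sq' (by linarith [(abs_le.1 hb).1]) (abs_le.1 hb).2]
    set t := |b + S.b₁ x| with ht
    have ht2 : t ^ 2 ≤ 2 * b ^ 2 + 2 * B ^ 2 := by rw [ht, sq_abs]; exact hbb
    have e1 : S.h ^ 2 * |S.α x| * p' * q' ≤ S.h ^ 2 * A * (p' ^ 2 + q' ^ 2) := by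
      rw [mul_assoc (S.h ^ 2 * |S.α x|)]
      gcongr
      nlinarith [sq_nonneg (p' - q'), sq_nonneg (p' + q')]
    have e2 : t * (p * q' + p' * q) ≤ (2 * b ^ 2 + 2 * B ^ 2) * (p ^ 2 + q ^ 2) +
        (p' ^ 2 + q' ^ 2) := by
      have : t * (p * q' + p' * q) ≤ t ^ 2 * (p ^ 2 + q ^ 2) + (p' ^ 2 + q' ^ 2) := by
        nlinarith [sq_nonneg (t * p - q'), sq_nonneg (t * q - p'), sq_nonneg (t * p),
          sq_nonneg (t * q), sq_nonneg p', sq_nonneg q']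
      refine this.trans ?_
      gcongr
    have e3 : p * q * |S.V₁ x| / S.c ≤ W / S.c * (p ^ 2 + q ^ 2) := by
      rw [div_mul_eq_mul_div, mul_comm (p * q)]
      gcongr
      nlinarith [sq_nonneg (p - q), sq_nonneg (p + q)]
    have e4 := mul_le_mul_of_nonneg_left e2 hh.le
    have r1 : 0 ≤ S.h ^ 2 * A := by positivity
    have r2 : 0 ≤ S.h * B ^ 2 := by positivity
    have r3 : 0 ≤ W / S.c := by positivity
    set Y := b ^ 2 * (p ^ 2 + q ^ 2)
    have hY : 0 ≤ Y := by positivity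
    have e5 : S.h * ((2 * b ^ 2 + 2 * B ^ 2) * (p ^ 2 + q ^ 2) + (p' ^ 2 + q' ^ 2)) =
      2 * S.h * Y + 2 * (S.h * B ^ 2) * (p ^ 2 + q ^ 2) + S.h * (p' ^ 2 + q' ^ 2) := by
      simp only [Y]; ring
    rw [e5] at e4
    have s1 : 0 ≤ p ^ 2 + q ^ 2 := by positivity
    have s2 : 0 ≤ p' ^ 2 + q' ^ 2 := by positivity
    set s := p ^ 2 + q ^ 2
    set s' := p' ^ 2 + q' ^ 2
    have e6 : p ^ 2 + p' ^ 2 + q ^ 2 + q' ^ 2 + Y = s + s' + Y := by simp only [s, s']; ring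
    rw [e6]
    rw [mul_assoc S.h t]
    have k1 := mul_le_mul_of_nonneg_right (show 2 * (S.h * B ^ 2) + W / S.c ≤ S.h ^ 2 * A +
      2 * S.h + 2 * S.h * B ^ 2 + W / S.c by linarith) s1
    have k2 := mul_le_mul_of_nonneg_right (show S.h ^ 2 * A + S.h ≤ S.h ^ 2 * A +
      2 * S.h + 2 * S.h * B ^ 2 + W / S.c by linarith) s2
    have k3 := mul_le_mul_of_nonneg_right (show 2 * S.h ≤ S.h ^ 2 * A +
      2 * S.h + 2 * S.h * B ^ 2 + W / S.c by linarith) hY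
    linarith
  -- This second quantity is what multiplies the derivative of a cut-off when the form is tested
  -- with a truncated function.
  · filter_upwards [hA, hB] with x ha hb
    have n1 : ‖(S.h : ℂ) ^ 2 * S.α x * u' x * v x +
        Complex.I * S.h * ((S.b₀ + S.b₁) x : ℝ) * (u x * v x)‖ ≤
        S.h ^ 2 * |S.α x| * ‖u' x‖ * ‖v x‖ + S.h * |S.b₀ x + S.b₁ x| * (‖u x‖ * ‖v x‖) := by
      refine (norm_add_le _ _).trans (add_le_add ?_ ?_)
      · simp [abs_of_pos hh]
      · rw [norm_mul, norm_mul, norm_mul, Complex.norm_I, one_mul, Complex.norm_real,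
          Complex.norm_real, Real.norm_of_nonneg hh.le, norm_mul]
        exact le_rfl
    refine n1.trans ?_
    set p := ‖u x‖
    set p' := ‖u' x‖
    set q := ‖v x‖
    have hp : 0 ≤ p := norm_nonneg _
    have hp' : 0 ≤ p' := norm_nonneg _
    have hq : 0 ≤ q := norm_nonneg _
    set b := S.b₀ x
    have hbb : (b + S.b₁ x) ^ 2 ≤ 2 * b ^ 2 + 2 * B ^ 2 := by
      nlinarith [sq_nonneg (b - S.b₁ x), sq_le_sq' (by linarith [(abs_le.1 hb).1]) (abs_le.1 hb).2]
    set t := |b + S.b₁ x| with ht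
    have ht2 : t ^ 2 ≤ 2 * b ^ 2 + 2 * B ^ 2 := by rw [ht, sq_abs]; exact hbb
    have e1 : S.h ^ 2 * |S.α x| * p' * q ≤ S.h ^ 2 * A * (p' ^ 2 + q ^ 2) := by
      rw [mul_assoc (S.h ^ 2 * |S.α x|)]
      gcongr
      nlinarith [sq_nonneg (p' - q), sq_nonneg (p' + q)]
    have e2 : t * (p * q) ≤ (2 * b ^ 2 + 2 * B ^ 2) * p ^ 2 + q ^ 2 := by
      have : t * (p * q) ≤ t ^ 2 * p ^ 2 + q ^ 2 := by
        nlinarith [sq_nonneg (t * p - q), sq_nonneg (t * p), sq_nonneg q]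
      refine this.trans ?_
      gcongr
    have e4 := mul_le_mul_of_nonneg_left e2 hh.le
    have r1 : 0 ≤ S.h ^ 2 * A := by positivity
    have r2 : 0 ≤ S.h * B ^ 2 := by positivity
    have r3 : 0 ≤ W / S.c := by positivity
    set Y := b ^ 2 * p ^ 2
    have hY : 0 ≤ Y := by positivity
    have e5 : S.h * ((2 * b ^ 2 + 2 * B ^ 2) * p ^ 2 + q ^ 2) =
      2 * S.h * Y + 2 * (S.h * B ^ 2) * p ^ 2 + S.h * q ^ 2 := by
      simp only [Y]; ring
    rw [e5] at e4
    rw [mul_assoc S.h t]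
    have s1 : 0 ≤ p ^ 2 := by positivity
    have s2 : 0 ≤ p' ^ 2 := by positivity
    have s3 : 0 ≤ q ^ 2 := by positivity
    have k1 := mul_le_mul_of_nonneg_right (show 2 * (S.h * B ^ 2) ≤ S.h ^ 2 * A +
      2 * S.h + 2 * S.h * B ^ 2 + W / S.c by linarith) s1
    have k2 := mul_le_mul_of_nonneg_right (show S.h ^ 2 * A ≤ S.h ^ 2 * A +
      2 * S.h + 2 * S.h * B ^ 2 + W / S.c by linarith) s2
    have k3 := mul_le_mul_of_nonneg_right (show S.h ^ 2 * A + S.h ≤ S.h ^ 2 * A +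
      2 * S.h + 2 * S.h * B ^ 2 + W / S.c by linarith) s3
    have k4 := mul_le_mul_of_nonneg_right (show 2 * S.h ≤ S.h ^ 2 * A +
      2 * S.h + 2 * S.h * B ^ 2 + W / S.c by linarith) hY
    linarith

/-- `b₀²` is integrable and `‖u‖²` is bounded. The bound `M` is left free so that the Sobolev
inequality with small `δ` can be inserted. -/
theorem integrable_b₀_sq_mul (S : Coeffs) (hu : IsH1 u u') :
    Integrable (fun x ↦ S.b₀ x ^ 2 * ‖u x‖ ^ 2) ∧ ∀ M, (∀ x, ‖u x‖ ^ 2 ≤ M) →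
      ∫ x, S.b₀ x ^ 2 * ‖u x‖ ^ 2 ≤ M * ∫ x, S.b₀ x ^ 2 := by
  have hi : Integrable (fun x ↦ S.b₀ x ^ 2 * ‖u x‖ ^ 2) := by
    refine Integrable.mul_bdd (c := 2 * (sqInt u + sqInt u')) S.integrable_b₀_sq
      (hu.prim.continuous.norm.pow 2).aestronglyMeasurable (.of_forall fun x ↦ ?_)
    rw [Real.norm_of_nonneg (by positivity)]
    exact hu.norm_sq_le_add x
  refine ⟨hi, fun M hM ↦ ?_⟩
  rw [← integral_const_mul]
  refine integral_mono hi (S.integrable_b₀_sq.const_mul _) fun x ↦ ?_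
  simp only
  rw [mul_comm]
  have := hM x
  gcongr

theorem integrable_majorant (S : Coeffs) (hu : IsH1 u u') (hv : IsH1 v v') (K : ℝ) :
    Integrable fun x ↦ K * (‖u x‖ ^ 2 + ‖u' x‖ ^ 2 + ‖v x‖ ^ 2 + ‖v' x‖ ^ 2 +
      S.b₀ x ^ 2 * (‖u x‖ ^ 2 + ‖v x‖ ^ 2)) := by
  have := ((((integrable_sq hu.memLp).add (integrable_sq hu.memLp_deriv)).add
    (integrable_sq hv.memLp)).add (integrable_sq hv.memLp_deriv)).add
    ((S.integrable_b₀_sq_mul hu).1.add (S.integrable_b₀_sq_mul hv).1)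
  refine (this.const_mul K).congr (.of_forall fun x ↦ ?_)
  simp only [Pi.add_apply]
  ring

theorem integrable_integrand {S : Coeffs} (hu : IsH1 u u') (hv : IsH1 v v') :
    Integrable (S.integrand u u' v v') := by
  obtain ⟨K, -, hK⟩ := S.exists_integrand_bound
  exact (S.integrable_majorant hu hv K).mono' (locallyIntegrable_integrand hu.prim.continuous
    hu.memLp_deriv.locL2 hv.prim.continuous hv.memLp_deriv.locL2).aestronglyMeasurable
    (hK u u' v v').1

/-- The form is bounded on `H¹`. -/
theorem exists_form_bound (S : Coeffs) : ∃ K : ℝ, 0 ≤ K ∧ ∀ u u' v v' : ℝ → ℂ,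
    IsH1 u u' → IsH1 v v' →
      ‖S.form u u' v v'‖ ≤ K * (sqInt u + sqInt u' + (sqInt v + sqInt v')) := by
  obtain ⟨K, hK0, hK⟩ := S.exists_integrand_bound
  set E := ∫ x, S.b₀ x ^ 2
  have hE : 0 ≤ E := integral_nonneg fun _ ↦ sq_nonneg _
  have hm := totalMass_nonneg S.V₀
  have hc := S.c_pos
  refine ⟨K + K * (2 * E) + 2 / S.c * totalMass S.V₀, by positivity, fun u u' v v' hu hv ↦ ?_⟩
  set M := sqInt u + sqInt u' + (sqInt v + sqInt v')
  have h1 : ‖∫ x, S.integrand u u' v v' x‖ ≤ K * (M + 2 * E * M) := by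
    refine (norm_integral_le_of_norm_le (S.integrable_majorant hu hv K) (hK u u' v v').1).trans ?_
    rw [integral_const_mul]
    gcongr
    have i1 := (((integrable_sq hu.memLp).add (integrable_sq hu.memLp_deriv)).add
      (integrable_sq hv.memLp)).add (integrable_sq hv.memLp_deriv)
    have i2 := (S.integrable_b₀_sq_mul hu).1
    have i3 := (S.integrable_b₀_sq_mul hv).1
    have e : ∫ x, (‖u x‖ ^ 2 + ‖u' x‖ ^ 2 + ‖v x‖ ^ 2 + ‖v' x‖ ^ 2 +
        S.b₀ x ^ 2 * (‖u x‖ ^ 2 + ‖v x‖ ^ 2)) = sqInt u + sqInt u' + sqInt v + sqInt v' +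
        ((∫ x, S.b₀ x ^ 2 * ‖u x‖ ^ 2) + ∫ x, S.b₀ x ^ 2 * ‖v x‖ ^ 2) := by
      simp only [mul_add]
      refine (integral_add i1 (i2.add i3)).trans (congrArg₂ _ ?_ (integral_add i2 i3))
      refine (integral_add (((integrable_sq hu.memLp).add (integrable_sq hu.memLp_deriv)).add
        (integrable_sq hv.memLp)) (integrable_sq hv.memLp_deriv)).trans (congrArg₂ _ ?_ rfl)
      refine (integral_add ((integrable_sq hu.memLp).add (integrable_sq hu.memLp_deriv))
        (integrable_sq hv.memLp)).trans (congrArg₂ _ ?_ rfl)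
      exact integral_add (integrable_sq hu.memLp) (integrable_sq hu.memLp_deriv)
    rw [e]
    have j1 := (S.integrable_b₀_sq_mul hu).2 _ hu.norm_sq_le_add
    have j2 := (S.integrable_b₀_sq_mul hv).2 _ hv.norm_sq_le_add
    have : 2 * E * M = 2 * (sqInt u + sqInt u') * E + 2 * (sqInt v + sqInt v') * E := by
      simp only [M]; ring
    rw [this]
    simp only [M]
    linarith
  have h2 : ‖signedIntegral S.V₀ fun x ↦ u x * v x / (S.β x : ℂ)‖ ≤
      (2 * M / S.c) * totalMass S.V₀ := by
    refine norm_signedIntegral_le _ fun x ↦ (S.norm_div_β_le _ x).trans ?_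
    gcongr
    rw [norm_mul]
    have j1 := hu.norm_sq_le_add x
    have j2 := hv.norm_sq_le_add x
    simp only [M]
    nlinarith [sq_nonneg (‖u x‖ - ‖v x‖), sq_nonneg ‖u x‖, sq_nonneg ‖v x‖]
  refine (norm_add_le _ _).trans ((add_le_add h1 h2).trans (le_of_eq ?_))
  ring

/-- Young's inequality bounds the magnetic cross term by half of the kinetic lower bound `h² a
‖u'‖²` plus `(2 / a) b² ‖u‖²`. The part with `b₀²` is kept apart, since `b₀` need not be bounded. -/
theorem re_integrand_ge (S : Coeffs) : ∃ D : ℝ, 0 ≤ D ∧ ∀ u u' : ℝ → ℂ, ∀ᵐ x,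
    S.h ^ 2 * S.a / 2 * ‖u' x‖ ^ 2 - D * ‖u x‖ ^ 2 - 4 / S.a * (S.b₀ x ^ 2 * ‖u x‖ ^ 2) ≤
      (S.integrand u u' (fun x ↦ starRingEnd ℂ (u x)) (fun x ↦ starRingEnd ℂ (u' x)) x).re := by
  obtain ⟨B, hB0, hB⟩ := exists_ae_bound S.memLp_b₁
  obtain ⟨W, hW0, hW⟩ := exists_ae_bound S.memLp_V₁
  have hh := S.h_pos
  have hc := S.c_pos
  have ha0 := S.a_pos
  refine ⟨4 / S.a * B ^ 2 + W / S.c, by positivity, fun u u' ↦ ?_⟩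
  filter_upwards [S.a_le, hB, hW] with x ha hb hw
  have e : (S.integrand u u' (fun x ↦ starRingEnd ℂ (u x)) (fun x ↦ starRingEnd ℂ (u' x)) x).re =
      S.h ^ 2 * S.α x * ‖u' x‖ ^ 2 -
        2 * S.h * (S.b₀ x + S.b₁ x) * ((u x).im * (u' x).re - (u x).re * (u' x).im) +
        ‖u x‖ ^ 2 * (S.V₁ x / S.β x) := by
    have e1 : S.integrand u u' (fun x ↦ starRingEnd ℂ (u x)) (fun x ↦ starRingEnd ℂ (u' x)) x =
        ((S.h ^ 2 * S.α x : ℝ) : ℂ) * (u' x * starRingEnd ℂ (u' x)) +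
        ((S.h * (S.b₀ x + S.b₁ x) : ℝ) : ℂ) * (Complex.I * (u x * starRingEnd ℂ (u' x) -
          u' x * starRingEnd ℂ (u x))) +
        (u x * starRingEnd ℂ (u x)) * ((S.V₁ x / S.β x : ℝ) : ℂ) := by
      simp only [integrand, Pi.add_apply]
      push_cast
      ring
    rw [e1, Complex.mul_conj, Complex.mul_conj, Complex.normSq_eq_norm_sq,
      Complex.normSq_eq_norm_sq, ← Complex.ofReal_mul, ← Complex.ofReal_mul, Complex.add_re,
      Complex.add_re, Complex.ofReal_re, Complex.ofReal_re, Complex.re_ofReal_mul]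
    simp
    ring
  rw [e]
  have hcs : ((u x).im * (u' x).re - (u x).re * (u' x).im) ^ 2 ≤ ‖u x‖ ^ 2 * ‖u' x‖ ^ 2 := by
    rw [← Complex.normSq_eq_norm_sq, ← Complex.normSq_eq_norm_sq, Complex.normSq_apply,
      Complex.normSq_apply]
    nlinarith [sq_nonneg ((u x).re * (u' x).re + (u x).im * (u' x).im)]
  set z := (u x).im * (u' x).re - (u x).re * (u' x).im
  set p := ‖u x‖
  set q := ‖u' x‖
  have hp : 0 ≤ p := norm_nonneg _
  have hq : 0 ≤ q := norm_nonneg _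
  have hz : |z| ≤ p * q := abs_le_of_sq_le_sq (by nlinarith) (by positivity)
  set b := S.b₀ x
  have hbb : (b + S.b₁ x) ^ 2 ≤ 2 * b ^ 2 + 2 * B ^ 2 := by
    nlinarith [sq_nonneg (b - S.b₁ x), sq_le_sq' (by linarith [(abs_le.1 hb).1]) (abs_le.1 hb).2]
  set t := b + S.b₁ x
  have h1 : 2 * S.h * t * z ≤ S.h ^ 2 * S.a / 2 * q ^ 2 + 2 / S.a * (t ^ 2 * p ^ 2) := by
    have h2 : t * z ≤ |t| * (p * q) := by
      calc t * z ≤ |t * z| := le_abs_self _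
        _ = |t| * |z| := abs_mul _ _
        _ ≤ _ := by gcongr
    have h3 : 2 * S.h * (|t| * (p * q)) ≤ S.h ^ 2 * S.a / 2 * q ^ 2 + 2 / S.a * (|t| ^ 2 * p ^ 2) := by
      have : 0 ≤ 2 / S.a * (S.h * S.a / 2 * q - |t| * p) ^ 2 := by positivity
      have e2 : 2 / S.a * (S.h * S.a / 2 * q - |t| * p) ^ 2 =
        S.h ^ 2 * S.a / 2 * q ^ 2 + 2 / S.a * (|t| ^ 2 * p ^ 2) - 2 * S.h * (|t| * (p * q)) := by
        field_simp
        ring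
      linarith
    rw [sq_abs] at h3
    nlinarith
  have h4 : 2 / S.a * (t ^ 2 * p ^ 2) ≤ 2 / S.a * ((2 * b ^ 2 + 2 * B ^ 2) * p ^ 2) := by gcongr
  have h5 : -(W / S.c * p ^ 2) ≤ p ^ 2 * (S.V₁ x / S.β x) := by
    have h6 : |S.V₁ x / S.β x| ≤ W / S.c := by
      rw [abs_div, abs_of_pos (S.β_pos x)]
      have := S.c_le x
      gcongr
    have := (abs_le.1 h6).1
    nlinarith [sq_nonneg p]
  have h7 : S.h ^ 2 * S.a * q ^ 2 ≤ S.h ^ 2 * S.α x * q ^ 2 := by gcongr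
  have e8 : 2 / S.a * ((2 * b ^ 2 + 2 * B ^ 2) * p ^ 2) =
    4 / S.a * (b ^ 2 * p ^ 2) + 4 / S.a * B ^ 2 * p ^ 2 := by ring
  rw [e8] at h4
  linarith

/-- The form is bounded below, and controls the derivative. -/
theorem exists_form_lower_bound (S : Coeffs) : ∃ κ Λ : ℝ, 0 < κ ∧ 0 ≤ Λ ∧ ∀ u u' : ℝ → ℂ,
    IsH1 u u' → κ * sqInt u' - Λ * sqInt u ≤
      (S.form u u' (fun x ↦ starRingEnd ℂ (u x)) (fun x ↦ starRingEnd ℂ (u' x))).re := by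
  obtain ⟨D, hD0, hD⟩ := S.re_integrand_ge
  have hh := S.h_pos
  have hc := S.c_pos
  have ha0 := S.a_pos
  set E₀ := ∫ x, S.b₀ x ^ 2
  have hE₀ : 0 ≤ E₀ := integral_nonneg fun _ ↦ sq_nonneg _
  have hm := totalMass_nonneg S.V₀
  set E := 4 / S.a * E₀ + totalMass S.V₀ / S.c with hEdef
  have hE : 0 ≤ E := by positivity
  -- Chosen so that `2 δ E ≤ h² a / 4`, half of the kinetic term that remains; `E + 1` avoids a
  -- division by zero.
  set δ := S.h ^ 2 * S.a / (8 * (E + 1)) with hδdef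
  have hδ : 0 < δ := by positivity
  refine ⟨S.h ^ 2 * S.a / 4, D + 2 / δ * E, by positivity, by positivity, fun u u' hu ↦ ?_⟩
  set M := 2 / δ * sqInt u + 2 * δ * sqInt u' with hM
  have hMx := hu.norm_sq_le hδ
  have hN := sqInt_nonneg u
  have hN' := sqInt_nonneg u'
  have i1 := (integrable_sq hu.memLp_deriv).const_mul (S.h ^ 2 * S.a / 2)
  have i2 := (integrable_sq hu.memLp).const_mul D
  have i3 := (S.integrable_b₀_sq_mul hu).1.const_mul (4 / S.a)
  have i4 := integrable_integrand (S := S) hu hu.conj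
  have h1 : S.h ^ 2 * S.a / 2 * sqInt u' - D * sqInt u - 4 / S.a * (M * E₀) ≤
      (∫ x, S.integrand u u' (fun x ↦ starRingEnd ℂ (u x))
        (fun x ↦ starRingEnd ℂ (u' x)) x).re := by
    have h2 := integral_mono_ae ((i1.sub i2).sub i3) i4.re (hD u u')
    have h3 : ∫ x, (S.integrand u u' (fun x ↦ starRingEnd ℂ (u x))
        (fun x ↦ starRingEnd ℂ (u' x)) x).re = _ := integral_re i4
    have h4 : ∫ x, (S.h ^ 2 * S.a / 2 * ‖u' x‖ ^ 2 - D * ‖u x‖ ^ 2 -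
        4 / S.a * (S.b₀ x ^ 2 * ‖u x‖ ^ 2)) = S.h ^ 2 * S.a / 2 * sqInt u' - D * sqInt u -
        4 / S.a * ∫ x, S.b₀ x ^ 2 * ‖u x‖ ^ 2 := by
      refine (integral_sub (i1.sub i2) i3).trans (congrArg₂ _ ?_ (integral_const_mul _ _))
      exact (integral_sub i1 i2).trans (congrArg₂ _ (integral_const_mul _ _)
        (integral_const_mul _ _))
    have h5 := (S.integrable_b₀_sq_mul hu).2 M hMx
    have h6 : 4 / S.a * (∫ x, S.b₀ x ^ 2 * ‖u x‖ ^ 2) ≤ 4 / S.a * (M * E₀) := by gcongr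
    have h7 : S.h ^ 2 * S.a / 2 * sqInt u' - D * sqInt u -
        4 / S.a * (∫ x, S.b₀ x ^ 2 * ‖u x‖ ^ 2) ≤ _ := h4.symm.le.trans (h2.trans h3.le)
    exact le_trans (by linarith) h7
  have h2 : ‖signedIntegral S.V₀ fun x ↦ u x * starRingEnd ℂ (u x) / (S.β x : ℂ)‖ ≤
      (M / S.c) * totalMass S.V₀ := by
    refine norm_signedIntegral_le _ fun x ↦ (S.norm_div_β_le _ x).trans ?_
    gcongr
    rw [norm_mul, RCLike.norm_conj, ← sq]
    exact hMx x
  have h3 := (Complex.abs_re_le_norm _).trans h2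
  have h4 := (abs_le.1 h3).1
  have h5 : 4 / S.a * (M * E₀) + M / S.c * totalMass S.V₀ = M * E := by rw [hEdef]; ring
  have h6 : M * E ≤ 2 / δ * E * sqInt u + S.h ^ 2 * S.a / 4 * sqInt u' := by
    have h7 : 2 * δ * E ≤ S.h ^ 2 * S.a / 4 := by
      have e : 2 * δ * E = S.h ^ 2 * S.a / 4 * (E / (E + 1)) := by rw [hδdef]; field_simp; ring
      have h9 : E / (E + 1) ≤ 1 := (div_le_one (by positivity)).2 (by linarith)
      rw [e]
      exact mul_le_of_le_one_right (by positivity) h9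
    have h8 := mul_le_mul_of_nonneg_right h7 hN'
    have : M * E = 2 / δ * E * sqInt u + 2 * δ * E * sqInt u' := by rw [hM]; ring
    linarith
  rw [form, Complex.add_re]
  linarith

end Coeffs

/-! ### Cut-offs, and extension of the weak form to `H¹` -/

/-- A sequence of cut-off functions with uniformly bounded derivatives. -/
theorem exists_cutoff : ∃ (χ χ' : ℕ → ℝ → ℝ) (C : ℝ), ∀ n : ℕ,
    IsPrim (fun x ↦ (χ n x : ℂ)) (fun x ↦ (χ' n x : ℂ)) ∧
    HasCompactSupport (fun x ↦ (χ n x : ℂ)) ∧ Continuous (χ' n) ∧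
    (∀ x, |χ n x| ≤ 1) ∧ (∀ x, |χ' n x| ≤ C) ∧
    ∀ x : ℝ, |x| ≤ n → χ n x = 1 ∧ χ' n x = 0 := by
  let b : ContDiffBump (0 : ℝ) := ⟨1, 2, one_pos, one_lt_two⟩
  have hb : ContDiff ℝ 1 b := b.contDiff
  have hb' : Continuous (deriv b) := hb.continuous_deriv le_rfl
  obtain ⟨C, hC⟩ := hb'.bounded_above_of_compact_support b.hasCompactSupport.deriv
  have hd : ∀ (n : ℕ) (x : ℝ), HasDerivAt (fun x : ℝ ↦ b (x / (n + 1)))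
      (deriv b (x / (n + 1)) / (n + 1)) x := fun n x ↦ by
    have h1 := (hb.differentiable one_ne_zero (x / (n + 1))).hasDerivAt
    have h2 : HasDerivAt (fun x : ℝ ↦ x / (n + 1)) (1 / ((n : ℝ) + 1)) x :=
      (hasDerivAt_id x).div_const _
    have h3 := h1.comp x h2
    rw [mul_one_div] at h3
    exact h3
  -- Dilating by `n + 1` rather than `n` covers `n = 0` and puts `|x| ≤ n` in the interior of the
  -- set where the cut-off is one, so that its derivative vanishes there.
  refine ⟨fun n x ↦ b (x / (n + 1)), fun n x ↦ deriv b (x / (n + 1)) / (n + 1), C,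
    fun n ↦ ?_⟩
  have hn : (0 : ℝ) < n + 1 := by positivity
  have hone : ∀ x : ℝ, |x| < n + 1 → b (x / (n + 1)) = 1 := fun x hx ↦ by
    apply b.one_of_mem_closedBall
    rw [mem_closedBall_zero_iff, Real.norm_eq_abs, abs_div, abs_of_pos hn]
    exact (div_lt_one hn).2 hx |>.le
  refine ⟨?_, ?_, by fun_prop, fun x ↦ ?_, fun x ↦ ?_, fun x hx ↦ ⟨?_, ?_⟩⟩
  · have hcd : ContDiff ℝ 1 fun x : ℝ ↦ ((b (x / (n + 1)) : ℝ) : ℂ) :=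
      Complex.ofRealCLM.contDiff.comp (hb.comp (contDiff_id.div_const _))
    convert IsPrim.of_contDiff hcd using 1
    funext x
    rw [(hd n x).ofReal_comp.deriv]
  · refine HasCompactSupport.intro (isCompact_Icc (a := -(2 * ((n : ℝ) + 1)))
      (b := 2 * ((n : ℝ) + 1))) fun x hx ↦ ?_
    have : 2 * ((n : ℝ) + 1) < |x| := by
      by_contra h
      exact hx (abs_le.1 (not_lt.1 h))
    change ((b (x / (n + 1)) : ℝ) : ℂ) = 0
    rw [b.zero_of_le_dist, Complex.ofReal_zero]
    rw [dist_zero_right, Real.norm_eq_abs, abs_div, abs_of_pos hn, le_div_iff₀ hn]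
    exact this.le
  · rw [abs_of_nonneg b.nonneg]
    exact b.le_one
  · rw [abs_div, abs_of_pos hn]
    refine (div_le_self (abs_nonneg _) (by linarith)).trans (hC _)
  · exact hone x (by linarith)
  · have h1 : (fun x : ℝ ↦ b (x / (n + 1))) =ᶠ[𝓝 x] fun _ ↦ (1 : ℝ) := by
      filter_upwards [(isOpen_lt continuous_abs continuous_const).mem_nhds
        (show |x| < (n : ℝ) + 1 by linarith)] with y hy
      exact hone y hy
    exact (hd n x).unique ((hasDerivAt_const x (1 : ℝ)).congr_of_eventuallyEq h1)

/-- Dominated convergence, used with `l = 1` for the cut-offs and `l = 0` for their derivatives. -/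
theorem tendsto_integral_cutoff {μ : Measure ℝ} {χ : ℕ → ℝ → ℝ} {C l : ℝ} {G : ℝ → ℂ}
    (hG : Integrable G μ) (hχ : ∀ n, Continuous (χ n)) (hC : ∀ n x, |χ n x| ≤ C)
    (hl : ∀ (n : ℕ) (x : ℝ), |x| ≤ n → χ n x = l) :
    Tendsto (fun n ↦ ∫ x, (χ n x : ℂ) * G x ∂μ) atTop (𝓝 (∫ x, (l : ℂ) * G x ∂μ)) := by
  refine tendsto_integral_of_dominated_convergence (fun x ↦ C * ‖G x‖) (fun n ↦ ?_)
    (hG.norm.const_mul C) (fun n ↦ .of_forall fun x ↦ ?_) (.of_forall fun x ↦ ?_)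
  · exact (Complex.continuous_ofReal.comp (hχ n)).aestronglyMeasurable.mul hG.1
  · rw [norm_mul, Complex.norm_real]
    exact mul_le_mul_of_nonneg_right (hC n x) (norm_nonneg _)
  · refine tendsto_const_nhds.congr' ?_
    obtain ⟨N, hN⟩ := exists_nat_ge |x|
    filter_upwards [eventually_ge_atTop N] with n hn
    rw [hl n x (hN.trans (by exact_mod_cast hn))]

theorem IsPrim.continuous_of_ofReal {χ : ℝ → ℝ} {χ' : ℝ → ℂ}
    (h : IsPrim (fun x ↦ (χ x : ℂ)) χ') : Continuous χ :=
  Complex.continuous_re.comp h.continuous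

/-- Only local square integrability of `u'` is required, so truncations of functions of the maximal
domain qualify. -/
theorem IsH1.cutoff {χ χ' : ℝ → ℝ} {C : ℝ} {u u' : ℝ → ℂ}
    (hχ : IsPrim (fun x ↦ (χ x : ℂ)) (fun x ↦ (χ' x : ℂ)))
    (hc : HasCompactSupport (fun x ↦ (χ x : ℂ)))
    (h1 : ∀ x, |χ x| ≤ 1) (hC : ∀ x, |χ' x| ≤ C) (hu : IsPrim u u') (hu' : LocL2 u') :
    IsH1 (fun x ↦ (χ x : ℂ) * u x) (fun x ↦ (χ' x : ℂ) * u x + χ x * u' x) := by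
  have hp := hχ.mul hu
  have hχ1 : MemLp (fun x ↦ (χ x : ℂ)) ⊤ volume :=
    memLp_top_of_bound hχ.continuous.aestronglyMeasurable 1 (.of_forall fun x ↦ by
      rw [Complex.norm_real]; exact h1 x)
  have hχ2 : MemLp (fun x ↦ (χ' x : ℂ)) ⊤ volume :=
    memLp_top_of_bound hχ.locInt.aestronglyMeasurable C (.of_forall fun x ↦ by
      rw [Complex.norm_real]; exact hC x)
  refine ⟨hp, hp.continuous.memLp_of_hasCompactSupport hc.mul_right, ?_⟩
  obtain ⟨R, -, hR⟩ := IsPrim.exists_radius (hc.mul_right (f' := u))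
  have hz := hp.ae_eq_zero_of_abs_lt hR
  have hl := ((hu.continuous.locL2.top_mul hχ2).add (hu'.top_mul hχ1)) R
  rw [← memLp_indicator_iff_restrict measurableSet_Icc] at hl
  refine hl.ae_eq ?_
  filter_upwards [hz] with x hx
  by_cases h : x ∈ Icc (-R) R
  · simp [h]
  · rw [indicator_of_notMem h, hx]
    by_contra hcon
    exact h (abs_le.1 (not_lt.1 hcon))

namespace Coeffs

variable {S : Coeffs} {u uc u' f w v v' : ℝ → ℂ}

theorem integrand_cutoff (S : Coeffs) (u u' v v' χ χ' : ℝ → ℂ) (x : ℝ) :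
    S.integrand u u' (fun x ↦ χ x * v x) (fun x ↦ χ' x * v x + χ x * v' x) x =
      χ x * S.integrand u u' v v' x + χ' x * ((S.h : ℂ) ^ 2 * S.α x * u' x * v x +
      Complex.I * S.h * ((S.b₀ + S.b₁) x : ℝ) * (u x * v x)) := by
  simp only [integrand]
  ring

theorem integrable_mul_div (S : Coeffs) (hv : MemLp v 2 volume) (hw : MemLp w 2 volume) :
    Integrable fun x ↦ w x * v x / (S.β x : ℂ) := by
  have h : MemLp (fun x ↦ (S.β x : ℂ)⁻¹ * w x) 2 volume := hw.mul' S.memLp_inv_β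
  refine (h.integrable_mul hv).congr (.of_forall fun x ↦ ?_)
  simp only [Pi.mul_apply]
  ring

theorem integrable_mul_div_of_finite (S : Coeffs) (μ : Measure ℝ) [IsFiniteMeasure μ]
    (hu : IsH1 u u') (hv : IsH1 v v') : Integrable (fun x ↦ u x * v x / (S.β x : ℂ)) μ := by
  obtain ⟨C1, hC1⟩ := hu.exists_bound
  obtain ⟨C2, hC2⟩ := hv.exists_bound
  refine Integrable.of_bound (C := C1 * C2 / S.c) ?_ (.of_forall fun x ↦ ?_)
  · exact (((hu.prim.continuous.mul hv.prim.continuous).measurable).div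
      (Complex.measurable_ofReal.comp S.measurable_β)).aestronglyMeasurable
  · refine (S.norm_div_β_le _ x).trans ?_
    rw [norm_mul]
    have := S.c_pos
    have h1 := hC1 x
    have h2 := hC2 x
    have h3 : 0 ≤ C1 := (norm_nonneg _).trans h1
    gcongr

/-- The weak form of the equation extends from compactly supported functions to `H¹`. -/
theorem form_eq_of_compact (hu : IsH1 u u') (hw : MemLp w 2 volume)
    (h : ∀ v v' : ℝ → ℂ, IsPrim v v' → LocL2 v' → HasCompactSupport v →
      S.form u u' v v' = ∫ x, w x * v x / (S.β x : ℂ)) (hv : IsH1 v v') :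
    S.form u u' v v' = ∫ x, w x * v x / (S.β x : ℂ) := by
  obtain ⟨χ, χ', C, hχ⟩ := exists_cutoff
  have hcont : ∀ n, Continuous (χ n) := fun n ↦ (hχ n).1.continuous_of_ofReal
  set J : ℝ → ℂ := fun x ↦ (S.h : ℂ) ^ 2 * S.α x * u' x * v x +
      Complex.I * S.h * ((S.b₀ + S.b₁) x : ℝ) * (u x * v x) with hJ
  have hI := integrable_integrand (S := S) hu hv
  have hJi : Integrable J := by
    obtain ⟨K, hK0, hK⟩ := S.exists_integrand_bound
    have hα : MemLp (fun x ↦ (S.α x : ℂ)) ⊤ volume := S.memLp_α.ofReal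
    have hm : AEStronglyMeasurable J volume := by
      have t1 := ((hu.memLp_deriv.locL2.top_mul hα).const_mul ((S.h : ℂ) ^ 2)).mul hv.memLp.locL2
      have t2 := ((S.locL2_b.continuous_mul hu.prim.continuous).const_mul
        (Complex.I * S.h)).mul hv.memLp.locL2
      refine ((t1.add t2).congr (.of_forall fun x ↦ ?_)).aestronglyMeasurable
      simp only [Pi.add_apply, hJ]
      ring
    refine (S.integrable_majorant hu hv K).mono' hm ((hK u u' v v').2.mono fun x hx ↦
      hx.trans ?_)
    have : 0 ≤ ‖v' x‖ ^ 2 + S.b₀ x ^ 2 * ‖v x‖ ^ 2 := by positivity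
    refine mul_le_mul_of_nonneg_left ?_ hK0
    linarith [mul_add (S.b₀ x ^ 2) (‖u x‖ ^ 2) (‖v x‖ ^ 2)]
  have l1 := tendsto_integral_cutoff (l := 1) hI hcont (fun n x ↦ (hχ n).2.2.2.1 x)
    (fun n x hx ↦ ((hχ n).2.2.2.2.2 x hx).1)
  -- The Leibniz error carries `χ'`, which is bounded uniformly in `n` and vanishes on `[-n, n]`; it
  -- disappears in the limit.
  have l2 := tendsto_integral_cutoff (l := 0) hJi (fun n ↦ (hχ n).2.2.1)
    (fun n x ↦ (hχ n).2.2.2.2.1 x) (fun n x hx ↦ ((hχ n).2.2.2.2.2 x hx).2)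
  have l3 := tendsto_integral_cutoff (l := 1) (S.integrable_mul_div hv.memLp hw) hcont
    (fun n x ↦ (hχ n).2.2.2.1 x) (fun n x hx ↦ ((hχ n).2.2.2.2.2 x hx).1)
  have l4 := tendsto_integral_cutoff (l := 1)
    (S.integrable_mul_div_of_finite S.V₀.toJordanDecomposition.posPart hu hv) hcont
    (fun n x ↦ (hχ n).2.2.2.1 x) (fun n x hx ↦ ((hχ n).2.2.2.2.2 x hx).1)
  have l5 := tendsto_integral_cutoff (l := 1)
    (S.integrable_mul_div_of_finite S.V₀.toJordanDecomposition.negPart hu hv) hcont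
    (fun n x ↦ (hχ n).2.2.2.1 x) (fun n x hx ↦ ((hχ n).2.2.2.2.2 x hx).1)
  simp only [Complex.ofReal_one, one_mul, Complex.ofReal_zero, zero_mul, integral_zero] at *
  have l6 := (l1.add l2).add (l4.sub l5)
  rw [add_zero] at l6
  refine tendsto_nhds_unique l6 (l3.congr fun n ↦ ?_)
  have hH := IsH1.cutoff (hχ n).1 (hχ n).2.1 (hχ n).2.2.2.1 (hχ n).2.2.2.2.1 hv.prim
    hv.memLp_deriv.locL2
  have key := h _ _ hH.prim hH.memLp_deriv.locL2 (hχ n).2.1.mul_right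
  have e1 : ∫ x, (χ n x : ℂ) * (w x * v x / (S.β x : ℂ)) =
      ∫ x, w x * ((χ n x : ℂ) * v x) / (S.β x : ℂ) := by
    congr 1; funext x; ring
  have hn1 : Integrable fun x ↦ (χ n x : ℂ) * S.integrand u u' v v' x :=
    hI.bdd_mul (c := 1) (hχ n).1.continuous.aestronglyMeasurable (.of_forall fun x ↦ by
      rw [Complex.norm_real]; exact (hχ n).2.2.2.1 x)
  have hn2 : Integrable fun x ↦ (χ' n x : ℂ) * J x :=
    hJi.bdd_mul (c := C) (hχ n).1.locInt.aestronglyMeasurable (.of_forall fun x ↦ by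
      rw [Complex.norm_real]; exact (hχ n).2.2.2.2.1 x)
  rw [e1, ← key, form, ← integral_add hn1 hn2, signedIntegral]
  congr 1
  · congr 1
    funext x
    exact S.integrand_cutoff u u' v v' (fun x ↦ (χ n x : ℂ)) (fun x ↦ (χ' n x : ℂ)) x
  · congr 1 <;> · congr 1; funext x; ring

theorem ActsOn.form_eq_of_isH1 (H : S.ActsOn u uc u' f w) (hu : IsH1 uc u')
    (hw : MemLp w 2 volume) (hv : IsH1 v v') :
    S.form uc u' v v' = ∫ x, w x * v x / (S.β x : ℂ) :=
  form_eq_of_compact hu hw (fun _ _ h1 h2 h3 ↦ H.form_eq hw h1 h2 h3) hv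

/-! ### From the weak form back to a flux of locally bounded variation -/

/-- A weak solution is a solution in the sense of distributions. -/
theorem exists_actsOn (hu : IsPrim u u') (hu' : LocL2 u') (hw : MemLp w 2 volume)
    (h : ∀ φ, IsTest φ → S.form u u' φ (deriv φ) = ∫ x, w x * φ x / (S.β x : ℂ)) :
    ∃ f, S.ActsOn u u u' f w := by
  have hh : (S.h : ℂ) ≠ 0 := by exact_mod_cast S.h_pos.ne'
  have hβm : Measurable fun x ↦ (S.β x : ℂ) := Complex.measurable_ofReal.comp S.measurable_β
  -- The densities which the measure of the flux must have, read off from `h df = dens dx + (u / β)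
  -- V₀`.
  let k : Fin 3 → ℝ → ℂ := ![fun x ↦ (S.h : ℂ)⁻¹ * (u x / S.β x),
    fun x ↦ -((S.h : ℂ)⁻¹ * (u x / S.β x)), fun x ↦ (S.h : ℂ)⁻¹ * S.dens u u' w x]
  have hV : ∀ μ : Measure ℝ, IsFiniteMeasure μ →
      LocallyIntegrable (fun x ↦ (S.h : ℂ)⁻¹ * (u x / S.β x)) μ := by
    intro μ _
    refine locallyIntegrable_of_Icc fun R ↦ ?_
    have h1 : IntegrableOn u (Icc (-R) R) μ := hu.continuous.integrableOn_Icc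
    have h2 := (Integrable.bdd_mul (c := S.c⁻¹) h1 hβm.inv.aestronglyMeasurable
      (.of_forall S.norm_inv_β_le)).const_mul (S.h : ℂ)⁻¹
    refine h2.congr (.of_forall fun x ↦ ?_)
    simp only [Pi.inv_apply]
    ring
  have hk : ∀ i, LocallyIntegrable (k i) (S.measures i) := fun i ↦ match i with
    | 0 => hV S.V₀.toJordanDecomposition.posPart inferInstance
    | 1 => (hV S.V₀.toJordanDecomposition.negPart inferInstance).neg
    | 2 => (locallyIntegrable_dens hu.continuous hu' hw).smul (S.h : ℂ)⁻¹
  have hβk : ∀ i, LocallyIntegrable (fun x ↦ (S.β x : ℂ) * k i x) (S.measures i) := by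
    intro i
    have hV' : ∀ μ : Measure ℝ, IsFiniteMeasure μ →
        LocallyIntegrable (fun x ↦ (S.β x : ℂ) * ((S.h : ℂ)⁻¹ * (u x / S.β x))) μ := by
      intro μ _
      refine ((hu.continuous.const_smul (S.h : ℂ)⁻¹).locallyIntegrable).congr
        (.of_forall fun x ↦ ?_)
      have := S.β_ne x
      simp only [Pi.smul_apply, smul_eq_mul]
      field_simp
    match i with
    | 0 => exact hV' S.V₀.toJordanDecomposition.posPart inferInstance
    | 1 =>
      refine ((hV' S.V₀.toJordanDecomposition.negPart inferInstance).neg).congr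
        (.of_forall fun x ↦ ?_)
      simp [k]
    | 2 =>
      refine ((locallyIntegrable_β_dens (S := S) hu.continuous hu' hw).smul (S.h : ℂ)⁻¹).congr
        (.of_forall fun x ↦ ?_)
      simp only [k, Pi.smul_apply, smul_eq_mul, Matrix.cons_val]
      ring
  obtain ⟨f₀, F₀, hF₀, hloc⟩ := exists_locBV S.measures_isLocallyFinite hk
  have hsum : ∀ g : ℝ → ℂ, (S.h : ℂ) * ∑ i, ∫ x, g x * k i x ∂S.measures i =
      (∫ x, g x * S.dens u u' w x) +
        signedIntegral S.V₀ fun x ↦ g x * u x / (S.β x : ℂ) := by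
    intro g
    have e1 : ∀ μ : Measure ℝ, ∫ x, g x * u x / (S.β x : ℂ) ∂μ =
        S.h * ∫ x, g x * ((S.h : ℂ)⁻¹ * (u x / S.β x)) ∂μ := fun μ ↦ by
      rw [← integral_const_mul]; congr 1; funext x; field_simp
    have e2 : ∫ x, g x * S.dens u u' w x =
        S.h * ∫ x, g x * ((S.h : ℂ)⁻¹ * S.dens u u' w x) := by
      rw [← integral_const_mul]; congr 1; funext x; field_simp
    rw [Fin.sum_univ_three, signedIntegral, e1, e1, e2]
    simp only [k, measures]
    simp only [Matrix.cons_val_zero, Matrix.cons_val_one, Matrix.cons_val, mul_neg, integral_neg]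
    ring
  have hφk : ∀ φ, IsTest φ → ∀ i, Integrable (fun x ↦ φ x * k i x) (S.measures i) :=
    fun φ hφ i ↦ by
      have := S.measures_isLocallyFinite i
      simpa using (hk i).integrable_smul_left_of_hasCompactSupport hφ.isPrim.continuous hφ.2
  have hflux : LocallyIntegrable (S.flux u u') volume := by
    have hα : MemLp (fun x ↦ (S.α x : ℂ)) ⊤ volume := S.memLp_α.ofReal
    refine (((hu'.top_mul hα).const_mul (S.h : ℂ)).add ((S.locL2_b.continuous_mul
      hu.continuous).const_mul Complex.I)).locallyIntegrable.congr (.of_forall fun x ↦ ?_)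
    simp only [flux]
    ring
  have hf₀l : LocallyIntegrable f₀ volume := locallyIntegrable_of_Icc fun R ↦ by
    obtain ⟨C, hC⟩ := F₀.exists_bound R
    exact Integrable.of_bound F₀.measurable.aestronglyMeasurable C
      ((ae_restrict_mem measurableSet_Icc).mono fun x hx ↦ hC x hx)
  -- `flux` and `f₀` have the same distributional derivative, so they differ by a constant, which
  -- may be added to `f₀` without changing its measure.
  obtain ⟨c, hc⟩ := exists_ae_eq_const (hflux.sub hf₀l) (fun φ hφ ↦ by
    have hd : Continuous (deriv φ) := hφ.1.continuous_deriv (by exact_mod_cast le_top)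
    have hi : ∀ {p : ℝ → ℂ}, LocallyIntegrable p volume → Integrable fun x ↦ p x * deriv φ x :=
      fun hp ↦ by
        simpa [mul_comm] using hp.integrable_smul_left_of_hasCompactSupport hd hφ.2.deriv
    have e : (fun x ↦ (S.flux u u' - f₀) x * deriv φ x) =
        fun x ↦ S.flux u u' x * deriv φ x - f₀ x * deriv φ x := by
      funext x; simp [sub_mul]
    rw [e, integral_sub (hi hflux) (hi hf₀l)]
    have h1 := h φ hφ
    rw [S.form_eq_flux hu.continuous hu' hw hφ.isPrim hd.locL2 hφ.2] at h1
    have h2 := F₀.integral_eq_neg hφ.isPrim hφ.2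
    have h3 := hsum φ
    rw [← hF₀ φ hφ.isPrim.continuous.measurable (hφk φ hφ), h2] at h3
    apply mul_left_cancel₀ hh
    rw [mul_zero]
    linear_combination h1 + h3)
  refine ⟨fun x ↦ f₀ x + c, hu.continuous, .rfl, hu.isWeakDeriv, ?_, F₀.addConst c, ?_,
    fun φ hφ ↦ ?_⟩
  · filter_upwards [hc] with x hx
    simp only [Pi.sub_apply] at hx
    rw [← hx]
    simp [flux]
  · rw [LocBV.locInt_iff, LocBV.meas_addConst, ← LocBV.locInt_iff]
    exact hloc S.β S.measurable_β hβk
  · have h1 : (F₀.addConst c).integral (fun x ↦ φ x * (S.β x : ℂ)) =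
        F₀.integral fun x ↦ φ x * (S.β x : ℂ) := by
      rw [LocBV.integral_eq_sum, LocBV.integral_eq_sum, LocBV.meas_addConst]
    have hφc := hφ.isPrim.continuous
    have h2 := hF₀ (fun x ↦ φ x * (S.β x : ℂ)) (hφc.measurable.mul hβm) (fun i ↦ ?_)
    · have h3 := hsum fun x ↦ φ x * (S.β x : ℂ)
      have e1 : (fun x ↦ φ x * (S.β x : ℂ) * u x / (S.β x : ℂ)) = fun x ↦ φ x * u x := by
        funext x
        have := S.β_ne x
        field_simp
      have e2 : ∀ x, φ x * (S.β x : ℂ) * S.dens u u' w x =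
          φ x * ((S.β x : ℂ) * S.dens u u' w x) := fun x ↦ by ring
      simp only [e1, e2] at h3
      rw [S.integral_mul_β_dens hu.continuous hu' hw hφc hφ.2] at h3
      rw [h1, h2]
      linear_combination -h3
    · have := S.measures_isLocallyFinite i
      refine ((hβk i).integrable_smul_left_of_hasCompactSupport hφc hφ.2).congr
        (.of_forall fun x ↦ ?_)
      simp only [smul_eq_mul]
      ring

end Coeffs

/-! ### Boundedness of the flux -/

theorem integral_indicator_monoMeasure {g : ℝ → ℝ} (hg : Monotone g) {x y : ℝ} (hxy : x ≤ y)
    (hx : ContinuousAt g x) (hy : ContinuousAt g y) :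
    ∫ t, (Ioc x y).indicator (fun _ ↦ (1 : ℂ)) t ∂monoMeasure hg = ((g y - g x : ℝ) : ℂ) := by
  have hr : ∀ {t}, ContinuousAt g t → Function.rightLim g t = g t := fun ht ↦
    (Monotone.continuousWithinAt_Ioi_iff_rightLim_eq hg).1 ht.continuousWithinAt
  rw [integral_indicator measurableSet_Ioc, setIntegral_const, Measure.real, monoMeasure,
    StieltjesFunction.measure_Ioc, Monotone.stieltjesFunction_eq, Monotone.stieltjesFunction_eq,
    hr hx, hr hy, ENNReal.toReal_ofReal (sub_nonneg.2 (hg hxy))]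
  simp

/-- The measures see right limits, which are the values themselves wherever all four monotone
functions are continuous, that is, off a countable set. -/
theorem LocBV.exists_integral_indicator {f : ℝ → ℂ} (F : LocBV f) :
    ∃ s : Set ℝ, (∀ᵐ x, x ∈ s) ∧ ∀ x ∈ s, ∀ y ∈ s, x ≤ y →
      F.integral ((Ioc x y).indicator fun _ ↦ 1) = f y - f x := by
  have hc : ∀ {g : ℝ → ℝ}, Monotone g → ∀ᵐ t : ℝ, ContinuousAt g t := fun hg ↦ by
    rw [ae_iff]; exact hg.countable_not_continuousAt.measure_zero _
  refine ⟨{t | ContinuousAt F.rePos t ∧ ContinuousAt F.reNeg t ∧ ContinuousAt F.imPos t ∧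
    ContinuousAt F.imNeg t}, ?_, fun x hx y hy hxy ↦ ?_⟩
  · filter_upwards [hc F.rePos_mono, hc F.reNeg_mono, hc F.imPos_mono, hc F.imNeg_mono]
      with t h1 h2 h3 h4 using ⟨h1, h2, h3, h4⟩
  · rw [LocBV.integral, integral_indicator_monoMeasure F.rePos_mono hxy hx.1 hy.1,
      integral_indicator_monoMeasure F.reNeg_mono hxy hx.2.1 hy.2.1,
      integral_indicator_monoMeasure F.imPos_mono hxy hx.2.2.1 hy.2.2.1,
      integral_indicator_monoMeasure F.imNeg_mono hxy hx.2.2.2 hy.2.2.2, F.eq, F.eq]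
    push_cast
    ring

/-- A square integrable function with bounded oscillation on intervals of unit length is
bounded. -/
theorem memLp_top_of_oscillation {f : ℝ → ℂ} (hf : MemLp f 2 volume) {s : Set ℝ} {L : ℝ}
    (hs : ∀ᵐ x, x ∈ s) (h : ∀ x ∈ s, ∀ y ∈ s, y ∈ Ioc x (x + 1) → ‖f y - f x‖ ≤ L) :
    MemLp f ⊤ volume := by
  refine memLp_top_of_bound hf.1 (L + √(sqInt f)) ?_
  filter_upwards [hs] with x hx
  have i1 : IntegrableOn (fun t ↦ ‖f t‖) (Ioc x (x + 1)) :=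
    ((hf.restrict _).integrable (by norm_num)).norm
  -- Almost every `t` in the unit interval satisfies `‖f x‖ - L ≤ ‖f t‖`; averaging and
  -- Cauchy–Schwarz bound `‖f x‖` by `L` plus the `L²` norm.
  have h1 := le_average (a := ‖f x‖ - L) one_pos i1 (by
    filter_upwards [hs] with t ht htx
    have := h x hx t ht htx
    have h2 := norm_sub_norm_le (f x) (f t)
    rw [norm_sub_rev] at h2
    linarith)
  have h2 := Real.le_sqrt_of_sq_le (sq_setIntegral_norm_le hf x one_pos)
  rw [one_mul] at h1 h2
  linarith

namespace Coeffs

variable {S : Coeffs} {u uc u' f w v v' : ℝ → ℂ}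

theorem memLp_flux (S : Coeffs) (hu : IsH1 u u') : MemLp (S.flux u u') 2 volume := by
  have hα : MemLp (fun x ↦ (S.α x : ℂ)) ⊤ volume := S.memLp_α.ofReal
  have hb0 : MemLp (fun x ↦ (S.b₀ x : ℂ)) 2 volume := S.memLp_b₀.ofReal
  have hb1 : MemLp (fun x ↦ (S.b₁ x : ℂ)) ⊤ volume := S.memLp_b₁.ofReal
  have t1 : MemLp (fun x ↦ (S.α x : ℂ) * u' x) 2 volume := hu.memLp_deriv.mul' hα
  have t2 : MemLp (fun x ↦ u x * (S.b₀ x : ℂ)) 2 volume := hb0.mul' hu.memLp_top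
  have t3 : MemLp (fun x ↦ (S.b₁ x : ℂ) * u x) 2 volume := hu.memLp.mul' hb1
  refine ((t1.const_mul (S.h : ℂ)).add ((t2.add t3).const_mul Complex.I)).ae_eq
    (.of_forall fun x ↦ ?_)
  simp only [flux, Pi.add_apply]
  push_cast
  ring

/-- `b₀ u'` is integrable as a product of square integrable functions, and the remaining terms are
square integrable, hence integrable over unit intervals with a uniform bound. -/
theorem exists_dens_bound (S : Coeffs) (hu : IsH1 u u') (hw : MemLp w 2 volume) :
    ∃ L : ℝ, ∀ x, IntegrableOn (S.dens u u' w) (Ioc x (x + 1)) ∧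
      ∫ t in Ioc x (x + 1), ‖S.dens u u' w t‖ ≤ L := by
  have hb0 : MemLp (fun x ↦ (S.b₀ x : ℂ)) 2 volume := S.memLp_b₀.ofReal
  have hb1 : MemLp (fun x ↦ (S.b₁ x : ℂ)) ⊤ volume := S.memLp_b₁.ofReal
  have h1 : Integrable fun x ↦ (S.h : ℂ) * -Complex.I * ((S.b₀ x : ℂ) * u' x) :=
    (hb0.integrable_mul hu.memLp_deriv).const_mul _
  have t1 : MemLp (fun x ↦ (S.b₁ x : ℂ) * u' x) 2 volume := hu.memLp_deriv.mul' hb1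
  have t2 : MemLp (fun x ↦ ((S.V₁ x : ℂ) * (S.β x : ℂ)⁻¹) * u x) 2 volume :=
    hu.memLp.mul' S.memLp_V₁_div
  have t3 : MemLp (fun x ↦ (S.β x : ℂ)⁻¹ * w x) 2 volume := hw.mul' S.memLp_inv_β
  have h2 := (t1.const_mul ((S.h : ℂ) * -Complex.I)).add (t2.sub t3)
  set d₁ := fun x ↦ (S.h : ℂ) * -Complex.I * ((S.b₀ x : ℂ) * u' x) with hd₁
  set d₂ := (fun x ↦ (S.h : ℂ) * -Complex.I * ((S.b₁ x : ℂ) * u' x)) +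
    ((fun x ↦ ((S.V₁ x : ℂ) * (S.β x : ℂ)⁻¹) * u x) - fun x ↦ (S.β x : ℂ)⁻¹ * w x) with hd₂
  have e : S.dens u u' w = fun x ↦ d₁ x + d₂ x := by
    funext x
    simp only [dens, hd₁, hd₂, Pi.add_apply, Pi.sub_apply]
    push_cast
    ring
  refine ⟨(∫ x, ‖d₁ x‖) + √(sqInt d₂), fun x ↦ ?_⟩
  have i1 : IntegrableOn d₁ (Ioc x (x + 1)) := h1.integrableOn
  have i2 : IntegrableOn d₂ (Ioc x (x + 1)) := (h2.restrict _).integrable (by norm_num)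
  rw [e]
  refine ⟨i1.add i2, ?_⟩
  have h3 := Real.le_sqrt_of_sq_le (sq_setIntegral_norm_le h2 x one_pos)
  rw [one_mul] at h3
  have h4 : ∫ t in Ioc x (x + 1), ‖d₁ t‖ ≤ ∫ t, ‖d₁ t‖ :=
    setIntegral_le_integral h1.norm (.of_forall fun _ ↦ norm_nonneg _)
  have h5 : ∫ t in Ioc x (x + 1), ‖d₁ t + d₂ t‖ ≤
      (∫ t in Ioc x (x + 1), ‖d₁ t‖) + ∫ t in Ioc x (x + 1), ‖d₂ t‖ := by
    rw [← integral_add i1.norm i2.norm]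
    exact integral_mono (i1.add i2).norm (i1.norm.add i2.norm) fun t ↦ norm_add_le _ _
  linarith

/-- The flux of an `H¹` solution is bounded. -/
theorem ActsOn.memLp_top_flux (H : S.ActsOn u uc u' f w) (hu : IsH1 uc u')
    (hw : MemLp w 2 volume) : MemLp f ⊤ volume := by
  have hf : MemLp f 2 volume := (S.memLp_flux hu).ae_eq H.2.2.2.1.symm
  obtain ⟨F, hF⟩ := H.integral_flux hw
  obtain ⟨s, hs, hsF⟩ := F.exists_integral_indicator
  obtain ⟨L, hL⟩ := S.exists_dens_bound hu hw
  obtain ⟨C, hC⟩ := hu.exists_bound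
  -- `h (f y - f x)` is the mass of `(x, y]` under `h df`: the absolutely continuous part
  -- contributes at most `L`, the part from `V₀` at most `C / c` times its total mass.
  refine memLp_top_of_oscillation (L := (L + C / S.c * totalMass S.V₀) / S.h) hf hs
    fun x hx y hy hxy ↦ ?_
  set g : ℝ → ℂ := (Ioc x y).indicator fun _ ↦ 1 with hg
  have hg1 : ∀ t, ‖g t‖ ≤ 1 := fun t ↦ by
    by_cases ht : t ∈ Ioc x y <;> simp [hg, ht]
  have h1 := hF g (max |x| |y|) 1 (measurable_const.indicator measurableSet_Ioc) (fun t ht ↦ by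
    rw [hg, indicator_of_notMem]
    intro htx
    exact absurd (abs_le_max_abs_abs htx.1.le htx.2) (not_le.2 ht)) hg1
  rw [hsF x hx y hy hxy.1.le] at h1
  have h2 : ‖∫ t, g t * S.dens uc u' w t‖ ≤ L := by
    have e : ∫ t, g t * S.dens uc u' w t = ∫ t in Ioc x y, S.dens uc u' w t := by
      rw [← integral_indicator measurableSet_Ioc]
      congr 1
      funext t
      by_cases ht : t ∈ Ioc x y <;> simp [hg, ht]
    rw [e]
    refine (norm_integral_le_integral_norm _).trans (le_trans ?_ (hL x).2)
    exact setIntegral_mono_set (hL x).1.norm (.of_forall fun _ ↦ norm_nonneg _)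
      (Ioc_subset_Ioc_right hxy.2).eventuallyLE
  have h3 : ‖signedIntegral S.V₀ fun t ↦ g t * uc t / (S.β t : ℂ)‖ ≤
      C / S.c * totalMass S.V₀ := by
    refine norm_signedIntegral_le _ fun t ↦ (S.norm_div_β_le _ t).trans ?_
    have := S.c_pos
    gcongr
    rw [norm_mul]
    exact (mul_le_of_le_one_left (norm_nonneg _) (hg1 t)).trans (hC t)
  have h4 : S.h * ‖f y - f x‖ ≤ L + C / S.c * totalMass S.V₀ := by
    have : ‖(S.h : ℂ) * (f y - f x)‖ = S.h * ‖f y - f x‖ := by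
      rw [norm_mul, Complex.norm_real, Real.norm_of_nonneg S.h_pos.le]
    rw [← this, h1]
    exact (norm_add_le _ _).trans (add_le_add h2 h3)
  rw [le_div_iff₀ S.h_pos]
  linarith

/-! ### The maximal domain -/

/-- The localisation identity: passing from the pair `(u, χ² ū)` to `(χ u, χ ū)`, the terms linear
in `χ'` either agree in real part or are imaginary. The only error is quadratic in `χ'` and contains
no derivative of `u`. -/
theorem re_integrand_cutoff (S : Coeffs) (u u' : ℝ → ℂ) (χ χ' : ℝ → ℝ) (x : ℝ) :
    (S.integrand (fun x ↦ (χ x : ℂ) * u x) (fun x ↦ (χ' x : ℂ) * u x + χ x * u' x)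
      (fun x ↦ starRingEnd ℂ ((χ x : ℂ) * u x))
      (fun x ↦ starRingEnd ℂ ((χ' x : ℂ) * u x + χ x * u' x)) x).re =
    (S.integrand u u' (fun x ↦ (χ x : ℂ) * starRingEnd ℂ ((χ x : ℂ) * u x))
      (fun x ↦ (χ' x : ℂ) * starRingEnd ℂ ((χ x : ℂ) * u x) +
        (χ x : ℂ) * starRingEnd ℂ ((χ' x : ℂ) * u x + χ x * u' x)) x).re +
      S.h ^ 2 * S.α x * χ' x ^ 2 * ‖u x‖ ^ 2 := by
  rw [← Complex.normSq_eq_norm_sq, Complex.normSq_apply]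
  have e : ∀ z z' : ℂ, ∀ p p' : ℝ, ∀ A B W : ℝ,
      (((A : ℂ) * ((p' : ℂ) * z + p * z') * starRingEnd ℂ ((p' : ℂ) * z + p * z') +
        (B : ℂ) * (Complex.I * ((p : ℂ) * z * starRingEnd ℂ ((p' : ℂ) * z + p * z') -
          ((p' : ℂ) * z + p * z') * starRingEnd ℂ ((p : ℂ) * z))) +
        (W : ℂ) * ((p : ℂ) * z * starRingEnd ℂ ((p : ℂ) * z)))).re =
      ((A : ℂ) * z' * ((p' : ℂ) * starRingEnd ℂ ((p : ℂ) * z) +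
          p * starRingEnd ℂ ((p' : ℂ) * z + p * z')) +
        (B : ℂ) * (Complex.I * (z * ((p' : ℂ) * starRingEnd ℂ ((p : ℂ) * z) +
          p * starRingEnd ℂ ((p' : ℂ) * z + p * z')) -
            z' * ((p : ℂ) * starRingEnd ℂ ((p : ℂ) * z)))) +
        (W : ℂ) * (z * ((p : ℂ) * starRingEnd ℂ ((p : ℂ) * z)))).re +
        A * p' ^ 2 * (z.re * z.re + z.im * z.im) := by
    intro z z' p p' A B W
    simp
    ring
  have h := e (u x) (u' x) (χ x) (χ' x) (S.h ^ 2 * S.α x) (S.h * (S.b₀ x + S.b₁ x))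
    (S.V₁ x / S.β x)
  convert h using 2
  · simp only [integrand, Pi.add_apply]
    push_cast
    ring
  · congr 1
    simp only [integrand, Pi.add_apply]
    push_cast
    ring

/-- Functions of the maximal domain have a square integrable derivative. -/
theorem ActsOn.isH1 (H : S.ActsOn u uc u' f w) (hu : MemLp u 2 volume) (hw : MemLp w 2 volume) :
    IsH1 uc u' := by
  have huc : MemLp uc 2 volume := hu.ae_eq H.2.1
  have hp := H.isPrim
  have hu' := H.locL2_deriv
  obtain ⟨χ, χ', C, hχ⟩ := exists_cutoff
  obtain ⟨κ, Λ, hκ, hΛ, hlow⟩ := S.exists_form_lower_bound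
  obtain ⟨A, hA0, hA⟩ := exists_ae_bound S.memLp_α
  have hc := S.c_pos
  have hN := sqInt_nonneg uc
  -- Bounds the right-hand side tested with `χ² ū` together with the localisation error,
  -- independently of `n`.
  set E := S.c⁻¹ * (sqInt w + sqInt uc) + S.h ^ 2 * A * C ^ 2 * sqInt uc with hE
  refine ⟨hp, huc, ?_⟩
  have hbound : ∀ n : ℕ, ∫ x in Icc (-(n : ℝ)) n, ‖u' x‖ ^ 2 ≤ (Λ * sqInt uc + E) / κ := by
    intro n
    obtain ⟨h1, h2, h3, h4, h5, h6⟩ := hχ n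
    have hH := IsH1.cutoff h1 h2 h4 h5 hp hu'
    set p : ℝ → ℂ := fun x ↦ (χ n x : ℂ) * uc x with hpdef
    set p' : ℝ → ℂ := fun x ↦ (χ' n x : ℂ) * uc x + χ n x * u' x with hp'def
    -- The test function `χ² ū` arises by applying the cut-off once more to the conjugate of `χ u`.
    have hV := IsH1.cutoff h1 h2 h4 h5 hH.conj.prim hH.conj.memLp_deriv.locL2
    have hform := H.form_eq hw hV.prim hV.memLp_deriv.locL2 h2.mul_right
    have hsq : sqInt p ≤ sqInt uc := by
      refine integral_mono (integrable_sq hH.memLp) (integrable_sq huc) fun x ↦ ?_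
      simp only [hpdef, norm_mul, Complex.norm_real, Real.norm_eq_abs]
      gcongr
      exact mul_le_of_le_one_left (norm_nonneg _) (h4 x)
    have hlow' := hlow p p' hH
    have hre : (S.form p p' (fun x ↦ starRingEnd ℂ (p x)) (fun x ↦ starRingEnd ℂ (p' x))).re ≤
        E := by
      have i1 := integrable_integrand (S := S) hH hH.conj
      have i2 := integrable_integrand_of_compact (S := S) hp.continuous hu' hV.prim
        hV.memLp_deriv.locL2 h2.mul_right
      have i3 : Integrable fun x ↦ S.h ^ 2 * A * C ^ 2 * ‖uc x‖ ^ 2 :=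
        (integrable_sq huc).const_mul _
      have l1 : (∫ x, S.integrand p p' (fun x ↦ starRingEnd ℂ (p x))
          (fun x ↦ starRingEnd ℂ (p' x)) x).re ≤ (∫ x, S.integrand uc u'
          (fun x ↦ (χ n x : ℂ) * starRingEnd ℂ (p x)) (fun x ↦ (χ' n x : ℂ) * starRingEnd ℂ (p x) +
          (χ n x : ℂ) * starRingEnd ℂ (p' x)) x).re + S.h ^ 2 * A * C ^ 2 * sqInt uc := by
        have q1 : ∫ x, (S.integrand p p' (fun x ↦ starRingEnd ℂ (p x))
          (fun x ↦ starRingEnd ℂ (p' x)) x).re = _ := integral_re i1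
        have q2 : ∫ x, (S.integrand uc u'
          (fun x ↦ (χ n x : ℂ) * starRingEnd ℂ (p x)) (fun x ↦ (χ' n x : ℂ) * starRingEnd ℂ (p x) +
          (χ n x : ℂ) * starRingEnd ℂ (p' x)) x).re = _ := integral_re i2
        have q3 : ∫ x, S.h ^ 2 * A * C ^ 2 * ‖uc x‖ ^ 2 = S.h ^ 2 * A * C ^ 2 * sqInt uc :=
          integral_const_mul _ _
        refine q1.symm.le.trans (le_trans ?_ (add_le_add q2.le q3.le))
        have i4 := i2.re
        refine le_trans ?_ (integral_add i4 i3).le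
        refine integral_mono_ae i1.re (i4.add i3) ?_
        filter_upwards [hA] with x hx
        have e := S.re_integrand_cutoff uc u' (χ n) (χ' n) x
        refine e.le.trans (add_le_add le_rfl ?_)
        have e2 : χ' n x ^ 2 ≤ C ^ 2 := by
          rw [← sq_abs]
          have := h5 x
          gcongr
        have e3 : S.α x ≤ A := (le_abs_self _).trans hx
        have := S.h_pos
        gcongr
      have l2 : signedIntegral S.V₀ (fun x ↦ p x * starRingEnd ℂ (p x) / (S.β x : ℂ)) =
          signedIntegral S.V₀ (fun x ↦ uc x * ((χ n x : ℂ) * starRingEnd ℂ (p x)) /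
            (S.β x : ℂ)) := by
        congr 1
        funext x
        simp only [hpdef]
        ring
      have l3 : ‖∫ x, w x * ((χ n x : ℂ) * starRingEnd ℂ (p x)) / (S.β x : ℂ)‖ ≤
          S.c⁻¹ * (sqInt w + sqInt uc) := by
        have i5 : Integrable fun x ↦ S.c⁻¹ * (‖w x‖ ^ 2 + ‖uc x‖ ^ 2) :=
          ((integrable_sq hw).add (integrable_sq huc)).const_mul _
        have e : ∫ x, S.c⁻¹ * (‖w x‖ ^ 2 + ‖uc x‖ ^ 2) = S.c⁻¹ * (sqInt w + sqInt uc) := by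
          rw [integral_const_mul]
          congr 1
          exact integral_add (integrable_sq hw) (integrable_sq huc)
        rw [← e]
        refine norm_integral_le_of_norm_le i5 (.of_forall fun x ↦ ?_)
        refine (S.norm_div_β_le _ x).trans ?_
        rw [div_eq_inv_mul]
        refine mul_le_mul_of_nonneg_left ?_ (inv_nonneg.2 hc.le)
        simp only [hpdef, norm_mul, Complex.norm_real, Real.norm_eq_abs, RCLike.norm_conj]
        have hx := h4 x
        have hx0 := abs_nonneg (χ n x)
        have hy : |χ n x| * (|χ n x| * ‖uc x‖) ≤ ‖uc x‖ := by
          rw [← mul_assoc]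
          exact mul_le_of_le_one_left (norm_nonneg _) (mul_le_one₀ hx hx0 hx)
        calc ‖w x‖ * (|χ n x| * (|χ n x| * ‖uc x‖)) ≤ ‖w x‖ * ‖uc x‖ := by gcongr
          _ ≤ _ := by nlinarith [sq_nonneg (‖w x‖ - ‖uc x‖), sq_nonneg (‖w x‖), sq_nonneg ‖uc x‖]
      have l4 := (le_abs_self _).trans ((Complex.abs_re_le_norm _).trans l3)
      rw [← hform, form, Complex.add_re] at l4
      rw [form, Complex.add_re, l2, hE]
      linarith
    have hin : ∫ x in Icc (-(n : ℝ)) n, ‖u' x‖ ^ 2 ≤ sqInt p' := by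
      have e : ∫ x in Icc (-(n : ℝ)) n, ‖u' x‖ ^ 2 = ∫ x in Icc (-(n : ℝ)) n, ‖p' x‖ ^ 2 := by
        refine setIntegral_congr_fun measurableSet_Icc fun x hx ↦ ?_
        have := h6 x (abs_le.2 hx)
        simp [hp'def, this.1, this.2]
      rw [e]
      exact setIntegral_le_integral (integrable_sq hH.memLp_deriv)
        (.of_forall fun _ ↦ by positivity)
    rw [le_div_iff₀ hκ]
    have : Λ * sqInt p ≤ Λ * sqInt uc := by gcongr
    have h9 := mul_le_mul_of_nonneg_left hin hκ.le
    linarith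
  have hcov : AECover volume atTop fun n : ℕ ↦ Icc (-(n : ℝ)) n :=
    aecover_Icc (tendsto_neg_atTop_atBot.comp tendsto_natCast_atTop_atTop)
      tendsto_natCast_atTop_atTop
  have hint : Integrable fun x ↦ ‖u' x‖ ^ 2 := by
    refine hcov.integrable_of_integral_norm_bounded ((Λ * sqInt uc + E) / κ) (fun n ↦ ?_)
      (.of_forall fun n ↦ ?_)
    · exact (hu' n).norm.integrable_sq
    · simpa using hbound n
  refine (memLp_two_iff_integrable_sq_norm hp.locInt.aestronglyMeasurable).2 hint

end Coeffs

/-! ### The weak operator: linearity, symmetry, single-valuedness -/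

theorem IsPrim.eq_of_ae_eq {u u' v v' : ℝ → ℂ} (hu : IsPrim u u') (hv : IsPrim v v')
    (h : u =ᵐ[volume] v) : u = v :=
  (hu.continuous.ae_eq_iff_eq volume hv.continuous).1 h

theorem IsTest.isH1 {φ : ℝ → ℂ} (h : IsTest φ) : IsH1 φ (deriv φ) :=
  ⟨h.isPrim, h.isPrim.continuous.memLp_of_hasCompactSupport h.2,
    (h.1.continuous_deriv (by exact_mod_cast le_top)).memLp_of_hasCompactSupport h.2.deriv⟩

theorem signedIntegral_add (ν : SignedMeasure ℝ) {f g : ℝ → ℂ}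
    (hf : ∀ (μ : Measure ℝ) [IsFiniteMeasure μ], Integrable f μ)
    (hg : ∀ (μ : Measure ℝ) [IsFiniteMeasure μ], Integrable g μ) :
    signedIntegral ν (fun x ↦ f x + g x) = signedIntegral ν f + signedIntegral ν g := by
  simp only [signedIntegral]
  rw [integral_add (hf _) (hg _), integral_add (hf _) (hg _)]
  ring

theorem signedIntegral_const_mul (ν : SignedMeasure ℝ) (c : ℂ) (f : ℝ → ℂ) :
    signedIntegral ν (fun x ↦ c * f x) = c * signedIntegral ν f := by
  simp only [signedIntegral, integral_const_mul]
  ring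

theorem signedIntegral_conj (ν : SignedMeasure ℝ) (f : ℝ → ℂ) :
    signedIntegral ν (fun x ↦ starRingEnd ℂ (f x)) = starRingEnd ℂ (signedIntegral ν f) := by
  simp only [signedIntegral, integral_conj, map_sub]

namespace Coeffs

variable {S : Coeffs} {u u' v v' u₁ u₁' u₂ u₂' v₁ v₁' v₂ v₂' w w₁ w₂ : ℝ → ℂ}

/-- Derivatives matter only almost everywhere, while `u` and `v` stay fixed pointwise because `V₀`
may charge Lebesgue null sets. -/
theorem form_congr (S : Coeffs) (u v : ℝ → ℂ) (hu : u₁' =ᵐ[volume] u₂')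
    (hv : v₁' =ᵐ[volume] v₂') : S.form u u₁' v v₁' = S.form u u₂' v v₂' := by
  rw [form, form]
  congr 1
  refine integral_congr_ae ?_
  filter_upwards [hu, hv] with x h1 h2
  simp only [integrand, h1, h2]

theorem form_add_left (h₁ : IsH1 u₁ u₁') (h₂ : IsH1 u₂ u₂') (hv : IsH1 v v') :
    S.form (fun x ↦ u₁ x + u₂ x) (fun x ↦ u₁' x + u₂' x) v v' =
      S.form u₁ u₁' v v' + S.form u₂ u₂' v v' := by
  have e : (fun x ↦ (u₁ x + u₂ x) * v x / (S.β x : ℂ)) =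
      fun x ↦ u₁ x * v x / (S.β x : ℂ) + u₂ x * v x / (S.β x : ℂ) := by
    funext x; ring
  simp only [form]
  rw [e, signedIntegral_add _ (fun μ _ ↦ S.integrable_mul_div_of_finite μ h₁ hv)
    (fun μ _ ↦ S.integrable_mul_div_of_finite μ h₂ hv), add_add_add_comm,
    ← integral_add (integrable_integrand h₁ hv) (integrable_integrand h₂ hv)]
  congr 2
  funext x
  simp only [integrand]
  ring

theorem form_const_mul_left (S : Coeffs) (c : ℂ) (u u' v v' : ℝ → ℂ) :
    S.form (fun x ↦ c * u x) (fun x ↦ c * u' x) v v' = c * S.form u u' v v' := by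
  have e : (fun x ↦ c * u x * v x / (S.β x : ℂ)) = fun x ↦ c * (u x * v x / (S.β x : ℂ)) := by
    funext x; ring
  simp only [form]
  rw [e, signedIntegral_const_mul, mul_add, ← integral_const_mul]
  congr 2
  funext x
  simp only [integrand]
  ring

/-- The form is hermitian. -/
theorem form_conj (S : Coeffs) (u u' v v' : ℝ → ℂ) :
    S.form u u' (fun x ↦ starRingEnd ℂ (v x)) (fun x ↦ starRingEnd ℂ (v' x)) =
      starRingEnd ℂ (S.form v v' (fun x ↦ starRingEnd ℂ (u x)) (fun x ↦ starRingEnd ℂ (u' x))) := by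
  simp only [form, map_add]
  rw [← integral_conj, ← signedIntegral_conj]
  congr 1
  · congr 1
    funext x
    simp only [integrand, map_add, map_sub, map_mul, map_div₀, map_pow, Complex.conj_conj,
      Complex.conj_ofReal, Complex.conj_I]
    ring
  · congr 1
    funext x
    simp only [map_mul, map_div₀, Complex.conj_conj, Complex.conj_ofReal]
    ring

/-- The weak formulation of `P(h)u = w`. -/
def IsWeak (S : Coeffs) (u w : ℝ → ℂ) : Prop :=
  MemLp w 2 volume ∧ ∃ uc u' : ℝ → ℂ, IsH1 uc u' ∧ u =ᵐ[volume] uc ∧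
    ∀ v v' : ℝ → ℂ, IsH1 v v' → S.form uc u' v v' = ∫ x, w x * v x / (S.β x : ℂ)

/-- The bridge to form methods. Forwards, cut-offs enlarge the class of test functions to `H¹`;
backwards, the flux is reconstructed and its boundedness is automatic. -/
theorem isOp_iff_isWeak (S : Coeffs) (u w : ℝ → ℂ) :
    IsOp S.h S.α S.β (S.b₀ + S.b₁) S.V₀ S.V₁ u w ↔ S.IsWeak u w := by
  constructor
  · rintro ⟨uc, u', f, hA, hu, hu', -, hw⟩
    have H : S.ActsOn u uc u' f w := hA
    have h1 : IsH1 uc u' := ⟨H.isPrim, hu.ae_eq H.2.1, hu'⟩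
    exact ⟨hw, uc, u', h1, H.2.1, fun v v' hv ↦ H.form_eq_of_isH1 h1 hw hv⟩
  · rintro ⟨hw, uc, u', h1, hu, h⟩
    obtain ⟨f, hf⟩ := exists_actsOn h1.prim h1.memLp_deriv.locL2 hw fun φ hφ ↦ h φ _ hφ.isH1
    exact ⟨uc, u', f, ⟨hf.1, hu, hf.2.2⟩, h1.memLp.ae_eq hu.symm, h1.memLp_deriv,
      hf.memLp_top_flux h1 hw, hw⟩

theorem maxDom_eq_dom (S : Coeffs) :
    maxDom S.h S.α S.β (S.b₀ + S.b₁) S.V₀ S.V₁ = dom S.h S.α S.β (S.b₀ + S.b₁) S.V₀ S.V₁ := by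
  ext u
  constructor
  · rintro ⟨uc, u', f, w, hA, hu, hw⟩
    have H : S.ActsOn u uc u' f w := hA
    have h1 := H.isH1 hu hw
    exact ⟨w, uc, u', f, hA, hu, h1.memLp_deriv, H.memLp_top_flux h1 hw, hw⟩
  · rintro ⟨w, uc, u', f, hA, hu, -, -, hw⟩
    exact ⟨uc, u', f, w, hA, hu, hw⟩

theorem IsWeak.congr (h : S.IsWeak u₁ w₁) (hu : u₁ =ᵐ[volume] u₂) (hw : w₁ =ᵐ[volume] w₂) :
    S.IsWeak u₂ w₂ := by
  obtain ⟨h1, uc, u', h2, h3, h4⟩ := h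
  refine ⟨h1.ae_eq hw, uc, u', h2, hu.symm.trans h3, fun v v' hv ↦ (h4 v v' hv).trans ?_⟩
  refine integral_congr_ae ?_
  filter_upwards [hw] with x hx
  rw [hx]

theorem IsWeak.add (h₁ : S.IsWeak u₁ w₁) (h₂ : S.IsWeak u₂ w₂) :
    S.IsWeak (fun x ↦ u₁ x + u₂ x) (fun x ↦ w₁ x + w₂ x) := by
  obtain ⟨a1, uc, u', a2, a3, a4⟩ := h₁
  obtain ⟨b1, vc, v', b2, b3, b4⟩ := h₂
  refine ⟨a1.add b1, _, _, a2.add b2, a3.add b3, fun z z' hz ↦ ?_⟩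
  rw [form_add_left a2 b2 hz, a4 z z' hz, b4 z z' hz,
    ← integral_add (S.integrable_mul_div hz.memLp a1) (S.integrable_mul_div hz.memLp b1)]
  congr 1
  funext x
  ring

theorem IsWeak.const_mul (c : ℂ) (h : S.IsWeak u w) :
    S.IsWeak (fun x ↦ c * u x) (fun x ↦ c * w x) := by
  obtain ⟨a1, uc, u', a2, a3, a4⟩ := h
  refine ⟨a1.const_mul c, _, _, a2.const_mul c, a3.mono fun x hx ↦ by simp only [hx],
    fun z z' hz ↦ ?_⟩
  rw [form_const_mul_left, a4 z z' hz, ← integral_const_mul]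
  congr 1
  funext x
  ring

theorem isWeak_zero (S : Coeffs) : S.IsWeak (fun _ ↦ 0) (fun _ ↦ 0) := by
  have h0 : IsH1 (fun _ ↦ 0) (fun _ ↦ 0) :=
    ⟨⟨locallyIntegrable_zero, fun a b ↦ by simp⟩, MemLp.zero, MemLp.zero⟩
  refine ⟨MemLp.zero, _, _, h0, .rfl, fun v v' _ ↦ ?_⟩
  have := S.form_const_mul_left 0 (fun _ ↦ 0) (fun _ ↦ 0) v v'
  simp only [zero_mul] at this
  simp [this]

/-- Each equation is tested with the conjugate of the other solution, and the form is hermitian. -/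
theorem IsWeak.symm (h₁ : S.IsWeak u₁ w₁) (h₂ : S.IsWeak u₂ w₂) :
    ∫ x, w₁ x * starRingEnd ℂ (u₂ x) / (S.β x : ℂ) =
      ∫ x, u₁ x * starRingEnd ℂ (w₂ x) / (S.β x : ℂ) := by
  obtain ⟨a1, uc, u', a2, a3, a4⟩ := h₁
  obtain ⟨b1, vc, v', b2, b3, b4⟩ := h₂
  have e1 : ∫ x, w₁ x * starRingEnd ℂ (u₂ x) / (S.β x : ℂ) =
      ∫ x, w₁ x * starRingEnd ℂ (vc x) / (S.β x : ℂ) :=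
    integral_congr_ae (b3.mono fun x hx ↦ by simp only [hx])
  have e2 : ∫ x, u₁ x * starRingEnd ℂ (w₂ x) / (S.β x : ℂ) =
      starRingEnd ℂ (∫ x, w₂ x * starRingEnd ℂ (uc x) / (S.β x : ℂ)) := by
    rw [← integral_conj]
    refine integral_congr_ae (a3.mono fun x hx ↦ ?_)
    simp only [hx, map_mul, map_div₀, Complex.conj_conj, Complex.conj_ofReal]
    ring
  rw [e1, e2, ← a4 _ _ b2.conj, ← b4 _ _ a2.conj]
  exact S.form_conj uc u' vc v'

/-- The form vanishes when its first argument does, so `w / β` annihilates all test functions. -/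
theorem IsWeak.eq_zero (h : S.IsWeak u w) (hu : u =ᵐ[volume] 0) : w =ᵐ[volume] 0 := by
  obtain ⟨hw, uc, u', h1, h2, h3⟩ := h
  have h0 : IsPrim (fun _ ↦ 0) (fun _ ↦ 0) := ⟨locallyIntegrable_zero, fun a b ↦ by simp⟩
  have huc : uc = fun _ ↦ 0 := h1.prim.eq_of_ae_eq h0 (h2.symm.trans hu)
  subst huc
  have hu' : u' =ᵐ[volume] fun _ ↦ 0 := h1.prim.deriv_ae_eq h0
  have hform : ∀ v v' : ℝ → ℂ, S.form (fun _ ↦ 0) u' v v' = 0 := fun v v' ↦ by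
    rw [S.form_congr _ v hu' (.refl _ v')]
    simpa using S.form_const_mul_left 0 (fun _ ↦ 0) (fun _ ↦ 0) v v'
  have hl : LocallyIntegrable (fun x ↦ (S.β x : ℂ)⁻¹ * w x) volume :=
    (hw.locL2.top_mul S.memLp_inv_β).locallyIntegrable
  have := ae_eq_zero_of_integral_contDiff_smul_eq_zero hl fun φ hφ hφc ↦ by
    have ht := isTest_ofReal hφ hφc
    rw [← hform _ _, h3 _ _ ht.isH1]
    congr 1
    funext x
    rw [Complex.real_smul]
    ring
  filter_upwards [this] with x hx
  simpa [S.β_ne x] using hx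

/-! ### The weighted space -/

theorem weight_absolutelyContinuous (S : Coeffs) : weight S.β ≪ volume :=
  withDensity_absolutelyContinuous _ _

theorem measurable_density (S : Coeffs) : Measurable fun x ↦ ENNReal.ofReal (S.β x)⁻¹ :=
  S.measurable_β.inv.ennreal_ofReal

theorem absolutelyContinuous_weight (S : Coeffs) : volume ≪ weight S.β :=
  withDensity_absolutelyContinuous' S.measurable_density.aemeasurable
    (.of_forall fun x ↦ by simpa using S.β_pos x)

theorem ae_eq_weight (S : Coeffs) : u =ᵐ[weight S.β] v ↔ u =ᵐ[volume] v :=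
  ⟨fun h ↦ S.absolutelyContinuous_weight.ae_eq h, fun h ↦ S.weight_absolutelyContinuous.ae_eq h⟩

theorem exists_β_le (S : Coeffs) : ∃ B, 0 < B ∧ ∀ᵐ x, S.β x ≤ B := by
  obtain ⟨B, hB, h⟩ := exists_ae_bound S.memLp_β
  exact ⟨B + 1, by linarith, h.mono fun x hx ↦ by linarith [le_abs_self (S.β x)]⟩

/-- The density `1 / β` lies almost everywhere between two positive constants. -/
theorem memLp_weight (S : Coeffs) : MemLp u 2 (weight S.β) ↔ MemLp u 2 volume := by
  constructor
  · intro h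
    obtain ⟨B, hB, hβ⟩ := S.exists_β_le
    refine h.of_measure_le_smul (c := ENNReal.ofReal B) ENNReal.ofReal_ne_top ?_
    rw [weight, ← withDensity_smul _ S.measurable_density]
    nth_rw 1 [← withDensity_one (μ := volume)]
    refine withDensity_mono (hβ.mono fun x hx ↦ ?_)
    simp only [Pi.smul_apply, smul_eq_mul, Pi.one_apply]
    rw [← ENNReal.ofReal_mul hB.le, ← ENNReal.ofReal_one]
    apply ENNReal.ofReal_le_ofReal
    rw [← div_eq_mul_inv, le_div_iff₀ (S.β_pos x)]
    linarith
  · intro h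
    refine h.of_measure_le_smul (c := ENNReal.ofReal S.c⁻¹) ENNReal.ofReal_ne_top ?_
    rw [weight, ← withDensity_const]
    exact withDensity_mono (.of_forall fun x ↦ ENNReal.ofReal_le_ofReal (S.inv_β_le x))

theorem integral_weight (S : Coeffs) (g : ℝ → ℂ) :
    ∫ x, g x ∂weight S.β = ∫ x, g x / (S.β x : ℂ) := by
  rw [weight, integral_withDensity_eq_integral_toReal_smul S.measurable_density
    (.of_forall fun _ ↦ ENNReal.ofReal_lt_top)]
  congr 1
  funext x
  rw [ENNReal.toReal_ofReal (inv_nonneg.2 (S.β_pos x).le), Complex.real_smul, div_eq_inv_mul]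
  push_cast
  rfl

theorem inner_weight (S : Coeffs) (f g : L2 S.β) :
    inner ℂ f g = ∫ x, g x * starRingEnd ℂ (f x) / (S.β x : ℂ) := by
  rw [L2.inner_def, S.integral_weight]
  simp only [RCLike.inner_apply]

/-- The graph of the operator. -/
def graph (S : Coeffs) : Submodule ℂ (L2 S.β × L2 S.β) where
  carrier := {p | S.IsWeak p.1 p.2}
  add_mem' {p q} hp hq := by
    refine (IsWeak.add hp hq).congr ?_ ?_
    · exact (S.ae_eq_weight.1 (Lp.coeFn_add p.1 q.1)).symm
    · exact (S.ae_eq_weight.1 (Lp.coeFn_add p.2 q.2)).symm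
  zero_mem' := by
    refine S.isWeak_zero.congr ?_ ?_ <;>
    · exact (S.ae_eq_weight.1 (Lp.coeFn_zero ℂ 2 (weight S.β))).symm
  smul_mem' c p hp := by
    refine (IsWeak.const_mul c hp).congr ?_ ?_
    · exact (S.ae_eq_weight.1 (Lp.coeFn_smul c p.1)).symm
    · exact (S.ae_eq_weight.1 (Lp.coeFn_smul c p.2)).symm

end Coeffs

/-! ### Abstract Hilbert space lemmas -/

section Hilbert

open scoped InnerProductSpace ComplexConjugate

variable {V : Type*} [NormedAddCommGroup V] [InnerProductSpace ℂ V]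

/-- A hermitian form bounded by a multiple of `‖v‖² + ‖w‖²` is a bounded form. -/
theorem norm_le_mul_of_le_add_sq {b : V → V → ℂ} {K : ℝ}
    (hsmul : ∀ (c : ℂ) v w, b v (c • w) = c * b v w) (hconj : ∀ v w, b v w = conj (b w v))
    (hK : ∀ v w, ‖b v w‖ ≤ K * (‖v‖ ^ 2 + ‖w‖ ^ 2)) (v w : V) : ‖b v w‖ ≤ 2 * K * ‖v‖ * ‖w‖ := by
  have hl : ∀ (c : ℂ) v w, b (c • v) w = conj c * b v w := fun c v w ↦ by
    rw [hconj, hsmul, map_mul, ← hconj]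
  rcases eq_or_ne v 0 with rfl | hv
  · have : b 0 w = 0 := by simpa using hl 0 0 w
    simp [this]
  rcases eq_or_ne w 0 with rfl | hw
  · have : b v 0 = 0 := by simpa using hsmul 0 v 0
    simp [this]
  have hv' := norm_pos_iff.2 hv
  have hw' := norm_pos_iff.2 hw
  -- For unit vectors the bound is `2 K`; homogeneity gives the rest.
  have h := hK (((‖v‖⁻¹ : ℝ) : ℂ) • v) (((‖w‖⁻¹ : ℝ) : ℂ) • w)
  rw [hl, hsmul, norm_smul, norm_smul, norm_mul, norm_mul, RCLike.norm_conj, Complex.norm_real,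
    Complex.norm_real, norm_inv, norm_inv, norm_norm, norm_norm, inv_mul_cancel₀ hv'.ne',
    inv_mul_cancel₀ hw'.ne'] at h
  have e : ‖v‖⁻¹ * (‖w‖⁻¹ * ‖b v w‖) = ‖b v w‖ / (‖v‖ * ‖w‖) := by
    field_simp
  rw [e, div_le_iff₀ (by positivity)] at h
  linarith

variable [CompleteSpace V]

/-- The Lax–Milgram theorem for hermitian forms. -/
theorem exists_forall_eq_inner {b : V → V → ℂ} {K κ : ℝ}
    (hadd : ∀ v w w', b v (w + w') = b v w + b v w')
    (hsmul : ∀ (c : ℂ) v w, b v (c • w) = c * b v w) (hconj : ∀ v w, b v w = conj (b w v))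
    (hK : ∀ v w, ‖b v w‖ ≤ K * (‖v‖ ^ 2 + ‖w‖ ^ 2)) (hκ : 0 < κ)
    (hcoe : ∀ v, κ * ‖v‖ ^ 2 ≤ (b v v).re) (r : V) : ∃ v, ∀ w, b w v = ⟪w, r⟫_ℂ := by
  let B₀ : V →ₗ⋆[ℂ] V →ₗ[ℂ] ℂ := LinearMap.mk₂'ₛₗ (starRingEnd ℂ) (RingHom.id ℂ) b
    (fun v v' w ↦ by rw [hconj, hadd, map_add, ← hconj, ← hconj])
    (fun c v w ↦ by rw [hconj, hsmul, map_mul, ← hconj, smul_eq_mul])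
    hadd (fun c v w ↦ hsmul c v w)
  let B : V →L⋆[ℂ] V →L[ℂ] ℂ := B₀.mkContinuous₂ (2 * K) (norm_le_mul_of_le_add_sq hsmul hconj hK)
  let T := InnerProductSpace.continuousLinearMapOfBilin B
  have hT : ∀ v w, ⟪T v, w⟫_ℂ = b v w := fun v w ↦
    InnerProductSpace.continuousLinearMapOfBilin_apply B v w
  have hbelow : ∀ v, κ * ‖v‖ ≤ ‖T v‖ := fun v ↦ by
    rcases eq_or_ne v 0 with rfl | hv
    · simp
    refine le_of_mul_le_mul_right ?_ (norm_pos_iff.2 hv)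
    calc κ * ‖v‖ * ‖v‖ = κ * ‖v‖ ^ 2 := by ring
      _ ≤ (b v v).re := hcoe v
      _ = (⟪T v, v⟫_ℂ).re := by rw [hT]
      _ ≤ ‖⟪T v, v⟫_ℂ‖ := Complex.re_le_norm _
      _ ≤ ‖T v‖ * ‖v‖ := norm_inner_le_norm _ _
  have hanti : AntilipschitzWith (κ⁻¹).toNNReal T := T.antilipschitz_of_bound fun v ↦ by
    rw [Real.coe_toNNReal _ (inv_pos.2 hκ).le, ← div_eq_inv_mul, le_div_iff₀ hκ, mul_comm]
    exact hbelow v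
  -- `T` is bounded below, so its range is closed. A vector `w` orthogonal to the range has `b w w =
  -- 0` and vanishes by coercivity.
  have hclosed : IsClosed (T.range : Set V) := hanti.isClosed_range T.uniformContinuous
  have hrange : T.range = ⊤ := by
    have := hclosed.completeSpace_coe
    rw [← T.range.orthogonal_orthogonal, Submodule.eq_top_iff']
    intro v w hw
    have h0 : b w w = 0 := by rw [← hT]; exact hw _ ⟨w, rfl⟩
    have h1 := hcoe w
    rw [h0, Complex.zero_re] at h1
    have h2 : ‖w‖ ^ 2 ≤ 0 := nonpos_of_mul_nonpos_right h1 hκ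
    obtain rfl : w = 0 := by
      rw [← norm_eq_zero]
      exact pow_eq_zero_iff two_ne_zero |>.1 (le_antisymm h2 (by positivity))
    exact inner_zero_left _
  obtain ⟨v, hv⟩ : r ∈ T.range := hrange ▸ Submodule.mem_top
  refine ⟨v, fun w ↦ ?_⟩
  rw [hconj, ← hT, inner_conj_symm]
  exact congrArg _ hv

variable {Γ : Submodule ℂ (V × V)}

/-- The domain of a symmetric graph is dense if a shift of it is surjective. -/
theorem dense_domain (hsymm : ∀ p ∈ Γ, ∀ q ∈ Γ, ⟪p.2, q.1⟫_ℂ = ⟪p.1, q.2⟫_ℂ)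
    (hsingle : ∀ p ∈ Γ, p.1 = 0 → p.2 = 0) {l : ℝ}
    (hsurj : ∀ g, ∃ p ∈ Γ, p.2 + (l : ℂ) • p.1 = g) :
    Dense (Γ.map (LinearMap.fst ℂ V V) : Set V) := by
  rw [Submodule.dense_iff_topologicalClosure_eq_top, Submodule.topologicalClosure_eq_top_iff,
    Submodule.eq_bot_iff]
  intro v hv
  obtain ⟨p, hp, rfl⟩ := hsurj v
  -- The vector orthogonal to the domain has been written as `p.2 + l p.1`. By symmetry `p.1` is
  -- then orthogonal to the range of the shift, which is everything.
  have key : ∀ q ∈ Γ, ⟪q.2 + (l : ℂ) • q.1, p.1⟫_ℂ = 0 := fun q hq ↦ by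
    have h1 := hv q.1 ⟨q, hq, rfl⟩
    rw [inner_add_right, inner_smul_right] at h1
    rw [inner_add_left, inner_smul_left, hsymm q hq p hp, Complex.conj_ofReal, h1]
  have hp1 : p.1 = 0 := by
    obtain ⟨q, hq, e⟩ := hsurj p.1
    have := key q hq
    rwa [e, inner_self_eq_zero] at this
  rw [hsingle p hp hp1, hp1, smul_zero, add_zero]

/-- The operator with a symmetric graph is self-adjoint if a shift of it is surjective. -/
theorem isSelfAdjoint_toLinearPMap (hsymm : ∀ p ∈ Γ, ∀ q ∈ Γ, ⟪p.2, q.1⟫_ℂ = ⟪p.1, q.2⟫_ℂ)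
    (hsingle : ∀ p ∈ Γ, p.1 = 0 → p.2 = 0) {l : ℝ}
    (hsurj : ∀ g, ∃ p ∈ Γ, p.2 + (l : ℂ) • p.1 = g) : IsSelfAdjoint Γ.toLinearPMap := by
  set A := Γ.toLinearPMap with hA
  have hgraph : ∀ u : A.domain, ((u : V), A u) ∈ Γ := fun u ↦ by
    rw [← Submodule.toLinearPMap_graph_eq Γ hsingle]
    exact A.mem_graph u
  have hmem : ∀ p ∈ Γ, ∃ u : A.domain, (u : V) = p.1 ∧ A u = p.2 := fun p hp ↦ by
    rw [← Submodule.toLinearPMap_graph_eq Γ hsingle, LinearPMap.mem_graph_iff] at hp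
    exact hp
  have hdense : Dense (A.domain : Set V) := by
    rw [hA, Submodule.toLinearPMap_domain]
    exact dense_domain hsymm hsingle hsurj
  have hformal : A.IsFormalAdjoint A := fun u v ↦ hsymm _ (hgraph u) _ (hgraph v)
  rw [LinearPMap.isSelfAdjoint_def]
  refine (LinearPMap.eq_of_le_of_domain_eq (hformal.le_adjoint hdense) ?_).symm
  refine le_antisymm (hformal.le_adjoint hdense).1 fun y hy ↦ ?_
  -- Solve `(A + l) u = (A* + l) y` within the domain of `A`. As `l` is real, `y - u` is orthogonal
  -- to the range of `A + l`, hence zero.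
  obtain ⟨p, hp, e⟩ := hsurj (LinearPMap.adjoint A ⟨y, hy⟩ + (l : ℂ) • y)
  obtain ⟨u, hu1, hu2⟩ := hmem p hp
  have hadj := LinearPMap.adjoint_isFormalAdjoint hdense
  suffices y = u by rw [this]; exact u.2
  rw [← sub_eq_zero]
  obtain ⟨q, hq, e'⟩ := hsurj (y - u)
  obtain ⟨z, hz1, hz2⟩ := hmem q hq
  rw [← inner_self_eq_zero (𝕜 := ℂ)]
  nth_rw 2 [← e']
  have h1 : ⟪LinearPMap.adjoint A ⟨y, hy⟩, (z : V)⟫_ℂ = ⟪y, A z⟫_ℂ := hadj ⟨y, hy⟩ z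
  have h2 : ⟪A u, (z : V)⟫_ℂ = ⟪(u : V), A z⟫_ℂ := hformal u z
  have h3 : ⟪LinearPMap.adjoint A ⟨y, hy⟩ + (l : ℂ) • y, (z : V)⟫_ℂ =
      ⟪A u + (l : ℂ) • (u : V), (z : V)⟫_ℂ := by rw [← e, hu1, hu2]
  rw [inner_add_left, inner_add_left, inner_smul_left, inner_smul_left, h1, h2,
    Complex.conj_ofReal] at h3
  rw [← hz1, ← hz2, inner_sub_left, inner_add_right, inner_add_right, inner_smul_right,
    inner_smul_right, h3, sub_self]

end Hilbert

/-! ### The Sobolev space -/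

/-- Pairs of square integrable functions. -/
abbrev Pair : Type := WithLp 2 (Lp ℂ 2 (volume : Measure ℝ) × Lp ℂ 2 (volume : Measure ℝ))

theorem sqInt_eq_norm_sq (f : Lp ℂ 2 (volume : Measure ℝ)) : sqInt f = ‖f‖ ^ 2 := by
  rw [← @inner_self_eq_norm_sq ℂ, L2.inner_def, sqInt, ← integral_re (L2.integrable_inner f f)]
  congr 1
  funext x
  rw [inner_self_eq_norm_sq]

theorem sqInt_congr {u v : ℝ → ℂ} (h : u =ᵐ[volume] v) : sqInt u = sqInt v :=
  integral_congr_ae (h.mono fun x hx ↦ by simp only [hx])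

theorem IsTest.memLp_conj {φ : ℝ → ℂ} (h : IsTest φ) :
    MemLp (fun x ↦ starRingEnd ℂ (φ x)) 2 volume := h.isH1.conj.memLp

theorem IsTest.memLp_conj_deriv {φ : ℝ → ℂ} (h : IsTest φ) :
    MemLp (fun x ↦ starRingEnd ℂ (deriv φ x)) 2 volume := h.isH1.conj.memLp_deriv

/-- The pairs which are orthogonal to the Sobolev functions with their derivatives. -/
def testPairs : Set Pair :=
  {t | ∃ (φ : ℝ → ℂ) (h : IsTest φ),
    t = WithLp.toLp 2 (h.memLp_conj_deriv.toLp _, h.memLp_conj.toLp _)}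

/-- The Sobolev space `H¹(ℝ)`, as the space of pairs `(u, u')`. -/
noncomputable def sobolev : Submodule ℂ Pair := (Submodule.span ℂ testPairs)ᗮ

theorem inner_testPair {φ : ℝ → ℂ} (h : IsTest φ) (p : Pair) :
    inner ℂ (WithLp.toLp 2 (h.memLp_conj_deriv.toLp _, h.memLp_conj.toLp _)) p =
      (∫ x, p.fst x * deriv φ x) + ∫ x, p.snd x * φ x := by
  rw [WithLp.prod_inner_apply, L2.inner_def, L2.inner_def]
  congr 1
  · refine integral_congr_ae ?_
    filter_upwards [h.memLp_conj_deriv.coeFn_toLp] with x hx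
    simp [RCLike.inner_apply, hx]
  · refine integral_congr_ae ?_
    filter_upwards [h.memLp_conj.coeFn_toLp] with x hx
    simp [RCLike.inner_apply, hx]

/-- Orthogonality to the test pairs says `∫ u φ' + ∫ u' φ = 0`, the definition of the weak
derivative; the continuous representative then comes from the du Bois-Reymond lemma. -/
theorem mem_sobolev {p : Pair} :
    p ∈ sobolev ↔ ∃ u, IsH1 u p.snd ∧ p.fst =ᵐ[volume] u := by
  have h1 : p ∈ sobolev ↔ ∀ φ, IsTest φ → ∫ x, p.fst x * deriv φ x = -∫ x, p.snd x * φ x := by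
    rw [sobolev, Submodule.mem_orthogonal]
    constructor
    · intro h φ hφ
      have := h _ (Submodule.subset_span ⟨φ, hφ, rfl⟩)
      rw [inner_testPair hφ] at this
      exact eq_neg_of_add_eq_zero_left this
    · intro h t ht
      induction ht using Submodule.span_induction with
      | mem t ht =>
        obtain ⟨φ, hφ, rfl⟩ := ht
        rw [inner_testPair hφ, h φ hφ, neg_add_cancel]
      | zero => exact inner_zero_left _
      | add s t _ _ hs ht => rw [inner_add_left, hs, ht, add_zero]
      | smul c t _ ht => rw [inner_smul_left, ht, mul_zero]
  have hl : ∀ f : Lp ℂ 2 (volume : Measure ℝ), LocallyIntegrable f volume := fun f ↦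
    (Lp.memLp f).locallyIntegrable (by norm_num)
  rw [h1]
  constructor
  · intro h
    obtain ⟨u, hu, e⟩ := exists_isPrim (hl p.fst) (hl p.snd) h
    exact ⟨u, ⟨hu, (Lp.memLp p.fst).ae_eq e, Lp.memLp p.snd⟩, e⟩
  · rintro ⟨u, hu, e⟩ φ hφ
    rw [← hu.prim.isWeakDeriv.2.2 φ hφ]
    exact integral_congr_ae (e.mono fun x hx ↦ by simp only [hx])

/-- The continuous representative. -/
noncomputable def rep (p : sobolev) : ℝ → ℂ := (mem_sobolev.1 p.2).choose

theorem isH1_rep (p : sobolev) : IsH1 (rep p) (p : Pair).snd :=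
  (mem_sobolev.1 p.2).choose_spec.1

theorem ae_eq_rep (p : sobolev) : (p : Pair).fst =ᵐ[volume] rep p :=
  (mem_sobolev.1 p.2).choose_spec.2

theorem rep_eq {p : sobolev} {u u' : ℝ → ℂ} (hu : IsPrim u u')
    (h : (p : Pair).fst =ᵐ[volume] u) : rep p = u :=
  (isH1_rep p).prim.eq_of_ae_eq hu ((ae_eq_rep p).symm.trans h)

theorem rep_add (p q : sobolev) : rep (p + q) = fun x ↦ rep p x + rep q x :=
  rep_eq ((isH1_rep p).add (isH1_rep q)).prim
    ((Lp.coeFn_add (p : Pair).fst (q : Pair).fst).trans ((ae_eq_rep p).add (ae_eq_rep q)))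

theorem rep_smul (c : ℂ) (p : sobolev) : rep (c • p) = fun x ↦ c * rep p x :=
  rep_eq ((isH1_rep p).const_mul c).prim
    ((Lp.coeFn_smul c (p : Pair).fst).trans ((ae_eq_rep p).mono fun x hx ↦ by simp [hx]))

theorem norm_sq_eq_sqInt (p : sobolev) :
    ‖p‖ ^ 2 = sqInt (rep p) + sqInt (p : Pair).snd := by
  rw [← sqInt_congr (ae_eq_rep p), sqInt_eq_norm_sq, sqInt_eq_norm_sq,
    ← WithLp.prod_norm_sq_eq_of_L2]
  rfl

theorem exists_rep {u u' : ℝ → ℂ} (h : IsH1 u u') :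
    ∃ p : sobolev, rep p = u ∧ (p : Pair).snd =ᵐ[volume] u' := by
  have h1 := h.memLp.coeFn_toLp
  have h2 := h.memLp_deriv.coeFn_toLp
  have hp : WithLp.toLp 2 (h.memLp.toLp _, h.memLp_deriv.toLp _) ∈ sobolev :=
    mem_sobolev.2 ⟨u, ⟨h.prim.congr_deriv h2.symm, h.memLp, Lp.memLp _⟩, h1⟩
  exact ⟨⟨_, hp⟩, rep_eq h.prim h1, h2⟩

/-! ### Solving the shifted equation -/

namespace Coeffs

variable {S : Coeffs} {u u' v v' w : ℝ → ℂ}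

/-- A coercive form is solvable. -/
theorem exists_isWeak_of_coercive {κ : ℝ} (hκ : 0 < κ)
    (hcoe : ∀ u u', IsH1 u u' → κ * (sqInt u + sqInt u') ≤
      (S.form u u' (fun x ↦ starRingEnd ℂ (u x)) fun x ↦ starRingEnd ℂ (u' x)).re)
    (hw : MemLp w 2 volume) : ∃ u, S.IsWeak u w := by
  -- An orthogonal complement is closed, so completeness needs no separate argument.
  have : CompleteSpace sobolev := inferInstanceAs (CompleteSpace (Submodule.span ℂ testPairs)ᗮ)
  obtain ⟨K, hK0, hK⟩ := S.exists_form_bound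
  let b : sobolev → sobolev → ℂ := fun p q ↦ S.form (rep q) (q : Pair).snd
    (fun x ↦ starRingEnd ℂ (rep p x)) fun x ↦ starRingEnd ℂ ((p : Pair).snd x)
  have hwβ : MemLp (fun x ↦ (S.β x : ℂ)⁻¹ * w x) 2 volume := hw.mul' S.memLp_inv_β
  -- Pairing with `w / β` is the inner product with `X`; its orthogonal projection represents the
  -- same functional inside the Sobolev space.
  let X : Pair := WithLp.toLp 2 (hwβ.toLp _, 0)
  have sq_conj : ∀ f : ℝ → ℂ, sqInt (fun x ↦ starRingEnd ℂ (f x)) = sqInt f := fun f ↦ by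
    simp only [sqInt, RCLike.norm_conj]
  obtain ⟨p, hp⟩ := exists_forall_eq_inner (b := b) (K := K) (κ := κ)
    (fun p q q' ↦ by
      simp only [b]
      rw [← form_add_left (isH1_rep q) (isH1_rep q') (isH1_rep p).conj, rep_add]
      exact S.form_congr _ _ (Lp.coeFn_add (q : Pair).snd (q' : Pair).snd) .rfl)
    (fun c p q ↦ by
      simp only [b]
      rw [← form_const_mul_left, rep_smul]
      exact S.form_congr _ _ (Lp.coeFn_smul c (q : Pair).snd) .rfl)
    (fun p q ↦ S.form_conj _ _ _ _)
    (fun p q ↦ by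
      have := hK _ _ _ _ (isH1_rep q) (isH1_rep p).conj
      rw [sq_conj, sq_conj, ← norm_sq_eq_sqInt, ← norm_sq_eq_sqInt, add_comm (‖q‖ ^ 2)] at this
      exact this)
    hκ (fun p ↦ by
      rw [norm_sq_eq_sqInt]
      exact hcoe _ _ (isH1_rep p)) (sobolev.orthogonalProjectionOnto X)
  refine ⟨rep p, hw, _, _, isH1_rep p, .rfl, fun v v' hv ↦ ?_⟩
  obtain ⟨q, hq, hq'⟩ := exists_rep hv.conj
  have h1 : b q p = inner ℂ (q : Pair) X := by
    rw [hp q]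
    exact Submodule.inner_orthogonalProjectionOnto_eq_of_mem_left q X
  have h2 : b q p = S.form (rep p) (p : Pair).snd v v' := by
    simp only [b, hq, Complex.conj_conj]
    exact S.form_congr _ _ .rfl (hq'.mono fun x hx ↦ by simp [hx])
  rw [← h2, h1, WithLp.prod_inner_apply, inner_zero_right, add_zero, L2.inner_def]
  refine integral_congr_ae ?_
  filter_upwards [hwβ.coeFn_toLp, ae_eq_rep q] with x hx hx'
  rw [RCLike.inner_apply]
  have hX : X.ofLp.1 x = (S.β x : ℂ)⁻¹ * w x := hx
  have hq1 : (q : Pair).ofLp.1 x = rep q x := hx'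
  rw [hX, hq1, hq, Complex.conj_conj]
  ring

/-- The coefficients of the operator `P(h) + l`. -/
noncomputable def shift (S : Coeffs) (l : ℝ) : Coeffs where
  __ := S
  V₁ := fun x ↦ S.V₁ x + l
  memLp_V₁ := S.memLp_V₁.add (memLp_top_const l)

theorem form_shift (S : Coeffs) (l : ℝ) (hu : IsH1 u u') (hv : IsH1 v v') :
    (S.shift l).form u u' v v' = S.form u u' v v' + l * ∫ x, u x * v x / (S.β x : ℂ) := by
  have h1 := integrable_integrand (S := S) hu hv
  have h2 := (S.integrable_mul_div hv.memLp hu.memLp).const_mul (l : ℂ)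
  have e : (S.shift l).integrand u u' v v' =
      fun x ↦ S.integrand u u' v v' x + l * (u x * v x / (S.β x : ℂ)) := by
    funext x
    simp only [integrand, shift]
    push_cast
    ring
  rw [form, e, integral_add h1 h2, integral_const_mul, form]
  simp only [shift]
  ring

theorem IsWeak.of_shift {l : ℝ} (h : (S.shift l).IsWeak u w) :
    S.IsWeak u fun x ↦ w x - l * u x := by
  obtain ⟨hw, uc, u', h1, h2, h3⟩ := h
  have hu : MemLp u 2 volume := h1.memLp.ae_eq h2.symm
  refine ⟨hw.sub (hu.const_mul _), uc, u', h1, h2, fun v v' hv ↦ ?_⟩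
  have h4 := h3 v v' hv
  rw [form_shift _ _ h1 hv] at h4
  have h5 : ∫ x, u x * v x / (S.β x : ℂ) = ∫ x, uc x * v x / (S.β x : ℂ) :=
    integral_congr_ae (h2.mono fun x hx ↦ by simp only [hx])
  rw [eq_sub_of_add_eq h4, ← h5, ← integral_const_mul]
  rw [← integral_sub (by exact S.integrable_mul_div hv.memLp hw)
    ((S.integrable_mul_div hv.memLp hu).const_mul _)]
  congr 1
  funext x
  simp only [shift]
  ring

/-- Coercivity lacks `(Λ + κ) ‖u‖²`. The shift contributes `l ∫ ‖u‖² / β ≥ (l / B) ‖u‖²`, whence `l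
= B (Λ + κ)`. -/
theorem exists_shift_surjective (S : Coeffs) :
    ∃ l : ℝ, ∀ w, MemLp w 2 volume → ∃ u, (S.shift l).IsWeak u w := by
  obtain ⟨κ, Λ, hκ, hΛ, h⟩ := S.exists_form_lower_bound
  obtain ⟨B, hB, hβ⟩ := S.exists_β_le
  refine ⟨B * (Λ + κ), fun w hw ↦ exists_isWeak_of_coercive hκ (fun u u' hu ↦ ?_) hw⟩
  have h1 : (∫ x, u x * starRingEnd ℂ (u x) / (S.β x : ℂ)).re = ∫ x, ‖u x‖ ^ 2 / S.β x := by
    rw [← RCLike.re_eq_complex_re, ← integral_re (S.integrable_mul_div hu.conj.memLp hu.memLp)]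
    congr 1
    funext x
    rw [Complex.mul_conj, ← Complex.ofReal_div, Complex.normSq_eq_norm_sq]
    exact Complex.ofReal_re _
  have hint : Integrable fun x ↦ ‖u x‖ ^ 2 / S.β x := by
    have := (S.integrable_mul_div hu.conj.memLp hu.memLp).re
    refine this.congr (.of_forall fun x ↦ ?_)
    simp only
    rw [Complex.mul_conj, ← Complex.ofReal_div, Complex.normSq_eq_norm_sq]
    exact Complex.ofReal_re _
  have h2 : B⁻¹ * sqInt u ≤ ∫ x, ‖u x‖ ^ 2 / S.β x := by
    rw [sqInt, ← integral_const_mul]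
    refine integral_mono_ae ((integrable_sq hu.memLp).const_mul _) hint (hβ.mono fun x hx ↦ ?_)
    simp only
    rw [inv_mul_eq_div]
    exact div_le_div_of_nonneg_left (by positivity) (S.β_pos x) hx
  rw [form_shift _ _ hu hu.conj, Complex.add_re, Complex.re_ofReal_mul, h1]
  have h3 : (Λ + κ) * sqInt u ≤ B * (Λ + κ) * ∫ x, ‖u x‖ ^ 2 / S.β x := by
    calc (Λ + κ) * sqInt u = B * (Λ + κ) * (B⁻¹ * sqInt u) := by field_simp
      _ ≤ _ := by gcongr
  linarith [h u u' hu]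

theorem graph_symm {p q : L2 S.β × L2 S.β} (hp : p ∈ S.graph) (hq : q ∈ S.graph) :
    inner ℂ p.2 q.1 = inner ℂ p.1 q.2 := by
  rw [inner_weight, inner_weight]
  exact (IsWeak.symm hq hp).symm

theorem graph_single {p : L2 S.β × L2 S.β} (hp : p ∈ S.graph) (h : p.1 = 0) : p.2 = 0 := by
  refine Lp.ext (((S.ae_eq_weight).2 (IsWeak.eq_zero hp ?_)).trans (Lp.coeFn_zero _ _ _).symm)
  rw [h]
  exact S.ae_eq_weight.1 (Lp.coeFn_zero _ _ _)

theorem exists_graph_shift_surjective (S : Coeffs) :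
    ∃ l : ℝ, ∀ g, ∃ p ∈ S.graph, p.2 + (l : ℂ) • p.1 = g := by
  obtain ⟨l, hl⟩ := S.exists_shift_surjective
  refine ⟨l, fun g ↦ ?_⟩
  have hg : MemLp g 2 volume := S.memLp_weight.1 (Lp.memLp g)
  obtain ⟨u, hu⟩ := hl g hg
  have hu2 : MemLp u 2 (weight S.β) := by
    obtain ⟨-, uc, u', h1, h2, -⟩ := hu
    exact S.memLp_weight.2 (h1.memLp.ae_eq h2.symm)
  have hu1 : hu2.toLp u =ᵐ[volume] u := S.ae_eq_weight.1 hu2.coeFn_toLp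
  refine ⟨(hu2.toLp u, g - (l : ℂ) • hu2.toLp u), ?_, sub_add_cancel _ _⟩
  refine hu.of_shift.congr hu1.symm ?_
  filter_upwards [hu1, S.ae_eq_weight.1 (Lp.coeFn_sub g ((l : ℂ) • hu2.toLp u)),
    S.ae_eq_weight.1 (Lp.coeFn_smul (l : ℂ) (hu2.toLp u))] with x h1 h2 h3
  simp only [h2, Pi.sub_apply, h3, Pi.smul_apply, h1, smul_eq_mul]

theorem coe_map_graph (S : Coeffs) :
    (S.graph.map (LinearMap.fst ℂ (L2 S.β) (L2 S.β)) : Set (L2 S.β)) =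
      dom S.h S.α S.β (S.b₀ + S.b₁) S.V₀ S.V₁ := by
  ext u
  constructor
  · rintro ⟨p, hp, rfl⟩
    exact ⟨p.2, (S.isOp_iff_isWeak _ _).2 hp⟩
  · rintro ⟨w, hw⟩
    have h1 := (S.isOp_iff_isWeak _ _).1 hw
    have h2 := S.memLp_weight.2 h1.1
    exact ⟨(u, h2.toLp w), h1.congr .rfl (S.ae_eq_weight.1 h2.coeFn_toLp).symm, rfl⟩

end Coeffs

end MagSchr

/-! ### Self-adjointness and equality of the domains -/

theorem lemmaA1 (h : ℝ) (hh : 0 < h)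
    (α β b₀ b₁ V₁ : ℝ → ℝ) (V₀ : MeasureTheory.SignedMeasure ℝ)
    (hα : MeasureTheory.MemLp α ⊤ MeasureTheory.volume)
    (hα_inf : ∃ c : ℝ, 0 < c ∧ ∀ᵐ x ∂(MeasureTheory.volume : MeasureTheory.Measure ℝ), c ≤ α x)
    (hβ_meas : Measurable β)
    (hβ : MeasureTheory.MemLp β ⊤ MeasureTheory.volume)
    (hβ_inf : ∃ c : ℝ, 0 < c ∧ ∀ x, c ≤ β x)
    (hV₁ : MeasureTheory.MemLp V₁ ⊤ MeasureTheory.volume)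
    (hb₀ : MeasureTheory.MemLp b₀ 2 MeasureTheory.volume)
    (hb₁ : MeasureTheory.MemLp b₁ ⊤ MeasureTheory.volume) :
    Dense (MagSchr.dom h α β (b₀ + b₁) V₀ V₁) ∧
    (∃ P : MagSchr.L2 β →ₗ.[ℂ] MagSchr.L2 β,
      (P.domain : Set (MagSchr.L2 β)) = MagSchr.dom h α β (b₀ + b₁) V₀ V₁ ∧
      (∀ (u : P.domain) (w : MagSchr.L2 β),
        P u = w ↔ MagSchr.IsOp h α β (b₀ + b₁) V₀ V₁ (u : MagSchr.L2 β) w) ∧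
      IsSelfAdjoint P) ∧
    MagSchr.maxDom h α β (b₀ + b₁) V₀ V₁ = MagSchr.dom h α β (b₀ + b₁) V₀ V₁ := by

  obtain ⟨a, ha, hα'⟩ := hα_inf
  obtain ⟨c, hc, hβ'⟩ := hβ_inf
  let S : MagSchr.Coeffs :=
    { h := h, α := α, β := β, b₀ := b₀, b₁ := b₁, V₁ := V₁, V₀ := V₀, h_pos := hh
      memLp_α := hα, a := a, a_pos := ha, a_le := hα', measurable_β := hβ_meas, memLp_β := hβ
      c := c, c_pos := hc, c_le := hβ', memLp_V₁ := hV₁, memLp_b₀ := hb₀, memLp_b₁ := hb₁ }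
  obtain ⟨l, hl⟩ := S.exists_graph_shift_surjective
  have hsymm : ∀ p ∈ S.graph, ∀ q ∈ S.graph, inner ℂ p.2 q.1 = inner ℂ p.1 q.2 :=
    fun p hp q hq ↦ MagSchr.Coeffs.graph_symm hp hq
  have hsingle : ∀ p ∈ S.graph, p.1 = 0 → p.2 = 0 := fun p hp ↦ MagSchr.Coeffs.graph_single hp
  refine ⟨?_, ⟨S.graph.toLinearPMap, ?_, fun u w ↦ ?_, ?_⟩, S.maxDom_eq_dom⟩
  · have := MagSchr.dense_domain hsymm hsingle hl
    rwa [S.coe_map_graph] at this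
  · rw [Submodule.toLinearPMap_domain]
    exact S.coe_map_graph
  · have hu : ((u : MagSchr.L2 β), S.graph.toLinearPMap u) ∈ S.graph := by
      have := S.graph.toLinearPMap.mem_graph u
      rwa [Submodule.toLinearPMap_graph_eq _ hsingle] at this
    refine Iff.trans ?_ (S.isOp_iff_isWeak _ _).symm
    constructor
    · rintro rfl
      exact hu
    -- Two values at the same `u` differ by the second entry of a graph element whose first entry is
    -- zero.
    · intro hw
      have h2 : ((u : MagSchr.L2 β), w) ∈ S.graph := hw
      have h3 := S.graph.sub_mem hu h2
      exact sub_eq_zero.1 (hsingle _ h3 (sub_self _))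
  · exact MagSchr.isSelfAdjoint_toLinearPMap hsymm hsingle hl
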